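/- Let $G$ be a finite simple bipartite plane graph with color classes black and white, and let $s_0\neq s_1$ be two vertices on the boundary of the outer face $F_{\mathrm{out}}$ of $G$ (the special vertices). An angle of $G$ is a pair of consecutive edges around a vertex. A generalized strong labeling of $G$ is a map from the angles of $G$ to $\{0,1\}$ such that: - (G0) for $i\in\{0,1\}$, all angles at $s_i$ are labeled $i$; - (G1) for each vertex $v\notin\{s_0,s_1\}$, the labels around $v$ form, in cyclic order, a non-empty interval of $1$s and a non-empty interval of $0$s; - (G2$^+$) for each edge, traversed from its white end $w$ to its black end $b$, let $w_L,b_L$ be the labels at $w$ and $b$ on the left of the edge and $w_R,b_R$ those on its right; then for some $i\in\{0,1\}$, with $\bar i=1-i$, the quadruple $(w_L,b_L,w_R,b_R)$ is one of $(\bar i,i,i,i)$, $(i,\bar i,i,i)$, $(i,\bar i,\bar i,i)$ (six patterns in all: the four types in which the labels coincide at exactly one endpoint and coincide on the right side of the edge only, and two types of bidirected edges, in which the labels differ at both endpoints and on both sides); - (G3$^+$) each face (including $F_{\mathrm{out}}$) has exactly one pair of adjacent $0$-labels and exactly one pair of adjacent $1$-labels (adjacent: at the two ends of an edge, on the same side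 of it). In addition, the edge on the outer face which contains $s_0$ and which has $F_{\mathrm{out}}$ on its right when traversed from its white end to its black end has two labels $0$ in $F_{\mathrm{out}}$. A graph is 2-connected if it has at least three vertices, is connected and has no cut vertex. $G$ is weakly 2-connected if it is 2-connected or becomes 2-connected when the edge $s_0s_1$ is added. $G$ contains a block with a right chord if there are an edge $ab$ with $a$ black and $b$ white and a connected component $C$ of $G-\{a,b\}$ containing neither $s_0$ nor $s_1$ (where $a$ or $b$ itself may be special) such that $C$ lies to the left of $ab$ directed from $a$ to $b$, that is, in the plane subgraph induced by $C\cup\{a,b\}$ the face on the left of $ab$ is bounded. Theorem. $G$ admits a generalized strong labeling with special vertices $s_0,s_1$ if and only if the following three conditions hold: (1) $s_0$ and $s_1$ are nonadjacent; (2) $G$ is weakly 2-connected; (3) $G$ contains no block with a right chord. -/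

import Mathlib

namespace StrongLabeling

/-- The two color classes of a bipartite graph. -/
inductive Shade : Type
  | black
  | white

/-- The angles of a graph drawn in the plane. A dart `d` stands for the angle at its tail `d.fst`
that lies between `d` and the counterclockwise next dart around `d.fst`, so this angle is on the
left of `d`. An isolated vertex has one full angle. -/
abbrev Angle {V : Type*} (G : SimpleGraph V) : Type _ :=
  G.Dart ⊕ {v : V // G.IsIsolated v}

/-- The vertex of an angle. -/
def Angle.vertex {V : Type*} {G : SimpleGraph V} : Angle G → V
  | Sum.inl d => d.fst
  | Sum.inr v => v.1

/-- A crossing-free drawing of a (possibly disconnected) finite simple graph in the plane, up to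
orientation-preserving homeomorphism of the plane, encoded by its counterclockwise rotation at the
vertices, its faces (as classes of angles), and its outer face.

In a connected drawing the faces are exactly the orbits of `d ↦ rot⁻¹ d.symm` (the boundary walks
keeping the face on their left). In a disconnected drawing a face can have several boundary walks,
at most one for each component. Planarity is Euler's formula `v - e + f = 1 + k` with `k` the number
of components, together with the fact that the drawing hangs together: one can get from
every angle to every other one by moving inside faces and along components. -/
structure PlaneDrawing {V : Type*} (G : SimpleGraph V) where
  /-- The counterclockwise next dart with the same tail. -/
  rot : Equiv.Perm G.Dart
  rot_fst : ∀ d, (rot d).fst = d.fst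
  rot_sameCycle : ∀ d e : G.Dart, d.fst = e.fst → rot.SameCycle d e
  /-- Lying in the same face. -/
  sameFace : Setoid (Angle G)
  sameFace_walk : ∀ d : G.Dart, sameFace (Sum.inl d) (Sum.inl (rot.symm d.symm))
  hangs_together : ∀ x y : Angle G,
    Relation.EqvGen (fun x y => sameFace x y ∨ G.Reachable x.vertex y.vertex) x y
  euler : Nat.card V + Nat.card (Quotient sameFace) =
    Nat.card G.edgeSet + Nat.card G.ConnectedComponent + 1
  /-- The outer (unbounded) face. -/
  outer : Quotient sameFace

namespace PlaneDrawing

variable {V : Type*} {G : SimpleGraph V} (P : PlaneDrawing G)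

/-- The faces of the drawing. -/
abbrev Face : Type _ := Quotient P.sameFace

/-- The face in which an angle lies. -/
def faceOf (x : Angle G) : P.Face := Quotient.mk P.sameFace x

/-- The face on the left of a dart. -/
def leftFace (d : G.Dart) : P.Face := P.faceOf (Sum.inl d)

/-- The vertex `v` lies on the boundary of the outer face. -/
def OnOuterFace (v : V) : Prop := ∃ x : Angle G, x.vertex = v ∧ P.faceOf x = P.outer

/-- The angle at the tail of `d`, on the left of `d`. -/
def tailLeft (d : G.Dart) : Angle G := Sum.inl d

/-- The angle at the tail of `d`, on the right of `d`. -/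
def tailRight (d : G.Dart) : Angle G := Sum.inl (P.rot.symm d)

/-- The angle at the head of `d`, on the left of `d`. -/
def headLeft (d : G.Dart) : Angle G := Sum.inl (P.rot.symm d.symm)

/-- The angle at the head of `d`, on the right of `d`. -/
def headRight (d : G.Dart) : Angle G := Sum.inl d.symm

/-- The faces `f` and `g` of the drawing of `G` are contained in the same face of the induced
drawing of the subgraph `G[S]`: one can get from `f` to `g` by crossing only edges that are not in
`G[S]`. -/
def SameFaceOfInduced (S : Set V) (f g : P.Face) : Prop :=
  Relation.EqvGen (fun f g => ∃ e : G.Dart, ¬ (e.fst ∈ S ∧ e.snd ∈ S) ∧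
    P.leftFace e = f ∧ P.leftFace e.symm = g) f g

/-- Vertex rule at `v`: read counterclockwise around `v` from a suitable starting point, the labels
are a non-empty interval of zeros followed by a non-empty interval of ones. -/
def VertexRule (l : Angle G → Fin 2) (v : V) : Prop :=
  ∃ (d : G.Dart) (k : ℕ), d.fst = v ∧ 0 < k ∧ k < (G.neighborSet v).ncard ∧
    ∀ i < (G.neighborSet v).ncard, (l (Sum.inl ((P.rot ^ i) d)) = 0 ↔ i < k)

/-- Extended edge rule at the edge of `d`, traversed from its white end to its black end.
The patterns list the labels at the white end on the left, at the black end on the left, at the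
white end on the right, and at the black end on the right. The edge is oriented towards an endpoint
with two coincident labels `i`, and is then colored `i`:
white to black in the first pattern (coincident labels on the right side of the oriented edge),
black to white in the second one (coincident labels on the left side of the oriented edge);
in the third one the labels differ at both endpoints and on both sides (bidirected edge).
With the two values of `i` these are six patterns. -/
def EdgeRule (l : Angle G → Fin 2) (d : G.Dart) : Prop :=
  ∃ i : Fin 2,
    let pattern := (l (tailLeft d), l (P.headLeft d), l (P.tailRight d), l (headRight d))
    pattern = (1 - i, i, i, i) ∨
    pattern = (i, 1 - i, i, i) ∨
    pattern = (i, 1 - i, 1 - i, i)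

/-- Strong face rule at the face `f`: for both labels `i`, there is exactly one pair of
labels `i` that are adjacent in `f`, that is, at the two ends of an edge on the side of `f`. -/
def FaceRule (l : Angle G → Fin 2) (f : P.Face) : Prop :=
  ∀ i : Fin 2, ∃! d : G.Dart, P.leftFace d = f ∧ l (tailLeft d) = i ∧ l (P.headLeft d) = i

/-- `l` is a generalized strong labeling of the plane bipartite graph with coloring `c` and special
vertices `s₀` and `s₁`. -/
structure IsGeneralizedStrongLabeling (c : G.Coloring Shade) (s₀ s₁ : V)
    (l : Angle G → Fin 2) : Prop where
  special₀ : ∀ x : Angle G, x.vertex = s₀ → l x = 0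
  special₁ : ∀ x : Angle G, x.vertex = s₁ → l x = 1
  vertexRule : ∀ v, v ≠ s₀ → v ≠ s₁ → P.VertexRule l v
  edgeRule : ∀ d : G.Dart, c d.fst = Shade.white → c d.snd = Shade.black → P.EdgeRule l d
  faceRule : ∀ f, P.FaceRule l f
  /-- The edge at `s₀` on the outer face which has the outer face on its right when traversed from
  its white end to its black end has two labels `0` in the outer face. -/
  outerRule : ∃ d : G.Dart, c d.fst = Shade.white ∧ c d.snd = Shade.black ∧
    (d.fst = s₀ ∨ d.snd = s₀) ∧ P.leftFace d.symm = P.outer ∧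
    l (P.tailRight d) = 0 ∧ l (headRight d) = 0

/-- `G` contains a block with a right chord: there are an edge `ab` with `a` black and `b` white,
given by the dart `d`, and a component `C` of `G - {a, b}` that contains neither special vertex and
lies to the left of `ab`, i.e. in the drawing of `G[C ∪ {a, b}]` the face on the left of `ab` is
bounded. -/
def HasBlockWithRightChord (c : G.Coloring Shade) (s₀ s₁ : V) : Prop :=
  ∃ d : G.Dart, c d.fst = Shade.black ∧ c d.snd = Shade.white ∧
    ∃ C : (G.induce ({d.fst, d.snd}ᶜ : Set V)).ConnectedComponent,
      (∀ x ∈ C.supp, (x : V) ≠ s₀ ∧ (x : V) ≠ s₁) ∧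
      ¬ P.SameFaceOfInduced (Subtype.val '' C.supp ∪ {d.fst, d.snd}) (P.leftFace d) P.outer

end PlaneDrawing

/-- 2-connected graphs: at least three vertices, connected, and without cut vertices. -/
def TwoConnected {V : Type*} (G : SimpleGraph V) : Prop :=
  3 ≤ Nat.card V ∧ G.Connected ∧ ∀ v : V, (G.induce ({v}ᶜ : Set V)).Connected

/-- Weakly 2-connected graphs with special vertices `s₀` and `s₁`. -/
def WeaklyTwoConnected {V : Type*} (G : SimpleGraph V) (s₀ s₁ : V) : Prop :=
  TwoConnected G ∨ TwoConnected (G ⊔ SimpleGraph.edge s₀ s₁)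

end StrongLabeling

set_option linter.unusedSectionVars false

/-! Put a point into each face of the drawing and join it to the corners of that face. For connected
`G` this triangulates the sphere. The vertices are coloured 0 (faces), 1 (white) and 2 (black). Each
edge of `G`, traversed from white to black, has a dark triangle on its right and a light one on its
left. With `D` the set of edges of `G` and `N` the set of vertices and faces, Euler's formula reads
`|N| = |D| + 2`. `Hypermap` is the abstract form of this triangulation, and topology enters only
through mod 2 chains: on the sphere every 1-cycle bounds a set of triangles
(`Hypermap.exists_bd_eq`).

Labelings become choices. The six edge patterns say that the labels differ on the left of an edge
and that exactly two of three events happen: equality on its right side, change at its white end,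
change at its black end. So a labeling omits one vertex of each dark triangle. The remaining rules
say that every face and every nonspecial vertex sees exactly two events and that a special vertex
sees none (`Hypermap.IsOmission`). Conversely, the edges opposite to the omitted vertices form a
cycle. That cycle bounds a set of triangles, and the labels are read off from this set
(`exists_records_of_isOmission`).

When do omissions exist? Each nonspecial `x` must be omitted by `deg x - 2` of its dark triangles,
and each special vertex by all of them. By inclusion-exclusion, Hall's condition for a vertex set
`Y` is `e(Y) ≤ 2|Y \ S| + f(Y)`, where `f(Y)` counts the dark triangles with all vertices in `Y`.
Euler's inequality for the subgraph induced by `Y`, with a discharging over its regions, gives this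
bound if two rules hold and the special vertices are nonadjacent: every 2-cycle (`DigonRule`), and
every nonfacial 3-cycle with the dark sides of its edges inside (`TriangleRule`), has a special
vertex inside. Conversely, counting the events inside a region shows that an omission forces both
rules (`digonRule_of_isOmission`, `triangleRule_of_isOmission`).

It remains to read the two rules in `G`. A digon consists of two angles of one face at the same
vertex, so the digon rule expresses weak 2-connectivity. A triangle consists of an edge `e` and
angles of one face at both ends of `e`. Since both special vertices are on the outer face and
nonadjacent, the triangle rule then expresses that there is no block with a right chord.
Connectedness of `G` is a consequence of weak 2-connectivity on one side, and of counting events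
against Euler's formula on the other. -/

/-- A map on a surface all of whose faces are triangles, coloured dark and light so that each edge
lies on one dark and one light triangle, with a proper 3-coloring of the vertices. Both the dark and
the light triangles are indexed by `D`; the edge `(d, i)` of the dark triangle `d` is opposite to
its vertex of color `i`, and `σ i d` is the light triangle on its other side. -/
structure Hypermap (D N : Type*) where
  σ : Fin 3 → Equiv.Perm D
  dv : D → Fin 3 → N
  lv : D → Fin 3 → N
  col : N → Fin 3
  col_dv : ∀ d i, col (dv d i) = i
  compat : ∀ d i j, j ≠ i → lv (σ i d) j = dv d j
  surj : ∀ x, ∃ d, dv d (col x) = x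
  conn : ∀ R : D ⊕ D → ZMod 2, (∀ d i, R (Sum.inl d) = R (Sum.inr (σ i d))) → ∀ a b, R a = R b

/-! ### Mod 2 chains on the triangulation, and exactness on the sphere -/

namespace Hypermap

variable {D N : Type*} (T : Hypermap D N)

theorem zmod_two_cases (a : ZMod 2) : a = 0 ∨ a = 1 := by revert a; decide

theorem zmod_two_add_eq_zero {a b : ZMod 2} : a + b = 0 ↔ a = b := by revert a b; decide

theorem fin_three_ne_add_one (j : Fin 3) : j ≠ j + 1 := by revert j; decide

theorem fin_three_ne_add_two (j : Fin 3) : j ≠ j + 2 := by revert j; decide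

theorem fin_three_exists_add (i j : Fin 3) (h : i ≠ j) :
    ∃ k, (k + 1 = i ∧ k + 2 = j) ∨ (k + 1 = j ∧ k + 2 = i) := by
  revert h; revert i j; decide

theorem fin_three_exists_ne (i j : Fin 3) : ∃ k, i ≠ k ∧ j ≠ k := by revert i j; decide

theorem dv_inj {d e : D} {i j : Fin 3} (h : T.dv d i = T.dv e j) : i = j := by
  rw [← T.col_dv d i, h, T.col_dv]

theorem dv_col {d : D} {i : Fin 3} {x : N} (h : T.dv d i = x) : T.col x = i := by
  rw [← h, T.col_dv]

theorem col_lv (e : D) (i : Fin 3) : T.col (T.lv e i) = i := by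
  have h := fin_three_ne_add_one i
  have := T.compat ((T.σ (i + 1)).symm e) (i + 1) i h
  rw [Equiv.apply_symm_apply] at this
  rw [this, T.col_dv]

/-- The mod 2 boundary of a set of triangles. -/
def bd : (D ⊕ D → ZMod 2) →ₗ[ZMod 2] (D × Fin 3 → ZMod 2) where
  toFun R ε := R (Sum.inl ε.1) + R (Sum.inr (T.σ ε.2 ε.1))
  map_add' R S := by ext ε; simp only [Pi.add_apply]; ring
  map_smul' c R := by ext ε; simp [mul_add]

theorem bd_apply (R : D ⊕ D → ZMod 2) (d : D) (i : Fin 3) :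
    T.bd R (d, i) = R (Sum.inl d) + R (Sum.inr (T.σ i d)) := rfl

/-- The difference has no boundary, hence is constant, the surface being connected. -/
theorem eq_of_bd_eq {R S : D ⊕ D → ZMod 2} (h : T.bd R = T.bd S) {a : D ⊕ D} (ha : R a = S a) :
    R = S := by
  have h0 : ∀ d i, (R - S) (Sum.inl d) = (R - S) (Sum.inr (T.σ i d)) := by
    intro d i
    have := congrFun h (d, i)
    rw [bd_apply, bd_apply] at this
    simp only [Pi.sub_apply]
    revert this
    generalize R (Sum.inl d) = a, S (Sum.inl d) = b, R (Sum.inr (T.σ i d)) = c,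
      S (Sum.inr (T.σ i d)) = e
    revert a b c e; decide
  ext b
  have := T.conn (R - S) h0 b a
  simp only [Pi.sub_apply, ha, sub_self] at this
  exact sub_eq_zero.1 this

variable [Fintype D] [Fintype N] [DecidableEq D] [DecidableEq N]

/-- The mod 2 boundary of a set of edges. -/
def cyc : (D × Fin 3 → ZMod 2) →ₗ[ZMod 2] (N → ZMod 2) where
  toFun y x := ∑ d, ∑ j, if T.dv d j = x then y (d, j + 1) + y (d, j + 2) else 0
  map_add' y z := by
    ext x
    simp only [Pi.add_apply, ← Finset.sum_add_distrib]
    refine Finset.sum_congr rfl fun d _ => Finset.sum_congr rfl fun j _ => ?_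
    split_ifs <;> ring
  map_smul' c y := by
    ext x
    simp only [Pi.smul_apply, smul_eq_mul, Finset.mul_sum, RingHom.id_apply]
    refine Finset.sum_congr rfl fun d _ => Finset.sum_congr rfl fun j _ => ?_
    split_ifs <;> ring

theorem cyc_apply (y : D × Fin 3 → ZMod 2) (x : N) :
    T.cyc y x = ∑ d, ∑ j, if T.dv d j = x then y (d, j + 1) + y (d, j + 2) else 0 := rfl

theorem cyc_apply_col (y : D × Fin 3 → ZMod 2) (x : N) :
    T.cyc y x = ∑ d, if T.dv d (T.col x) = x then
      y (d, T.col x + 1) + y (d, T.col x + 2) else 0 := by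
  rw [cyc_apply]
  refine Finset.sum_congr rfl fun d _ => ?_
  rw [Finset.sum_eq_single (T.col x)]
  · intro j _ hj
    rw [if_neg]
    intro h
    exact hj (T.dv_col h).symm
  · simp

theorem cyc_single (d : D) (i : Fin 3) :
    T.cyc (Pi.single (d, i) 1) = Pi.single (T.dv d (i + 1)) 1 + Pi.single (T.dv d (i + 2)) 1 := by
  ext x
  rw [cyc_apply, Finset.sum_eq_single d]
  · fin_cases i <;> simp [Fin.sum_univ_three, Pi.single_apply, eq_comm, add_comm]
  · intro e _ he
    refine Finset.sum_eq_zero fun j _ => ?_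
    simp [he]
  · simp

/-- At a vertex of colour `j`, the edges of types `j + 1` and `j + 2` lead from its dark triangles
to its light ones. Reindexing by the two permutations makes both sums run over the same light
triangles, so they cancel. -/
theorem cyc_bd (R : D ⊕ D → ZMod 2) : T.cyc (T.bd R) = 0 := by
  ext x
  rw [cyc_apply, Finset.sum_comm]
  refine Finset.sum_eq_zero fun j _ => ?_
  have key : ∀ i, j ≠ i → ∑ d, (if T.dv d j = x then R (Sum.inr (T.σ i d)) else 0) =
      ∑ d, (if T.lv d j = x then R (Sum.inr d) else 0) := by
    intro i hi
    rw [← Equiv.sum_comp (T.σ i) (fun d => if T.lv d j = x then R (Sum.inr d) else 0)]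
    simp only [T.compat _ i j hi]
  have h1 := key (j + 1) (fin_three_ne_add_one j)
  have h2 := key (j + 2) (fin_three_ne_add_two j)
  have : ∑ d, (if T.dv d j = x then T.bd R (d, j + 1) + T.bd R (d, j + 2) else 0) =
      ∑ d, (if T.dv d j = x then R (Sum.inr (T.σ (j + 1) d)) else 0) +
      ∑ d, (if T.dv d j = x then R (Sum.inr (T.σ (j + 2) d)) else 0) := by
    rw [← Finset.sum_add_distrib]
    refine Finset.sum_congr rfl fun d _ => ?_
    split_ifs
    · rw [bd_apply, bd_apply]
      have := CharTwo.add_self_eq_zero (R (Sum.inl d))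
      linear_combination this
    · simp
  rw [this, h1, h2, CharTwo.add_self_eq_zero]

/-- Each dark triangle has exactly one vertex of colour `j`. Applied to a cycle, this shows that the
number of its edges with an end of colour `j` is even. -/
theorem sum_cyc_col (y : D × Fin 3 → ZMod 2) (j : Fin 3) :
    ∑ x with T.col x = j, T.cyc y x = ∑ d, (y (d, j + 1) + y (d, j + 2)) := by
  have : ∀ x ∈ Finset.univ.filter (fun x => T.col x = j), T.cyc y x =
      ∑ d, if T.dv d j = x then y (d, j + 1) + y (d, j + 2) else 0 := by
    intro x hx
    rw [cyc_apply_col, (Finset.mem_filter.1 hx).2]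
  rw [Finset.sum_congr rfl this, Finset.sum_comm]
  refine Finset.sum_congr rfl fun d _ => ?_
  rw [Finset.sum_ite_eq, if_pos]
  simp [T.col_dv]

theorem sum_cyc (y : D × Fin 3 → ZMod 2) : ∑ x, T.cyc y x = 0 := by
  have h : ∑ x, T.cyc y x = ∑ d, ∑ j, (y (d, j + 1) + y (d, j + 2)) := by
    simp only [cyc_apply]
    rw [Finset.sum_comm]
    refine Finset.sum_congr rfl fun d _ => ?_
    rw [Finset.sum_comm]
    refine Finset.sum_congr rfl fun j _ => ?_
    simp
  rw [h]
  refine Finset.sum_eq_zero fun d _ => ?_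
  simp only [Fin.sum_univ_three]
  have : ∀ a b c : ZMod 2, (b + c) + (c + a) + (a + b) = 0 := by decide
  exact this _ _ _

/-- The 1-skeleton is connected, so the sum of any two points is a boundary. The boundaries
therefore have codimension at most one. -/
theorem card_le_finrank_range_cyc :
    Fintype.card N ≤ Module.finrank (ZMod 2) (LinearMap.range T.cyc) + 1 := by
  classical
  rcases isEmpty_or_nonempty N with hN | ⟨⟨x₀⟩⟩
  · simp
  set W := LinearMap.range T.cyc with hW
  set P : N → Prop := fun x => (Pi.single x 1 + Pi.single x₀ 1 : N → ZMod 2) ∈ W with hP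
  have two : ∀ v : N → ZMod 2, v + v = 0 := fun v => by
    ext x; exact CharTwo.add_self_eq_zero _
  have hadj : ∀ d i j, i ≠ j → (P (T.dv d i) → P (T.dv d j)) := by
    intro d i j hij hi
    obtain ⟨k, hk⟩ : ∃ k, (k + 1 = i ∧ k + 2 = j) ∨ (k + 1 = j ∧ k + 2 = i) :=
      fin_three_exists_add i j hij
    have h1 : (Pi.single (T.dv d i) 1 + Pi.single (T.dv d j) 1 : N → ZMod 2) ∈ W := by
      refine ⟨Pi.single (d, k) 1, ?_⟩
      rw [cyc_single]
      rcases hk with ⟨rfl, rfl⟩ | ⟨rfl, rfl⟩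
      · rfl
      · exact add_comm _ _
    have h2 := W.add_mem h1 hi
    have : (Pi.single (T.dv d i) 1 + Pi.single (T.dv d j) 1 +
        (Pi.single (T.dv d i) 1 + Pi.single x₀ 1) : N → ZMod 2) =
        (Pi.single (T.dv d i) 1 + Pi.single (T.dv d i) 1) +
        (Pi.single (T.dv d j) 1 + Pi.single x₀ 1) := by abel
    rw [this, two, zero_add] at h2
    exact h2
  have hladj : ∀ e i j, P (T.lv e i) → P (T.lv e j) := by
    intro e i j hi
    by_cases hij : i = j
    · exact hij ▸ hi
    obtain ⟨k, hk⟩ : ∃ k, i ≠ k ∧ j ≠ k := fin_three_exists_ne i j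
    have h1 := T.compat ((T.σ k).symm e) k i hk.1
    have h2 := T.compat ((T.σ k).symm e) k j hk.2
    rw [Equiv.apply_symm_apply] at h1 h2
    rw [h2]
    rw [h1] at hi
    exact hadj _ _ _ hij hi
  have hdadj : ∀ d i j, P (T.dv d i) → P (T.dv d j) := by
    intro d i j hi
    by_cases hij : i = j
    · exact hij ▸ hi
    exact hadj _ _ _ hij hi
  have hall : ∀ x, P x := by
    -- The triangles whose vertices are homologous to `x₀` form a set closed under crossing edges,
    -- hence all or nothing.
    set R : D ⊕ D → ZMod 2 := Sum.elim (fun d => if P (T.dv d 0) then 1 else 0)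
      (fun d => if P (T.lv d 0) then 1 else 0) with hR
    have hconn := T.conn R (by
      intro d i
      simp only [hR, Sum.elim_inl, Sum.elim_inr]
      have : P (T.dv d 0) ↔ P (T.lv (T.σ i d) 0) := by
        obtain ⟨j, hj⟩ : ∃ j, j ≠ i := by revert i; decide
        rw [show P (T.dv d 0) ↔ P (T.dv d j) from ⟨hdadj _ _ _, hdadj _ _ _⟩,
          show P (T.lv (T.σ i d) 0) ↔ P (T.lv (T.σ i d) j) from ⟨hladj _ _ _, hladj _ _ _⟩,
          T.compat d i j hj]
      simp only [this])
    intro x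
    obtain ⟨d, hd⟩ := T.surj x
    obtain ⟨d₀, hd₀⟩ := T.surj x₀
    have h0 : P (T.dv d₀ 0) := by
      refine hdadj _ (T.col x₀) _ ?_
      rw [hd₀, hP]
      simp only [two]
      exact W.zero_mem
    have := hconn (Sum.inl d) (Sum.inl d₀)
    simp only [hR, Sum.elim_inl, if_pos h0] at this
    have hd0 : P (T.dv d 0) := by
      by_contra h
      rw [if_neg h] at this
      exact zero_ne_one this
    rw [← hd]
    exact hdadj _ _ _ hd0
  have htop : W ⊔ Submodule.span (ZMod 2) {(Pi.single x₀ 1 : N → ZMod 2)} = ⊤ := by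
    rw [eq_top_iff, ← (Pi.basisFun (ZMod 2) N).span_eq, Submodule.span_le]
    rintro _ ⟨x, rfl⟩
    rw [Pi.basisFun_apply]
    have : (Pi.single x 1 : N → ZMod 2) =
        (Pi.single x 1 + Pi.single x₀ 1) + Pi.single x₀ 1 := by
      rw [add_assoc, two, add_zero]
    rw [this]
    exact Submodule.add_mem_sup (hall x) (Submodule.mem_span_singleton_self _)
  have h1 := Submodule.finrank_add_le_finrank_add_finrank W
    (Submodule.span (ZMod 2) {(Pi.single x₀ 1 : N → ZMod 2)})
  rw [htop, finrank_top, Module.finrank_fintype_fun_eq_card] at h1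
  have h2 := finrank_span_singleton (K := ZMod 2) (v := (Pi.single x₀ (1 : ZMod 2) : N → ZMod 2))
    (by
      intro h
      have := congrFun h x₀
      simp at this)
  omega

/-- Only the constant sets of triangles have empty boundary. -/
theorem two_card_le_finrank_range_bd :
    2 * Fintype.card D ≤ Module.finrank (ZMod 2) (LinearMap.range T.bd) + 1 := by
  have h := LinearMap.finrank_range_add_finrank_ker T.bd
  rw [Module.finrank_fintype_fun_eq_card, Fintype.card_sum] at h
  have hker : LinearMap.ker T.bd ≤ Submodule.span (ZMod 2) {(1 : D ⊕ D → ZMod 2)} := by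
    intro R hR
    rw [LinearMap.mem_ker] at hR
    rw [Submodule.mem_span_singleton]
    rcases isEmpty_or_nonempty (D ⊕ D) with he | ⟨⟨a⟩⟩
    · exact ⟨0, by ext x; exact he.elim x⟩
    · refine ⟨R a, T.eq_of_bd_eq (a := a) ?_ (by simp)⟩
      rw [hR]
      ext ⟨d, i⟩
      rw [bd_apply]
      simp only [Pi.smul_apply, Pi.one_apply, smul_eq_mul, mul_one, Pi.zero_apply]
      exact CharTwo.add_self_eq_zero _
  have h1 := Submodule.finrank_mono hker
  have h2 := finrank_span_le_card (R := ZMod 2) ({(1 : D ⊕ D → ZMod 2)} : Set (D ⊕ D → ZMod 2))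
  simp at h2
  omega

theorem range_bd_le_ker_cyc : LinearMap.range T.bd ≤ LinearMap.ker T.cyc := by
  rintro _ ⟨R, rfl⟩
  exact T.cyc_bd R

/-- The genus is nonnegative: boundaries are cycles, so the two rank bounds cannot add up to more
than the number of edges, `3 |D|`. -/
theorem card_le (T : Hypermap D N) : Fintype.card N ≤ Fintype.card D + 2 := by
  have h1 := T.card_le_finrank_range_cyc
  have h2 := T.two_card_le_finrank_range_bd
  have h3 := Submodule.finrank_mono T.range_bd_le_ker_cyc
  have h4 := LinearMap.finrank_range_add_finrank_ker T.cyc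
  rw [Module.finrank_fintype_fun_eq_card, Fintype.card_prod, Fintype.card_fin] at h4
  omega

/-- When Euler's formula holds with equality, the rank bounds leave no room between boundaries and
cycles. -/
theorem exists_bd_eq (hE : Fintype.card N = Fintype.card D + 2) {y : D × Fin 3 → ZMod 2}
    (hy : T.cyc y = 0) : ∃ R, T.bd R = y := by
  have h1 := T.card_le_finrank_range_cyc
  have h2 := T.two_card_le_finrank_range_bd
  have h4 := LinearMap.finrank_range_add_finrank_ker T.cyc
  rw [Module.finrank_fintype_fun_eq_card, Fintype.card_prod, Fintype.card_fin] at h4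
  have := Submodule.eq_of_le_of_finrank_le T.range_bd_le_ker_cyc (by omega)
  have hy' : y ∈ LinearMap.ker T.cyc := hy
  rw [← this] at hy'
  exact hy'

end Hypermap

/-! ### Regions of induced subgraphs -/

namespace Hypermap

variable {D N : Type*} (T : Hypermap D N)

/-- The edges with both ends in `Y`. -/
def edgesIn (Y : Set N) : Set (D × Fin 3) :=
  {ε | T.dv ε.1 (ε.2 + 1) ∈ Y ∧ T.dv ε.1 (ε.2 + 2) ∈ Y}

theorem fin_three_eq_add (i j : Fin 3) (h : j ≠ i) : j = i + 1 ∨ j = i + 2 := by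
  revert h; revert i j; decide

theorem mem_edgesIn {Y : Set N} {d : D} {i : Fin 3} :
    (d, i) ∈ T.edgesIn Y ↔ ∀ j, j ≠ i → T.dv d j ∈ Y := by
  constructor
  · rintro ⟨h1, h2⟩ j hj
    rcases fin_three_eq_add i j hj with rfl | rfl
    · exact h1
    · exact h2
  · intro h
    exact ⟨h _ (fin_three_ne_add_one i).symm, h _ (fin_three_ne_add_two i).symm⟩

/-- Two triangles are linked if they share an edge outside of `E`. -/
def Link (E : Set (D × Fin 3)) (a b : D ⊕ D) : Prop :=
  ∃ d i, (d, i) ∉ E ∧ a = Sum.inl d ∧ b = Sum.inr (T.σ i d)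

/-- The faces of the subgraph with edge set `E`, as classes of triangles. -/
abbrev Region (E : Set (D × Fin 3)) : Type _ := Quot (T.Link E)

variable [Fintype D] [Fintype N] [DecidableEq D] [DecidableEq N]

/-- The sets of triangles with boundary in `E`. -/
def regions (E : Set (D × Fin 3)) : Submodule (ZMod 2) (D ⊕ D → ZMod 2) where
  carrier := {R | ∀ ε ∉ E, T.bd R ε = 0}
  add_mem' := by
    intro R S hR hS ε hε
    rw [map_add, Pi.add_apply, hR ε hε, hS ε hε, add_zero]
  zero_mem' := by intro ε _; simp
  smul_mem' := by
    intro c R hR ε hε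
    rw [map_smul, Pi.smul_apply, hR ε hε, smul_zero]

theorem finrank_regions_le (E : Set (D × Fin 3)) :
    Module.finrank (ZMod 2) (T.regions E) ≤ Nat.card (T.Region E) := by
  have hfin : Finite (T.Region E) := inferInstance
  have := Fintype.ofFinite (T.Region E)
  have hlift : ∀ R : T.regions E, ∀ a b, T.Link E a b → R.1 a = R.1 b := by
    rintro ⟨R, hR⟩ a b ⟨d, i, h, rfl, rfl⟩
    exact zmod_two_add_eq_zero.1 (hR _ h)
  let f : T.regions E →ₗ[ZMod 2] (T.Region E → ZMod 2) :=
    { toFun := fun R => Quot.lift R.1 (hlift R)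
      map_add' := by
        intro R S; ext q; induction q using Quot.ind; rfl
      map_smul' := by
        intro c R; ext q; induction q using Quot.ind; rfl }
  have hf : Function.Injective f := by
    intro R S h
    ext a
    exact congrFun h (Quot.mk _ a)
  have := LinearMap.finrank_le_finrank_of_injective hf
  rwa [Module.finrank_fintype_fun_eq_card, ← Nat.card_eq_fintype_card] at this

theorem one_mem_regions (E : Set (D × Fin 3)) : (1 : D ⊕ D → ZMod 2) ∈ T.regions E := by
  rintro ⟨d, i⟩ _
  rw [bd_apply]
  exact CharTwo.add_self_eq_zero _

/-- Euler's inequality for the subgraph induced by `Y`. -/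
theorem card_edgesIn_add_two_le [Nonempty D] (hE : Fintype.card N = Fintype.card D + 2)
    (Y : Finset N) (hY : Y.Nonempty) :
    Nat.card (T.edgesIn Y) + 2 ≤ Nat.card (T.Region (T.edgesIn Y)) + Y.card := by
  classical
  set E := T.edgesIn Y with hEdef
  have hEfin : Fintype E := Fintype.ofFinite _
  refine le_trans ?_ (Nat.add_le_add_right (T.finrank_regions_le E) _)
  let ext : (E → ZMod 2) →ₗ[ZMod 2] (D × Fin 3 → ZMod 2) :=
    { toFun := fun y ε => if h : ε ∈ E then y ⟨ε, h⟩ else 0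
      map_add' := by intro y z; ext ε; simp only [Pi.add_apply]; split_ifs <;> simp
      map_smul' := by intro c y; ext ε; simp only [Pi.smul_apply]; split_ifs <;> simp }
  have ext_apply : ∀ y ε, ext y ε = if h : ε ∈ E then y ⟨ε, h⟩ else 0 := fun _ _ => rfl
  let ψ : (E → ZMod 2) →ₗ[ZMod 2] (Y → ZMod 2) := (LinearMap.funLeft (ZMod 2) (ZMod 2)
    (Subtype.val : Y → N)) ∘ₗ T.cyc ∘ₗ ext
  have hout : ∀ y x, x ∉ Y → T.cyc (ext y) x = 0 := by
    intro y x hx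
    rw [cyc_apply]
    refine Finset.sum_eq_zero fun d _ => Finset.sum_eq_zero fun j _ => ?_
    split_ifs with h
    · rw [ext_apply, ext_apply, dif_neg, dif_neg, add_zero]
      · intro h'
        rw [hEdef, mem_edgesIn] at h'
        exact hx (h ▸ h' j (fin_three_ne_add_two j))
      · intro h'
        rw [hEdef, mem_edgesIn] at h'
        exact hx (h ▸ h' j (fin_three_ne_add_one j))
    · rfl
  -- The coefficients of a boundary add up to zero, so a single point of `Y` is never reached.
  have hrange : Module.finrank (ZMod 2) (LinearMap.range ψ) < Y.card := by
    have h1 : LinearMap.range ψ < ⊤ := by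
      rw [lt_top_iff_ne_top]
      intro htop
      obtain ⟨y₀, hy₀⟩ := hY
      have : (Pi.single ⟨y₀, hy₀⟩ 1 : Y → ZMod 2) ∈ LinearMap.range ψ := by
        rw [htop]; trivial
      obtain ⟨y, hy⟩ := this
      have hs := T.sum_cyc (ext y)
      rw [← Finset.sum_subset (Finset.subset_univ Y) (fun x _ hx => hout y x hx),
        ← Finset.sum_coe_sort] at hs
      have : ∀ x : Y, T.cyc (ext y) x = (Pi.single ⟨y₀, hy₀⟩ 1 : Y → ZMod 2) x := by
        intro x
        rw [← hy]
        rfl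
      simp [this] at hs
    have := Submodule.finrank_lt h1.ne
    rwa [Module.finrank_fintype_fun_eq_card, Fintype.card_coe] at this
  have hrn := LinearMap.finrank_range_add_finrank_ker ψ
  rw [Module.finrank_fintype_fun_eq_card, ← Nat.card_eq_fintype_card] at hrn
  let g : T.regions E →ₗ[ZMod 2] (D × Fin 3 → ZMod 2) := T.bd.domRestrict _
  have hg := LinearMap.finrank_range_add_finrank_ker g
  have hgker : 1 ≤ Module.finrank (ZMod 2) (LinearMap.ker g) := by
    rw [Nat.one_le_iff_ne_zero, ← Nat.pos_iff_ne_zero, Module.finrank_pos_iff_exists_ne_zero]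
    refine ⟨⟨⟨1, T.one_mem_regions E⟩, ?_⟩, ?_⟩
    · rw [LinearMap.mem_ker]
      ext ⟨d, i⟩
      exact CharTwo.add_self_eq_zero _
    · intro h
      obtain ⟨d⟩ := ‹Nonempty D›
      have := congrArg (fun z => z.1.1 (Sum.inl d)) h
      simp at this
  -- A cycle inside `E` bounds a set of triangles, and this set is a union of regions.
  have hle : (LinearMap.ker ψ).map ext ≤ LinearMap.range g := by
    rintro _ ⟨y, hy, rfl⟩
    have hy0 : T.cyc (ext y) = 0 := by
      ext x
      by_cases hx : x ∈ Y
      · exact congrFun (LinearMap.mem_ker.1 hy) ⟨x, hx⟩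
      · exact hout y x hx
    obtain ⟨R, hR⟩ := T.exists_bd_eq hE hy0
    refine ⟨⟨R, ?_⟩, hR⟩
    intro ε hε
    rw [hR, ext_apply, dif_neg hε]
  have hext : Function.Injective ext := by
    intro y z h
    ext ⟨ε, hε⟩
    have := congrFun h ε
    rwa [ext_apply, ext_apply, dif_pos hε, dif_pos hε] at this
  have h5 := Submodule.finrank_mono hle
  rw [← (Submodule.equivMapOfInjective ext hext _).finrank_eq] at h5
  omega

end Hypermap

/-! ### The sparsity bound from the digon and triangle rules -/

namespace Hypermap

variable {D N : Type*} (T : Hypermap D N)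

/-- The vertices of a triangle. -/
def tv : D ⊕ D → Fin 3 → N := Sum.elim T.dv T.lv

theorem col_tv (a : D ⊕ D) (i : Fin 3) : T.col (T.tv a i) = i := by
  cases a
  · exact T.col_dv _ _
  · exact T.col_lv _ _

/-- All triangles at `x` belong to `R`. -/
def Inside (R : D ⊕ D → ZMod 2) (x : N) : Prop := ∀ a i, T.tv a i = x → R a = 1

/-- Each digon has a special vertex inside. -/
def DigonRule [DecidableEq D] (S : Finset N) : Prop :=
  ∀ (R : D ⊕ D → ZMod 2) (ε δ : D × Fin 3), ε ≠ δ →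
    T.bd R = Pi.single ε 1 + Pi.single δ 1 → ∃ s ∈ S, T.Inside R s

/-- Each nonfacial triangle with the dark triangles at its edges in the interior has a special
vertex inside. -/
def TriangleRule [DecidableEq D] (S : Finset N) : Prop :=
  ∀ (R : D ⊕ D → ZMod 2) (d : Fin 3 → D),
    T.bd R = ∑ i, Pi.single (d i, i) 1 → (∀ i, R (Sum.inl (d i)) = 1) → ¬ (∀ i, d i = d 0) →
    ∃ s ∈ S, T.Inside R s

/-- No two special vertices are adjacent. -/
def Nonadjacent (S : Finset N) : Prop :=
  ∀ d i j, i ≠ j → T.dv d i ∈ S → T.dv d j ∉ S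

variable [Fintype D] [Fintype N] [DecidableEq D] [DecidableEq N]

/-- The dark triangles with all vertices in `Y`. -/
def full (Y : Finset N) : Finset D := {d | ∀ i, T.dv d i ∈ Y}

theorem mem_full {Y : Finset N} {d : D} : d ∈ T.full Y ↔ ∀ i, T.dv d i ∈ Y := by simp [full]

/-- All three sides of a full triangle are in the edge set, so no link leaves it and it is a region
by itself. -/
theorem mk_inl_injOn_full (Y : Finset N) {d e : D} (hd : d ∈ T.full Y)
    (h : (Quot.mk _ (Sum.inl d) : T.Region (T.edgesIn Y)) = Quot.mk _ (Sum.inl e)) : d = e := by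
  let f : T.Region (T.edgesIn Y) → Prop := Quot.lift (fun a => a = Sum.inl d) (by
    rintro a b ⟨d', i, hi, rfl, rfl⟩
    simp only [Sum.inl.injEq, reduceCtorEq, eq_iff_iff, iff_false]
    rintro rfl
    exact hi (T.mem_edgesIn.2 fun j _ => T.mem_full.1 hd j))
  have h1 : f (Quot.mk _ (Sum.inl d)) := rfl
  rw [h] at h1
  exact (Sum.inl.inj h1).symm

/-- In a cycle the edges of any two types are together even in number. With three edges in all, the
numbers of the three types have equal parity and sum 3, so there is one edge of each type. -/
theorem exists_triangle (y : D × Fin 3 → ZMod 2) (P : Finset (D × Fin 3)) (hP : P.card = 3)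
    (hy : ∀ ε, y ε = if ε ∈ P then 1 else 0) (hc : T.cyc y = 0) :
    ∃ d : Fin 3 → D, (∀ i, (d i, i) ∈ P) ∧ y = ∑ i, Pi.single (d i, i) 1 := by
  classical
  set n : Fin 3 → ℕ := fun i => (P.filter (fun ε => ε.2 = i)).card with hn
  have hsum : n 0 + n 1 + n 2 = 3 := by
    have := Finset.card_eq_sum_card_fiberwise (s := P) (f := Prod.snd) (t := Finset.univ) (by simp)
    rw [hP, Fin.sum_univ_three] at this
    exact this.symm
  have hpar : ∀ i, ∑ d, y (d, i) = (n i : ZMod 2) := by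
    intro i
    simp only [hy, hn, Finset.sum_boole]
    congr 1
    refine Finset.card_bij (fun d _ => (d, i)) (by simp) (by simp) ?_
    rintro ⟨d, j⟩ h
    simp only [Finset.mem_filter] at h
    obtain ⟨h, rfl⟩ := h
    exact ⟨d, by simpa using h, rfl⟩
  have hev : ∀ j : Fin 3, ((n (j + 1) + n (j + 2) : ℕ) : ZMod 2) = 0 := by
    intro j
    have := T.sum_cyc_col y j
    rw [hc, Finset.sum_add_distrib, hpar, hpar] at this
    push_cast
    rw [← this]
    simp
  have h0 := (ZMod.natCast_eq_zero_iff _ _).1 (hev 0)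
  have h1 := (ZMod.natCast_eq_zero_iff _ _).1 (hev 1)
  have h2 := (ZMod.natCast_eq_zero_iff _ _).1 (hev 2)
  simp only [Fin.isValue, zero_add, show (1 : Fin 3) + 1 = 2 from rfl,
    show (1 : Fin 3) + 2 = 0 from rfl, show (2 : Fin 3) + 1 = 0 from rfl,
    show (2 : Fin 3) + 2 = 1 from rfl] at h0 h1 h2
  have hn1 : ∀ i, n i = 1 := by
    have : n 0 = 1 ∧ n 1 = 1 ∧ n 2 = 1 := by omega
    intro i
    fin_cases i
    exacts [this.1, this.2.1, this.2.2]
  have hex : ∀ i, ∃ d, P.filter (fun ε => ε.2 = i) = {(d, i)} := by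
    intro i
    obtain ⟨⟨d, j⟩, h⟩ := Finset.card_eq_one.1 (hn1 i)
    have : (d, j) ∈ P.filter (fun ε => ε.2 = i) := by rw [h]; simp
    obtain rfl : j = i := (Finset.mem_filter.1 this).2
    exact ⟨d, h⟩
  choose d hd using hex
  have hmem : ∀ e i, (e, i) ∈ P ↔ e = d i := by
    intro e i
    have : (e, i) ∈ P ↔ (e, i) ∈ P.filter (fun ε => ε.2 = i) := by simp
    rw [this, hd]
    simp
  refine ⟨d, fun i => (hmem _ _).2 rfl, ?_⟩
  ext ⟨e, i⟩
  rw [hy, Finset.sum_apply, Finset.sum_eq_single i]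
  · simp [Pi.single_apply, hmem]
  · intro j _ hj
    simp [hj.symm]
  · simp

section Count

variable (E : Set (D × Fin 3)) [DecidablePred (· ∈ E)] [DecidableEq (T.Region E)]

/-- The edges in `E` with the dark side in the region `O`. -/
def darkSide (O : T.Region E) : Finset (D × Fin 3) :=
  {ε | ε ∈ E ∧ Quot.mk _ (Sum.inl ε.1) = O}

/-- The edges in `E` with the light side in the region `O`. -/
def lightSide (O : T.Region E) : Finset (D × Fin 3) :=
  {ε | ε ∈ E ∧ Quot.mk _ (Sum.inr (T.σ ε.2 ε.1)) = O}

/-- Counting the sides of the dark and of the light triangles in `O`, the edges off `E` contribute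
equally to both counts. So the two boundary counts agree modulo 3. -/
theorem darkSide_lightSide_mod (O : T.Region E) :
    ∃ a b : ℕ, 3 * a + (T.lightSide E O).card = 3 * b + (T.darkSide E O).card := by
  refine ⟨(Finset.univ.filter (fun d => (Quot.mk _ (Sum.inl d) : T.Region E) = O)).card,
    (Finset.univ.filter (fun d => (Quot.mk _ (Sum.inr d) : T.Region E) = O)).card, ?_⟩
  have h1 : 3 * (Finset.univ.filter (fun d => (Quot.mk _ (Sum.inl d) : T.Region E) = O)).card =
      (Finset.univ.filter (fun ε : D × Fin 3 =>
        (Quot.mk _ (Sum.inl ε.1) : T.Region E) = O)).card := by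
    rw [show (Finset.univ.filter (fun ε : D × Fin 3 =>
        (Quot.mk _ (Sum.inl ε.1) : T.Region E) = O)) =
        (Finset.univ.filter (fun d => (Quot.mk _ (Sum.inl d) : T.Region E) = O)) ×ˢ Finset.univ by
      ext ⟨d, i⟩; simp]
    simp [mul_comm]
  have h2 : 3 * (Finset.univ.filter (fun d => (Quot.mk _ (Sum.inr d) : T.Region E) = O)).card =
      (Finset.univ.filter (fun ε : D × Fin 3 =>
        (Quot.mk _ (Sum.inr (T.σ ε.2 ε.1)) : T.Region E) = O)).card := by
    rw [show 3 * (Finset.univ.filter (fun d => (Quot.mk _ (Sum.inr d) : T.Region E) = O)).card =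
        ((Finset.univ.filter (fun d => (Quot.mk _ (Sum.inr d) : T.Region E) = O)) ×ˢ
          (Finset.univ : Finset (Fin 3))).card by simp [mul_comm]]
    symm
    refine Finset.card_bij (fun ε _ => (T.σ ε.2 ε.1, ε.2)) ?_ ?_ ?_
    · rintro ⟨d, i⟩ h
      simpa using h
    · rintro ⟨d, i⟩ _ ⟨e, j⟩ _ h
      simp only [Prod.mk.injEq] at h
      obtain ⟨h, rfl⟩ := h
      rw [(T.σ i).injective h]
    · rintro ⟨d, i⟩ h
      exact ⟨((T.σ i).symm d, i), by simpa using h, by simp⟩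
  have h3 : (Finset.univ.filter (fun ε : D × Fin 3 =>
        (Quot.mk _ (Sum.inl ε.1) : T.Region E) = O)).card = (T.darkSide E O).card +
      (Finset.univ.filter (fun ε : D × Fin 3 => ε ∉ E ∧
        (Quot.mk _ (Sum.inl ε.1) : T.Region E) = O)).card := by
    rw [← Finset.card_filter_add_card_filter_not (fun ε => ε ∈ E), Finset.filter_filter,
      Finset.filter_filter]
    simp only [darkSide, and_comm]
  have h4 : (Finset.univ.filter (fun ε : D × Fin 3 =>
        (Quot.mk _ (Sum.inr (T.σ ε.2 ε.1)) : T.Region E) = O)).card = (T.lightSide E O).card +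
      (Finset.univ.filter (fun ε : D × Fin 3 => ε ∉ E ∧
        (Quot.mk _ (Sum.inr (T.σ ε.2 ε.1)) : T.Region E) = O)).card := by
    rw [← Finset.card_filter_add_card_filter_not (fun ε => ε ∈ E), Finset.filter_filter,
      Finset.filter_filter]
    simp only [lightSide, and_comm]
  have h5 : (Finset.univ.filter (fun ε : D × Fin 3 => ε ∉ E ∧
        (Quot.mk _ (Sum.inl ε.1) : T.Region E) = O)) =
      (Finset.univ.filter (fun ε : D × Fin 3 => ε ∉ E ∧
        (Quot.mk _ (Sum.inr (T.σ ε.2 ε.1)) : T.Region E) = O)) := by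
    refine Finset.filter_congr ?_
    rintro ⟨d, i⟩ _
    refine and_congr_right fun h => ?_
    have : (Quot.mk _ (Sum.inl d) : T.Region E) = Quot.mk _ (Sum.inr (T.σ i d)) :=
      Quot.sound ⟨d, i, h, rfl, rfl⟩
    rw [this]
  rw [h5] at h3
  omega

/-- The indicator of a region. -/
def ind (O : T.Region E) : D ⊕ D → ZMod 2 := fun a => if Quot.mk _ a = O then 1 else 0

theorem bd_ind (O : T.Region E) (ε : D × Fin 3) : T.bd (T.ind E O) ε =
    (if ε ∈ T.darkSide E O then 1 else 0) + (if ε ∈ T.lightSide E O then 1 else 0) := by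
  obtain ⟨d, i⟩ := ε
  rw [bd_apply]
  simp only [ind, darkSide, lightSide, Finset.mem_filter, Finset.mem_univ, true_and]
  by_cases h : (d, i) ∈ E
  · simp [h]
  · have : (Quot.mk _ (Sum.inl d) : T.Region E) = Quot.mk _ (Sum.inr (T.σ i d)) :=
      Quot.sound ⟨d, i, h, rfl, rfl⟩
    rw [this]
    simp [h, CharTwo.add_self_eq_zero]

/-- This excludes that a special vertex in the interior of a short region belongs to `Y`: an edge of
`E` at it would have the region on both sides. -/
theorem mem_sides_of_inside {O : T.Region E} {x : N} (h : T.Inside (T.ind E O) x)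
    {ε : D × Fin 3} (hε : ε ∈ E) {j : Fin 3} (hj : j ≠ ε.2) (hx : T.dv ε.1 j = x) :
    ε ∈ T.darkSide E O ∧ ε ∈ T.lightSide E O := by
  have h1 := h (Sum.inl ε.1) j hx
  have h2 := h (Sum.inr (T.σ ε.2 ε.1)) j ((T.compat _ _ _ hj).trans hx)
  simp only [ind, ite_eq_left_iff, zero_ne_one, imp_false, not_not] at h1 h2
  simp only [darkSide, lightSide, Finset.mem_filter, Finset.mem_univ, true_and]
  exact ⟨⟨hε, h1⟩, hε, h2⟩

end Count

/-- The weight is 1 for each edge with the dark side in `O` and 2 for each with the light side in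
`O`. As the two counts agree modulo 3, a weight below 6 leaves only an empty boundary, digons and
dark-sided triangles. The rules then put a special vertex inside. -/
theorem region_bound {S : Finset N} (hS : S.card = 2)
    (hD : T.DigonRule S) (hT : T.TriangleRule S) (hA : T.Nonadjacent S) (Y : Finset N)
    (E : Set (D × Fin 3)) (hE : E = T.edgesIn Y)
    (hY : ∀ x ∈ Y, ∃ ε ∈ E, ∃ j, j ≠ ε.2 ∧ T.dv ε.1 j = x)
    [DecidablePred (· ∈ E)] [DecidableEq (T.Region E)] (hne : E.Nonempty)
    (O : T.Region E) (hO : ∀ d ∈ T.full Y, Quot.mk _ (Sum.inl d) ≠ O) :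
    6 ≤ (T.darkSide E O).card + 2 * (T.lightSide E O).card ∨
    (3 ≤ (T.darkSide E O).card + 2 * (T.lightSide E O).card ∧
      ∃ s ∈ S \ Y, T.Inside (T.ind E O) s) := by
  obtain ⟨a, b, hab⟩ := T.darkSide_lightSide_mod E O
  by_cases h6 : 6 ≤ (T.darkSide E O).card + 2 * (T.lightSide E O).card
  · exact Or.inl h6
  have hall : T.bd (T.ind E O) = 0 → ∀ x, T.ind E O x = 1 := by
    intro h x
    obtain ⟨z, rfl⟩ := Quot.exists_rep O
    have : T.ind E (Quot.mk _ z) = 1 := by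
      refine T.eq_of_bd_eq (a := z) ?_ (by simp [ind])
      rw [h]
      ext ⟨d, i⟩
      rw [bd_apply]
      exact (CharTwo.add_self_eq_zero _).symm
    rw [this]
    rfl
  have hcases : ((T.darkSide E O).card = 0 ∧ (T.lightSide E O).card = 0) ∨
      ((T.darkSide E O).card = 1 ∧ (T.lightSide E O).card = 1) ∨
      ((T.darkSide E O).card = 3 ∧ (T.lightSide E O).card = 0) := by omega
  have hmem : ∀ ε ∈ E, T.ind E O (Sum.inl ε.1) = 1 → ε ∈ T.darkSide E O := by
    intro ε hε h
    simp only [ind, ite_eq_left_iff, zero_ne_one, imp_false, not_not] at h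
    simp only [darkSide, Finset.mem_filter, Finset.mem_univ, true_and]
    exact ⟨hε, h⟩
  rcases hcases with ⟨hp, hq⟩ | ⟨hp, hq⟩ | ⟨hp, hq⟩
  · exfalso
    have h0 : T.bd (T.ind E O) = 0 := by
      ext ε
      rw [bd_ind, Finset.card_eq_zero.1 hp, Finset.card_eq_zero.1 hq]
      simp
    obtain ⟨ε, hε⟩ := hne
    have := hmem ε hε (hall h0 _)
    rw [Finset.card_eq_zero.1 hp] at this
    simp at this
  · right
    refine ⟨by omega, ?_⟩
    obtain ⟨ε, hε⟩ := Finset.card_eq_one.1 hp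
    obtain ⟨δ, hδ⟩ := Finset.card_eq_one.1 hq
    have hbd : T.bd (T.ind E O) = Pi.single ε 1 + Pi.single δ 1 := by
      ext γ
      rw [bd_ind, hε, hδ]
      simp [Pi.single_apply]
    -- If the same edge is on both sides, `O` is everything and `E` is this one edge. Not both
    -- special vertices are then in `Y`, being nonadjacent.
    by_cases hεδ : ε = δ
    · subst hεδ
      have h1 := hall (by
        rw [hbd]; ext γ; exact CharTwo.add_self_eq_zero _)
      have hsub : ¬ S ⊆ Y := by
        intro hSY
        obtain ⟨s, t, hst, rfl⟩ := Finset.card_eq_two.1 hS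
        obtain ⟨ε₁, h₁, j₁, hj₁, hs⟩ := hY s (hSY (by simp))
        obtain ⟨ε₂, h₂, j₂, hj₂, ht⟩ := hY t (hSY (by simp))
        have e₁ := hmem ε₁ h₁ (h1 _)
        have e₂ := hmem ε₂ h₂ (h1 _)
        rw [hε, Finset.mem_singleton] at e₁ e₂
        subst e₁
        subst e₂
        refine hA ε₂.1 j₁ j₂ ?_ (by simp [hs]) (by simp [ht])
        rintro rfl
        exact hst (hs.symm.trans ht)
      obtain ⟨s, hs, hsY⟩ := Finset.not_subset.1 hsub
      exact ⟨s, by simp [hs, hsY], fun a i _ => h1 a⟩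
    · obtain ⟨s, hs, hin⟩ := hD _ ε δ hεδ hbd
      refine ⟨s, Finset.mem_sdiff.2 ⟨hs, fun hsY => ?_⟩, hin⟩
      obtain ⟨γ, hγ, j, hj, hx⟩ := hY s hsY
      obtain ⟨h1, h2⟩ := T.mem_sides_of_inside E hin hγ hj hx
      rw [hε, Finset.mem_singleton] at h1
      rw [hδ, Finset.mem_singleton] at h2
      exact hεδ (h1.symm.trans h2)
  · right
    refine ⟨by omega, ?_⟩
    have hq' := Finset.card_eq_zero.1 hq
    obtain ⟨d, hd, hbd⟩ := T.exists_triangle (T.bd (T.ind E O)) (T.darkSide E O) hp (by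
      intro ε
      rw [bd_ind, hq']
      simp) (T.cyc_bd _)
    have hd' : ∀ i, (d i, i) ∈ E ∧ Quot.mk _ (Sum.inl (d i)) = O := by
      intro i
      simpa [darkSide] using hd i
    obtain ⟨s, hs, hin⟩ := hT _ d hbd (by
      intro i
      simp [ind, (hd' i).2]) (by
      intro heq
      refine hO (d 0) (T.mem_full.2 fun i => ?_) (hd' 0).2
      have h1 := (hd' (i + 1)).1
      rw [heq, hE, mem_edgesIn] at h1
      exact h1 i (fin_three_ne_add_one i))
    refine ⟨s, Finset.mem_sdiff.2 ⟨hs, fun hsY => ?_⟩, hin⟩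
    obtain ⟨γ, hγ, j, hj, hx⟩ := hY s hsY
    have := (T.mem_sides_of_inside E hin hγ hj hx).2
    rw [hq'] at this
    simp at this

/-- Summed over all regions, each edge has weight 3. A full triangle has weight at least 3, and any
other region at least 6, or 3 if a special vertex outside `Y` is charged for the rest. Combine with
Euler's inequality. -/
theorem card_edgesIn_le_of_support [Nonempty D] (hE : Fintype.card N = Fintype.card D + 2)
    {S : Finset N} (hS : S.card = 2)
    (hD : T.DigonRule S) (hT : T.TriangleRule S) (hA : T.Nonadjacent S) (Y : Finset N)
    (hY : ∀ x ∈ Y, ∃ ε ∈ T.edgesIn Y, ∃ j, j ≠ ε.2 ∧ T.dv ε.1 j = x)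
    (hne : (T.edgesIn (Y : Set N)).Nonempty) :
    Nat.card (T.edgesIn (Y : Set N)) ≤ 2 * (Y \ S).card + (T.full Y).card := by
  classical
  set E := T.edgesIn (Y : Set N) with hEdef
  have : Fintype (T.Region E) := Fintype.ofFinite _
  have hYne : Y.Nonempty := by
    obtain ⟨ε, hε⟩ := hne
    exact ⟨_, hε.1⟩
  have heuler := T.card_edgesIn_add_two_le hE Y hYne
  rw [← hEdef, Nat.card_eq_fintype_card (α := T.Region E)] at heuler
  set F := (T.full Y).image (fun d => (Quot.mk _ (Sum.inl d) : T.Region E)) with hF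
  have hFcard : F.card = (T.full Y).card :=
    Finset.card_image_of_injOn fun d hd e _ h => T.mk_inl_injOn_full Y hd h
  have hEcard : Nat.card E = (Finset.univ.filter (fun ε => ε ∈ E)).card := by
    rw [Nat.card_eq_fintype_card, Fintype.card_subtype]
  have hp : ∑ O : T.Region E, (T.darkSide E O).card = Nat.card E := by
    rw [hEcard, Finset.card_eq_sum_card_fiberwise
      (f := fun ε => (Quot.mk _ (Sum.inl ε.1) : T.Region E)) (t := Finset.univ) (by simp)]
    simp only [darkSide, Finset.filter_filter]
  have hq : ∑ O : T.Region E, (T.lightSide E O).card = Nat.card E := by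
    rw [hEcard, Finset.card_eq_sum_card_fiberwise
      (f := fun ε => (Quot.mk _ (Sum.inr (T.σ ε.2 ε.1)) : T.Region E)) (t := Finset.univ) (by simp)]
    simp only [lightSide, Finset.filter_filter]
  set g : T.Region E → ℕ := fun O => ((S \ Y).filter (fun s => T.Inside (T.ind E O) s)).card with hg
  have hgsum : ∑ O : T.Region E, g O ≤ (S \ Y).card := by
    rw [hg, ← Finset.card_biUnion]
    · exact Finset.card_le_card (Finset.biUnion_subset.2 fun O _ => Finset.filter_subset _ _)
    · intro O _ O' _ hOO'
      rw [Function.onFun, Finset.disjoint_left]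
      intro s h1 h2
      have h1 := (Finset.mem_filter.1 h1).2
      have h2 := (Finset.mem_filter.1 h2).2
      obtain ⟨d, hd⟩ := T.surj s
      have h1 := h1 (Sum.inl d) _ hd
      have h2 := h2 (Sum.inl d) _ hd
      simp only [ind, ite_eq_left_iff, zero_ne_one, imp_false, not_not] at h1 h2
      exact hOO' (h1.symm.trans h2)
  have hbound : ∀ O : T.Region E, (if O ∈ F then 3 else 6) ≤
      (T.darkSide E O).card + 2 * (T.lightSide E O).card + 3 * g O := by
    intro O
    split_ifs with h
    · obtain ⟨d, hd, rfl⟩ := Finset.mem_image.1 h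
      have : (Finset.univ.image (fun i : Fin 3 => (d, i))) ⊆ T.darkSide E (Quot.mk _ (Sum.inl d)) := by
        intro ε hε
        obtain ⟨i, _, rfl⟩ := Finset.mem_image.1 hε
        simp only [darkSide, Finset.mem_filter, Finset.mem_univ, true_and, and_true]
        exact T.mem_edgesIn.2 fun j _ => T.mem_full.1 hd j
      have h3 := Finset.card_le_card this
      rw [Finset.card_image_of_injective _ (fun i j h => (Prod.mk.inj h).2)] at h3
      simp only [Finset.card_univ, Fintype.card_fin] at h3
      omega
    · rcases T.region_bound hS hD hT hA Y E hEdef hY hne O (fun d hd hO => h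
        (Finset.mem_image.2 ⟨d, hd, hO⟩)) with h1 | ⟨h1, s, hs, hin⟩
      · omega
      · have : 0 < g O := Finset.card_pos.2 ⟨s, Finset.mem_filter.2 ⟨hs, hin⟩⟩
        omega
  have htotal := Finset.sum_le_sum fun O (_ : O ∈ (Finset.univ : Finset (T.Region E))) => hbound O
  rw [Finset.sum_add_distrib, Finset.sum_add_distrib, ← Finset.mul_sum, ← Finset.mul_sum, hp, hq,
    Finset.sum_ite] at htotal
  simp only [Finset.sum_const, smul_eq_mul, Finset.filter_univ_mem] at htotal
  have hc : (Finset.univ.filter (fun O : T.Region E => O ∉ F)).card + F.card =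
      Fintype.card (T.Region E) := by
    rw [← Finset.card_compl_add_card F]
    congr 2
    ext; simp
  -- As `|S| = 2`, `2|Y \ S| = 2|Y| - 4 + 2|S \ Y|`. The discharging gives `e(Y) ≤ 2|Y| - 4 + f(Y) +
  -- |S \ Y|`.
  have hS1 := Finset.card_sdiff_add_card_inter S Y
  have hS2 := Finset.card_sdiff_add_card_inter Y S
  rw [Finset.inter_comm] at hS2
  omega

/-- Vertices of `Y` without edges to `Y` can be dropped: this keeps the edges and does not increase
the right-hand side. -/
theorem card_edgesIn_le [Nonempty D] (hE : Fintype.card N = Fintype.card D + 2)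
    {S : Finset N} (hS : S.card = 2)
    (hD : T.DigonRule S) (hT : T.TriangleRule S) (hA : T.Nonadjacent S) (Y : Finset N) :
    Nat.card (T.edgesIn (Y : Set N)) ≤ 2 * (Y \ S).card + (T.full Y).card := by
  classical
  rcases (T.edgesIn (Y : Set N)).eq_empty_or_nonempty with h | hne
  · rw [h]; simp
  set Y' := Y.filter (fun x => ∃ ε ∈ T.edgesIn Y, ∃ j, j ≠ ε.2 ∧ T.dv ε.1 j = x) with hY'
  have hE' : T.edgesIn (Y' : Set N) = T.edgesIn (Y : Set N) := by
    ext ⟨d, i⟩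
    rw [mem_edgesIn, mem_edgesIn]
    constructor
    · intro h j hj
      exact (Finset.mem_filter.1 (h j hj)).1
    · intro h j hj
      exact Finset.mem_filter.2 ⟨h j hj, (d, i), T.mem_edgesIn.2 h, j, hj, rfl⟩
  have hF' : T.full Y' ⊆ T.full Y := by
    intro d hd
    rw [mem_full] at hd ⊢
    exact fun i => (Finset.mem_filter.1 (hd i)).1
  have := T.card_edgesIn_le_of_support hE hS hD hT hA Y' (by
    intro x hx
    rw [hE']
    exact (Finset.mem_filter.1 hx).2) (hE' ▸ hne)
  rw [hE'] at this
  refine this.trans (Nat.add_le_add (Nat.mul_le_mul_left _ (Finset.card_le_card ?_))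
    (Finset.card_le_card hF'))
  exact Finset.sdiff_subset_sdiff (Finset.filter_subset _ _) subset_rfl

end Hypermap

/-! ### Omissions, by Hall's theorem -/

namespace Hypermap

variable {D N : Type*} (T : Hypermap D N) [Fintype D] [Fintype N] [DecidableEq D] [DecidableEq N]

/-- The dark triangles at a vertex. -/
def darkAt (x : N) : Finset D := {d | T.dv d (T.col x) = x}

theorem mem_darkAt {x : N} {d : D} : d ∈ T.darkAt x ↔ T.dv d (T.col x) = x := by simp [darkAt]

/-- A choice of a vertex of each dark triangle such that all but two of the dark triangles at each
nonspecial vertex choose it, and all of the dark triangles at each special vertex. -/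
def IsOmission (S : Finset N) (o : D → Fin 3) : Prop :=
  ∀ x, ((T.darkAt x).filter (fun d => o d ≠ T.col x)).card = if x ∈ S then 0 else 2

theorem sum_card_darkAt (Y : Finset N) :
    ∑ x ∈ Y, (T.darkAt x).card = ∑ d, (Finset.univ.filter (fun i => T.dv d i ∈ Y)).card := by
  rw [← Finset.card_sigma, ← Finset.card_sigma]
  refine Finset.card_bij' (fun p _ => ⟨p.2, T.col p.1⟩) (fun p _ => ⟨T.dv p.1 p.2, p.1⟩) ?_ ?_ ?_ ?_
  · rintro ⟨x, d⟩ h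
    simp only [Finset.mem_sigma, mem_darkAt] at h
    simp [h.2, h.1]
  · rintro ⟨d, i⟩ h
    simp only [Finset.mem_sigma, Finset.mem_univ, true_and, Finset.mem_filter] at h
    simp [h, mem_darkAt, col_dv]
  · rintro ⟨x, d⟩ h
    simp only [Finset.mem_sigma, mem_darkAt] at h
    simp [h.2]
  · rintro ⟨d, i⟩ h
    simp [col_dv]

/-- Inclusion-exclusion in one triangle: `k + [k = 3] = [k ≥ 1] + k.choose 2` for `k ≤ 3`. -/
theorem fin_three_count (p : Fin 3 → Bool) :
    (Finset.univ.filter (fun i => p i = true)).card + (if ∀ i, p i = true then 1 else 0) =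
    (if ∃ i, p i = true then 1 else 0) +
      (Finset.univ.filter (fun i => p (i + 1) = true ∧ p (i + 2) = true)).card := by
  revert p; decide

theorem sum_card_darkAt_add_full (Y : Finset N) :
    ∑ x ∈ Y, (T.darkAt x).card + (T.full Y).card =
      (Finset.univ.filter (fun d => ∃ i, T.dv d i ∈ Y)).card +
        Nat.card (T.edgesIn (Y : Set N)) := by
  classical
  have h1 : Nat.card (T.edgesIn (Y : Set N)) =
      ∑ d, (Finset.univ.filter (fun i => T.dv d (i + 1) ∈ Y ∧ T.dv d (i + 2) ∈ Y)).card := by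
    rw [← Finset.card_sigma, Nat.card_eq_fintype_card, Fintype.card_subtype]
    refine Finset.card_bij (fun ε _ => ⟨ε.1, ε.2⟩) ?_ ?_ ?_
    · rintro ⟨d, i⟩ h
      simpa [edgesIn] using h
    · rintro ⟨d, i⟩ _ ⟨e, j⟩ _ h
      simpa using h
    · rintro ⟨d, i⟩ h
      exact ⟨(d, i), by simpa [edgesIn] using h, rfl⟩
  rw [h1, sum_card_darkAt, full, Finset.card_filter, Finset.card_filter, ← Finset.sum_add_distrib,
    ← Finset.sum_add_distrib]
  refine Finset.sum_congr rfl fun d _ => ?_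
  have := fin_three_count (fun i => decide (T.dv d i ∈ Y))
  simpa only [decide_eq_true_eq] using this

/-- Each vertex `x` asks for `a x` of its dark triangles, those that are to omit it. Hall's
condition is the sparsity bound, and the total demand is the number of dark triangles, so a system
of representatives uses each of them once. -/
theorem exists_isOmission [Nonempty D] (hE : Fintype.card N = Fintype.card D + 2)
    {S : Finset N} (hS : S.card = 2)
    (hD : T.DigonRule S) (hT : T.TriangleRule S) (hA : T.Nonadjacent S) :
    ∃ o, T.IsOmission S o := by
  classical
  have key : ∀ Y : Finset N, ∑ x ∈ Y, (T.darkAt x).card ≤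
      (Finset.univ.filter (fun d => ∃ i, T.dv d i ∈ Y)).card + 2 * (Y \ S).card := by
    intro Y
    have h1 := T.sum_card_darkAt_add_full Y
    have h2 := T.card_edgesIn_le hE hS hD hT hA Y
    omega
  have htot : ∑ x, (T.darkAt x).card = 3 * Fintype.card D := by
    rw [sum_card_darkAt]
    simp [mul_comm]
  -- The truncated subtraction in the demand `a` needs degree at least 2. This is `key` for the
  -- complement of `x`, compared with the total degree `3 |D|`.
  have hdeg : ∀ x ∉ S, 2 ≤ (T.darkAt x).card := by
    intro x hx
    have h1 := key (Finset.univ.erase x)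
    have h2 := Finset.add_sum_erase Finset.univ (fun x => (T.darkAt x).card) (Finset.mem_univ x)
    have h3 : (Finset.univ.filter (fun d => ∃ i, T.dv d i ∈ Finset.univ.erase x)).card ≤
      Fintype.card D := Finset.card_le_univ _
    have h4 : (Finset.univ.erase x \ S).card + 3 = Fintype.card N := by
      rw [Finset.card_sdiff_of_subset]
      · rw [Finset.card_erase_of_mem (Finset.mem_univ x), hS, Finset.card_univ]
        have : (insert x S).card ≤ Fintype.card N := Finset.card_le_univ _
        rw [Finset.card_insert_of_notMem hx, hS] at this
        omega
      · intro s hs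
        refine Finset.mem_erase.2 ⟨?_, Finset.mem_univ _⟩
        rintro rfl
        exact hx hs
    omega
  set a : N → ℕ := fun x => if x ∈ S then (T.darkAt x).card else (T.darkAt x).card - 2 with ha
  have ha' : ∀ x, a x + (if x ∈ S then 0 else 2) = (T.darkAt x).card := by
    intro x
    simp only [ha]
    split_ifs with h
    · rfl
    · have := hdeg x h
      omega
  have hasum : ∀ Y : Finset N, ∑ x ∈ Y, a x + 2 * (Y \ S).card = ∑ x ∈ Y, (T.darkAt x).card := by
    intro Y
    simp only [← ha', Finset.sum_add_distrib]
    congr 1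
    rw [Finset.sum_ite, Finset.sum_const_zero, zero_add, Finset.sum_const, smul_eq_mul, mul_comm,
      Finset.filter_notMem_eq_sdiff]
  let t : (Σ x : N, Fin (a x)) → Finset D := fun p => T.darkAt p.1
  obtain ⟨f, hf, hft⟩ := (Finset.all_card_le_biUnion_card_iff_exists_injective t).1 (by
    intro s
    set X := s.image Sigma.fst with hX
    have h1 : s.card ≤ ∑ x ∈ X, a x := by
      have : s ⊆ X.sigma (fun _ => Finset.univ) := by
        intro p hp
        exact Finset.mem_sigma.2 ⟨Finset.mem_image_of_mem _ hp, Finset.mem_univ _⟩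
      have := Finset.card_le_card this
      rw [Finset.card_sigma] at this
      simpa using this
    have h2 : s.biUnion t = Finset.univ.filter (fun d => ∃ i, T.dv d i ∈ X) := by
      ext d
      simp only [t, Finset.mem_biUnion, mem_darkAt, Finset.mem_filter, Finset.mem_univ, true_and]
      constructor
      · rintro ⟨p, hp, h⟩
        refine ⟨T.col p.1, ?_⟩
        rw [h]
        exact Finset.mem_image_of_mem _ hp
      · rintro ⟨i, hi⟩
        obtain ⟨p, hp, h⟩ := Finset.mem_image.1 hi
        refine ⟨p, hp, ?_⟩
        rw [h, T.col_dv]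
    rw [h2]
    have h3 := key X
    have h4 := hasum X
    omega)
  have hcard : Fintype.card (Σ x : N, Fin (a x)) = Fintype.card D := by
    rw [Fintype.card_sigma]
    simp only [Fintype.card_fin]
    have h1 := hasum Finset.univ
    rw [htot] at h1
    have h2 : (Finset.univ \ S).card + 2 = Fintype.card N := by
      rw [← hS, Finset.card_sdiff_add_card_eq_card (Finset.subset_univ _), Finset.card_univ]
    omega
  have hbij := (Fintype.bijective_iff_injective_and_card f).2 ⟨hf, hcard⟩
  let g := (Equiv.ofBijective f hbij).symm
  have hfg : ∀ d, f (g d) = d := fun d => (Equiv.ofBijective f hbij).apply_symm_apply d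
  have hgf : ∀ p, g (f p) = p := fun p => (Equiv.ofBijective f hbij).symm_apply_apply p
  have hg : ∀ d, T.dv d (T.col (g d).1) = (g d).1 := by
    intro d
    have := hft (g d)
    rwa [hfg, mem_darkAt] at this
  refine ⟨fun d => T.col (g d).1, fun x => ?_⟩
  have hc : ((T.darkAt x).filter (fun d => T.col (g d).1 = T.col x)).card = a x := by
    rw [show a x = (Finset.univ : Finset (Fin (a x))).card by simp]
    symm
    refine Finset.card_bij (fun k _ => f ⟨x, k⟩) ?_ ?_ ?_
    · intro k _
      rw [Finset.mem_filter, hgf]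
      exact ⟨hft ⟨x, k⟩, rfl⟩
    · intro k _ l _ h
      have := hf h
      simpa using this
    · intro d hd
      obtain ⟨h1, h2⟩ := Finset.mem_filter.1 hd
      rw [mem_darkAt] at h1
      have h3 : (g d).1 = x := by rw [← hg d, h2, h1]
      subst h3
      exact ⟨(g d).2, Finset.mem_univ _, hfg d⟩
  have h1 := Finset.card_filter_add_card_filter_not (s := T.darkAt x)
    (fun d => T.col (g d).1 = T.col x)
  have h2 := ha' x
  simp only [ne_eq] at h1 ⊢
  omega

end Hypermap

/-! ### Necessity of the two rules: counting inside a region -/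

namespace Hypermap

variable {D N : Type*} (T : Hypermap D N)

/-- The triangles at each vertex form a single cycle. -/
def Star : Prop :=
  ∀ x (R : D ⊕ D → ZMod 2), (∀ d, T.dv d (T.col x) = x → ∀ j, j ≠ T.col x → T.bd R (d, j) = 0) →
    ∀ a b, T.tv a (T.col x) = x → T.tv b (T.col x) = x → R a = R b

variable [Fintype D] [Fintype N] [DecidableEq D] [DecidableEq N]

/-- Euler's inequality for a region relative to its boundary. -/
theorem interior_bound (hE : Fintype.card N = Fintype.card D + 2) (R : D ⊕ D → ZMod 2)
    (hR : ∃ a, R a = 1) [DecidablePred (T.Inside R)]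
    (hfill : ∀ z : D × Fin 3 → ZMod 2,
      (∀ d i, z (d, i) ≠ 0 → R (Sum.inl d) = 1 ∧ R (Sum.inr (T.σ i d)) = 1) →
      (∀ x, T.Inside R x → T.cyc z x = 0) →
      ∃ y : D × Fin 3 → ZMod 2, (∀ ε, y ε ≠ 0 → T.bd R ε ≠ 0) ∧ T.cyc (z + y) = 0) :
    3 * (Finset.univ.filter (fun d => R (Sum.inl d) = 1)).card + 3 ≤
      3 * (Finset.univ.filter (fun x => T.Inside R x)).card +
      2 * (Finset.univ.filter (fun ε : D × Fin 3 => T.bd R ε ≠ 0 ∧ R (Sum.inl ε.1) = 1)).card +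
      (Finset.univ.filter (fun ε : D × Fin 3 => T.bd R ε ≠ 0 ∧
        R (Sum.inr (T.σ ε.2 ε.1)) = 1)).card ∧
    ∃ u : ℕ, 3 * (Finset.univ.filter (fun d => R (Sum.inl d) = 1)).card +
      (Finset.univ.filter (fun ε : D × Fin 3 => T.bd R ε ≠ 0 ∧
        R (Sum.inr (T.σ ε.2 ε.1)) = 1)).card = 3 * u +
      (Finset.univ.filter (fun ε : D × Fin 3 => T.bd R ε ≠ 0 ∧ R (Sum.inl ε.1) = 1)).card := by
  classical
  set t := (Finset.univ.filter (fun d => R (Sum.inl d) = 1)).card with ht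
  set u := (Finset.univ.filter (fun d => R (Sum.inr d) = 1)).card with hu
  set a := (Finset.univ.filter (fun x => T.Inside R x)).card with ha
  set p := (Finset.univ.filter (fun ε : D × Fin 3 => T.bd R ε ≠ 0 ∧ R (Sum.inl ε.1) = 1)).card
    with hp
  set q := (Finset.univ.filter (fun ε : D × Fin 3 => T.bd R ε ≠ 0 ∧
        R (Sum.inr (T.σ ε.2 ε.1)) = 1)).card with hq
  let Ein := {ε : D × Fin 3 // R (Sum.inl ε.1) = 1 ∧ R (Sum.inr (T.σ ε.2 ε.1)) = 1}
  have hbd : ∀ ε : D × Fin 3, T.bd R ε ≠ 0 ↔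
      ¬ (R (Sum.inl ε.1) = 1 ↔ R (Sum.inr (T.σ ε.2 ε.1)) = 1) := by
    rintro ⟨d, i⟩
    rw [bd_apply]
    simp only
    generalize R (Sum.inl d) = b, R (Sum.inr (T.σ i d)) = c
    revert b c; decide
  have hEcard : Fintype.card Ein = (Finset.univ.filter (fun ε : D × Fin 3 =>
      R (Sum.inl ε.1) = 1 ∧ R (Sum.inr (T.σ ε.2 ε.1)) = 1)).card := Fintype.card_subtype _
  have h1 : Fintype.card Ein + p = 3 * t := by
    have e1 : 3 * t = (Finset.univ.filter (fun ε : D × Fin 3 => R (Sum.inl ε.1) = 1)).card := by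
      rw [show (Finset.univ.filter (fun ε : D × Fin 3 => R (Sum.inl ε.1) = 1)) =
        (Finset.univ.filter (fun d => R (Sum.inl d) = 1)) ×ˢ Finset.univ by ext ⟨d, i⟩; simp]
      simp [mul_comm, ht]
    rw [e1, ← Finset.card_filter_add_card_filter_not
      (fun ε : D × Fin 3 => R (Sum.inr (T.σ ε.2 ε.1)) = 1),
      Finset.filter_filter, Finset.filter_filter, hEcard, hp]
    congr 2
    refine Finset.filter_congr fun ε _ => ?_
    rw [hbd]
    tauto
  have h2 : Fintype.card Ein + q = 3 * u := by
    have e1 : 3 * u = (Finset.univ.filter (fun ε : D × Fin 3 =>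
        R (Sum.inr (T.σ ε.2 ε.1)) = 1)).card := by
      rw [show 3 * u = ((Finset.univ.filter (fun d => R (Sum.inr d) = 1)) ×ˢ
        (Finset.univ : Finset (Fin 3))).card by simp [mul_comm, hu]]
      symm
      refine Finset.card_bij (fun ε _ => (T.σ ε.2 ε.1, ε.2)) ?_ ?_ ?_
      · rintro ⟨d, i⟩ h
        simpa using h
      · rintro ⟨d, i⟩ _ ⟨e, j⟩ _ h
        simp only [Prod.mk.injEq] at h
        obtain ⟨h, rfl⟩ := h
        rw [(T.σ i).injective h]
      · rintro ⟨d, i⟩ h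
        exact ⟨((T.σ i).symm d, i), by simpa using h, by simp⟩
    rw [e1, ← Finset.card_filter_add_card_filter_not (fun ε : D × Fin 3 => R (Sum.inl ε.1) = 1),
      Finset.filter_filter, Finset.filter_filter, hEcard, hq]
    congr 1
    · congr 1
      exact Finset.filter_congr fun ε _ => by tauto
    · congr 1
      refine Finset.filter_congr fun ε _ => ?_
      rw [hbd]
      tauto
  let ext : (Ein → ZMod 2) →ₗ[ZMod 2] (D × Fin 3 → ZMod 2) :=
    { toFun := fun y ε => if h : R (Sum.inl ε.1) = 1 ∧ R (Sum.inr (T.σ ε.2 ε.1)) = 1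
        then y ⟨ε, h⟩ else 0
      map_add' := by intro y z; ext ε; simp only [Pi.add_apply]; split_ifs <;> simp
      map_smul' := by intro c y; ext ε; simp only [Pi.smul_apply]; split_ifs <;> simp }
  have ext_apply : ∀ y (ε : Ein), ext y ε.1 = y ε := fun y ε => dif_pos ε.2
  let L : (Ein → ZMod 2) →ₗ[ZMod 2] ({x // T.Inside R x} → ZMod 2) :=
    (LinearMap.funLeft (ZMod 2) (ZMod 2) Subtype.val) ∘ₗ T.cyc ∘ₗ ext
  let ext' : ({a // R a = 1} → ZMod 2) →ₗ[ZMod 2] (D ⊕ D → ZMod 2) :=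
    { toFun := fun y a => if h : R a = 1 then y ⟨a, h⟩ else 0
      map_add' := by intro y z; ext ε; simp only [Pi.add_apply]; split_ifs <;> simp
      map_smul' := by intro c y; ext ε; simp only [Pi.smul_apply]; split_ifs <;> simp }
  have ext'_apply : ∀ y b (h : R b = 1), ext' y b = y ⟨b, h⟩ := fun y b h => dif_pos h
  let M : ({a // R a = 1} → ZMod 2) →ₗ[ZMod 2] (Ein → ZMod 2) :=
    (LinearMap.funLeft (ZMod 2) (ZMod 2) Subtype.val) ∘ₗ T.bd ∘ₗ ext'
  have hM : ∀ S (ε : Ein), M S ε = S ⟨_, ε.2.1⟩ + S ⟨_, ε.2.2⟩ := by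
    intro S ε
    change ext' S (Sum.inl ε.1.1) + ext' S (Sum.inr (T.σ ε.1.2 ε.1.1)) = _
    rw [ext'_apply _ _ ε.2.1, ext'_apply _ _ ε.2.2]
  -- Relative exactness: a chain of inner edges without boundary inside is completed to a cycle by
  -- boundary edges of `R`, and this cycle bounds.
  have hle : LinearMap.ker L ≤ LinearMap.range M := by
    intro z hz
    obtain ⟨y, hy, hzy⟩ := hfill (ext z) (by
      intro d i h
      by_contra h'
      exact h (dif_neg h')) (by
      intro x hx
      exact congrFun (LinearMap.mem_ker.1 hz) ⟨x, hx⟩)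
    obtain ⟨g, hg⟩ := T.exists_bd_eq hE hzy
    refine ⟨fun b => g b.1, ?_⟩
    ext ε
    rw [hM]
    have := congrFun hg ε.1
    rw [Pi.add_apply, ext_apply] at this
    have hy0 : y ε.1 = 0 := by
      by_contra h
      have := hy _ h
      rw [hbd] at this
      exact this ⟨fun _ => ε.2.2, fun _ => ε.2.1⟩
    rw [hy0, add_zero] at this
    exact this
  have hrL := LinearMap.finrank_range_add_finrank_ker L
  have hrM := LinearMap.finrank_range_add_finrank_ker M
  have hkM : 1 ≤ Module.finrank (ZMod 2) (LinearMap.ker M) := by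
    rw [Nat.one_le_iff_ne_zero, ← Nat.pos_iff_ne_zero, Module.finrank_pos_iff_exists_ne_zero]
    refine ⟨⟨1, ?_⟩, ?_⟩
    · rw [LinearMap.mem_ker]
      ext ε
      rw [hM]
      exact CharTwo.add_self_eq_zero _
    · intro h
      obtain ⟨b, hb⟩ := hR
      have := congrArg (fun z => z.1 ⟨b, hb⟩) h
      simp at this
  have hLM := Submodule.finrank_mono hle
  have hrL' := Submodule.finrank_le (LinearMap.range L)
  rw [Module.finrank_fintype_fun_eq_card] at hrL hrM hrL'
  have hacard : Fintype.card {x // T.Inside R x} = a := Fintype.card_subtype _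
  have htu : Fintype.card {b // R b = 1} = t + u := by
    rw [Fintype.card_congr (Equiv.subtypeSum (p := fun b => R b = 1)), Fintype.card_sum,
      Fintype.card_subtype, Fintype.card_subtype]
  -- The ranks give `|Ein| + 1 ≤ a + t + u`. Eliminate `|Ein|` and `u` with `|Ein| + p = 3t` and
  -- `|Ein| + q = 3u`.
  exact ⟨by omega, u, by omega⟩

/-- Counting the choices inside a region. -/
theorem two_mul_card_dark {S : Finset N} {o : D → Fin 3} (ho : T.IsOmission S o)
    (R : D ⊕ D → ZMod 2) (hclean : ∀ s ∈ S, ¬ T.Inside R s) [DecidablePred (T.Inside R)] :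
    2 * (Finset.univ.filter (fun d => R (Sum.inl d) = 1)).card =
      2 * (Finset.univ.filter (fun x => T.Inside R x)).card +
      (Finset.univ.filter (fun ε : D × Fin 3 => R (Sum.inl ε.1) = 1 ∧ ε.2 ≠ o ε.1 ∧
        ¬ T.Inside R (T.dv ε.1 ε.2))).card := by
  have h1 : 2 * (Finset.univ.filter (fun d => R (Sum.inl d) = 1)).card =
      (Finset.univ.filter (fun ε : D × Fin 3 => R (Sum.inl ε.1) = 1 ∧ ε.2 ≠ o ε.1)).card := by
    rw [show (Finset.univ.filter (fun ε : D × Fin 3 => R (Sum.inl ε.1) = 1 ∧ ε.2 ≠ o ε.1)).card =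
      ((Finset.univ.filter (fun d => R (Sum.inl d) = 1)).sigma
        (fun d => Finset.univ.filter (fun i => i ≠ o d))).card from
      Finset.card_bij (fun ε _ => ⟨ε.1, ε.2⟩) (by rintro ⟨d, i⟩ h; simpa using h)
        (by rintro ⟨d, i⟩ _ ⟨e, j⟩ _ h; simpa using h)
        (by rintro ⟨d, i⟩ h; exact ⟨(d, i), by simpa using h, rfl⟩), Finset.card_sigma]
    have : ∀ i : Fin 3, (Finset.univ.filter (fun j => j ≠ i)).card = 2 := by decide
    simp only [this, Finset.sum_const, smul_eq_mul, mul_comm]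
  have h2 : (Finset.univ.filter (fun ε : D × Fin 3 => (R (Sum.inl ε.1) = 1 ∧ ε.2 ≠ o ε.1) ∧
      T.Inside R (T.dv ε.1 ε.2))).card =
      2 * (Finset.univ.filter (fun x => T.Inside R x)).card := by
    rw [show (Finset.univ.filter (fun ε : D × Fin 3 => (R (Sum.inl ε.1) = 1 ∧ ε.2 ≠ o ε.1) ∧
      T.Inside R (T.dv ε.1 ε.2))).card =
      ((Finset.univ.filter (fun x => T.Inside R x)).sigma
        (fun x => (T.darkAt x).filter (fun d => o d ≠ T.col x))).card from ?_, Finset.card_sigma]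
    · rw [Finset.sum_congr rfl (g := fun _ => 2)]
      · simp [mul_comm]
      · intro x hx
        rw [ho x, if_neg]
        intro hs
        exact hclean x hs (Finset.mem_filter.1 hx).2
    · refine Finset.card_bij (fun ε _ => ⟨T.dv ε.1 ε.2, ε.1⟩) ?_ ?_ ?_
      · rintro ⟨d, i⟩ h
        simp only [Finset.mem_filter, Finset.mem_univ, true_and] at h
        simp [h.2, mem_darkAt, T.col_dv, h.1.2.symm]
      · rintro ⟨d, i⟩ _ ⟨e, j⟩ _ h
        simp only [Sigma.mk.injEq, heq_eq_eq] at h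
        obtain ⟨h, rfl⟩ := h
        rw [T.dv_inj h]
      · rintro ⟨x, d⟩ h
        simp only [Finset.mem_sigma, Finset.mem_filter, Finset.mem_univ, true_and,
          mem_darkAt] at h
        refine ⟨(d, T.col x), ?_, ?_⟩
        · simp only [Finset.mem_filter, Finset.mem_univ, true_and, h.2.1]
          exact ⟨⟨h.1 (Sum.inl d) _ h.2.1, fun h' => h.2.2 h'.symm⟩, h.1⟩
        · simp [h.2.1]
  rw [h1, ← h2, ← Finset.card_filter_add_card_filter_not (fun ε : D × Fin 3 =>
    T.Inside R (T.dv ε.1 ε.2)), Finset.filter_filter, Finset.filter_filter]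
  simp only [and_assoc]

theorem fin_three_add_ne (k : Fin 3) : k + 1 ≠ k + 2 := by revert k; decide

theorem dv_add_ne (d : D) (i : Fin 3) : T.dv d (i + 1) ≠ T.dv d (i + 2) :=
  fun h => fin_three_add_ne i (T.dv_inj h)

theorem not_inside_of_bd {R : D ⊕ D → ZMod 2} {d : D} {i j : Fin 3} (h : T.bd R (d, i) ≠ 0)
    (hj : j ≠ i) : ¬ T.Inside R (T.dv d j) := by
  intro hin
  apply h
  rw [bd_apply, hin (Sum.inl d) j rfl, hin (Sum.inr (T.σ i d)) j (T.compat _ _ _ hj)]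
  rfl

/-- A chain inside a region that has its boundary off the interior of the region has its boundary
on the boundary of the region. -/
theorem cyc_eq_zero_of_star (hstar : T.Star) {R : D ⊕ D → ZMod 2} {z : D × Fin 3 → ZMod 2}
    (hz : ∀ d i, z (d, i) ≠ 0 → R (Sum.inl d) = 1 ∧ R (Sum.inr (T.σ i d)) = 1)
    (hz' : ∀ x, T.Inside R x → T.cyc z x = 0) {x : N}
    (hx : ∀ d i, T.bd R (d, i) ≠ 0 → ∀ j, j ≠ i → T.dv d j ≠ x) : T.cyc z x = 0 := by
  by_contra hne
  refine hne (hz' x ?_)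
  rw [cyc_apply_col] at hne
  obtain ⟨d, _, hd⟩ := Finset.exists_ne_zero_of_sum_ne_zero hne
  have hdx : T.dv d (T.col x) = x := by
    by_contra h
    exact hd (if_neg h)
  rw [if_pos hdx] at hd
  have hRd : R (Sum.inl d) = 1 := by
    by_contra h
    apply hd
    have : ∀ i, z (d, i) = 0 := fun i => by
      by_contra h'
      exact h (hz d i h').1
    rw [this, this, add_zero]
  intro a i ha
  have hi : T.col x = i := by rw [← ha, T.col_tv]
  rw [← hRd]
  refine hstar x R ?_ _ _ (by rw [hi, ha]) hdx
  intro e he j hj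
  by_contra h
  exact hx e j h _ hj.symm he

/-- In a digon without special vertex inside, the congruence modulo 3 forces one dark and one light
inner side, and `interior_bound` gives at most as many dark triangles as inner vertices. Each dark
triangle has two events and each inner vertex absorbs two, so no event is left for the boundary. But
the dark triangle at the boundary has one there. -/
theorem digonRule_of_isOmission (hE : Fintype.card N = Fintype.card D + 2) (hstar : T.Star)
    {S : Finset N} {o : D → Fin 3} (ho : T.IsOmission S o) : T.DigonRule S := by
  classical
  intro R ε δ hεδ hbd
  by_contra! hclean
  have hbd' : ∀ γ, T.bd R γ ≠ 0 ↔ γ = ε ∨ γ = δ := by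
    intro γ
    rw [hbd, Pi.add_apply, Pi.single_apply, Pi.single_apply]
    by_cases h1 : γ = ε
    · subst h1; simp [hεδ]
    · by_cases h2 : γ = δ
      · subst h2; simp [hεδ.symm]
      · simp [h1, h2]
  have hcyc : T.cyc (Pi.single ε 1) = T.cyc (Pi.single δ 1) := by
    have := T.cyc_bd R
    rw [hbd, map_add] at this
    ext x
    exact zmod_two_add_eq_zero.1 (congrFun this x)
  have hside : ∀ γ : D × Fin 3, T.bd R γ ≠ 0 →
      ¬ (R (Sum.inl γ.1) = 1 ↔ R (Sum.inr (T.σ γ.2 γ.1)) = 1) := by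
    rintro ⟨d, i⟩ h
    rw [bd_apply] at h
    simp only
    revert h
    generalize R (Sum.inl d) = b, R (Sum.inr (T.σ i d)) = c
    revert b c; decide
  obtain ⟨hb, u, hu⟩ := T.interior_bound hE R (by
    by_contra! h
    have := hside ε ((hbd' ε).2 (Or.inl rfl))
    simp [h] at this) (by
    intro z hz hz'
    obtain ⟨d, i⟩ := ε
    have hsupp : ∀ x, x ≠ T.dv d (i + 1) → x ≠ T.dv d (i + 2) → T.cyc z x = 0 := by
      intro x h1 h2
      refine T.cyc_eq_zero_of_star hstar hz hz' ?_
      intro e k hek j hj hx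
      have hmem : T.cyc (Pi.single (e, k) 1) x = 0 := by
        have : T.cyc (Pi.single (e, k) 1) = T.cyc (Pi.single (d, i) 1) := by
          rcases (hbd' _).1 hek with h | h
          · rw [h]
          · rw [h, hcyc]
        rw [this, cyc_single, Pi.add_apply, Pi.single_eq_of_ne h1, Pi.single_eq_of_ne h2, add_zero]
      rw [cyc_single, Pi.add_apply] at hmem
      have hne := T.dv_add_ne e k
      rcases fin_three_eq_add k j hj with rfl | rfl
      · rw [hx, Pi.single_eq_same, Pi.single_eq_of_ne (by rw [← hx]; exact hne)] at hmem
        simp at hmem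
      · rw [hx, Pi.single_eq_same, Pi.single_eq_of_ne (by rw [← hx]; exact hne.symm)] at hmem
        simp at hmem
    have hne := T.dv_add_ne d i
    have hsum := T.sum_cyc z
    rw [← Finset.sum_subset (Finset.subset_univ {T.dv d (i + 1), T.dv d (i + 2)}) (by
      intro x _ hx
      simp only [Finset.mem_insert, Finset.mem_singleton, not_or] at hx
      exact hsupp x hx.1 hx.2), Finset.sum_pair hne] at hsum
    -- The boundary of `z` is zero or the two corners of the digon, and one side of the digon
    -- repairs it.
    refine ⟨T.cyc z (T.dv d (i + 1)) • Pi.single (d, i) 1, ?_, ?_⟩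
    · intro γ hγ
      rw [hbd']
      left
      by_contra h
      apply hγ
      rw [Pi.smul_apply, Pi.single_eq_of_ne h, smul_zero]
    · rw [map_add, map_smul, cyc_single]
      ext x
      simp only [Pi.add_apply, Pi.smul_apply, smul_eq_mul, Pi.zero_apply]
      by_cases h1 : x = T.dv d (i + 1)
      · subst h1
        rw [Pi.single_eq_same, Pi.single_eq_of_ne hne, add_zero, mul_one]
        exact CharTwo.add_self_eq_zero _
      · by_cases h2 : x = T.dv d (i + 2)
        · subst h2
          rw [Pi.single_eq_same, Pi.single_eq_of_ne hne.symm, zero_add, mul_one, add_comm]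
          exact hsum
        · rw [Pi.single_eq_of_ne h1, Pi.single_eq_of_ne h2, hsupp x h1 h2]
          simp)
  have hcount := T.two_mul_card_dark ho R hclean
  set p := (Finset.univ.filter (fun ε : D × Fin 3 => T.bd R ε ≠ 0 ∧ R (Sum.inl ε.1) = 1)) with hp
  set q := (Finset.univ.filter (fun ε : D × Fin 3 => T.bd R ε ≠ 0 ∧
        R (Sum.inr (T.σ ε.2 ε.1)) = 1)) with hq
  have hpq : p.card + q.card = 2 := by
    rw [← Finset.card_pair hεδ, ← Finset.card_union_of_disjoint]
    · congr 1
      ext γ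
      simp only [hp, hq, Finset.mem_union, Finset.mem_filter, Finset.mem_univ, true_and,
        Finset.mem_insert, Finset.mem_singleton]
      rw [← hbd' γ]
      have := hside γ
      tauto
    · rw [Finset.disjoint_left]
      intro γ h1 h2
      simp only [hp, hq, Finset.mem_filter, Finset.mem_univ, true_and] at h1 h2
      exact hside γ h1.1 ⟨fun _ => h2.2, fun _ => h1.2⟩
  have hp1 : 0 < p.card := by omega
  obtain ⟨⟨d, i⟩, hdi⟩ := Finset.card_pos.1 hp1
  simp only [hp, Finset.mem_filter, Finset.mem_univ, true_and] at hdi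
  obtain ⟨j, hj1, hj2⟩ := fin_three_exists_ne i (o d)
  have : 0 < (Finset.univ.filter (fun ε : D × Fin 3 => R (Sum.inl ε.1) = 1 ∧ ε.2 ≠ o ε.1 ∧
        ¬ T.Inside R (T.dv ε.1 ε.2))).card := by
    refine Finset.card_pos.2 ⟨(d, j), ?_⟩
    simp only [Finset.mem_filter, Finset.mem_univ, true_and]
    exact ⟨hdi.2, hj2.symm, T.not_inside_of_bd hdi.1 hj1.symm⟩
  omega

/-- Each dark triangle at a side of a nonfacial triangle has an event at an end of that side. If one
dark triangle lies at two sides, all its vertices are corners and it provides two events; so there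
are always three. -/
theorem card_triangle_choices (d : Fin 3 → D) (c : D → Fin 3) (P : Finset (D × Fin 3))
    (hP : ∀ i j, j ≠ i → j ≠ c (d i) → (d i, j) ∈ P) (hd : ¬ ∀ i, d i = d 0) : 3 ≤ P.card := by
  have hex : ∀ i, ∃ j, (d i, j) ∈ P := by
    intro i
    obtain ⟨j, h1, h2⟩ := fin_three_exists_ne i (c (d i))
    exact ⟨j, hP i j h1.symm h2.symm⟩
  choose j hj using hex
  have hpair : ∀ i k l, i ≠ k → d i = d k → d l ≠ d i → 3 ≤ P.card := by
    intro i k l hik h hl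
    have hmem : ∀ m, m ≠ c (d i) → (d i, m) ∈ P := by
      intro m hm
      by_cases hmi : m = i
      · rw [h] at hm ⊢
        exact hP k m (hmi ▸ hik) hm
      · exact hP i m hmi hm
    have hsub : ({(d i, c (d i) + 1), (d i, c (d i) + 2), (d l, j l)} : Finset (D × Fin 3)) ⊆ P := by
      intro x hx
      simp only [Finset.mem_insert, Finset.mem_singleton] at hx
      rcases hx with rfl | rfl | rfl
      · exact hmem _ (fin_three_ne_add_one _).symm
      · exact hmem _ (fin_three_ne_add_two _).symm
      · exact hj l
    refine le_trans (le_of_eq ?_) (Finset.card_le_card hsub)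
    rw [Finset.card_insert_of_notMem, Finset.card_pair]
    · simp [hl.symm]
    · simp [hl.symm]
  by_cases h01 : d 0 = d 1
  · by_cases h2 : d 2 = d 0
    · refine absurd (fun i => ?_) hd
      fin_cases i
      exacts [rfl, h01.symm, h2]
    · exact hpair 0 1 2 (by decide) h01 h2
  · by_cases h02 : d 0 = d 2
    · exact hpair 0 2 1 (by decide) h02 (Ne.symm h01)
    · by_cases h12 : d 1 = d 2
      · exact hpair 1 2 0 (by decide) h12 h01
      · have hsub : ({(d 0, j 0), (d 1, j 1), (d 2, j 2)} : Finset (D × Fin 3)) ⊆ P := by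
          intro x hx
          simp only [Finset.mem_insert, Finset.mem_singleton] at hx
          rcases hx with rfl | rfl | rfl <;> exact hj _
        refine le_trans (le_of_eq ?_) (Finset.card_le_card hsub)
        rw [Finset.card_insert_of_notMem, Finset.card_pair]
        · simp [h12]
        · simp [h01, h02]

/-- With no special vertex inside, `interior_bound` with `p = 3`, `q = 0` leaves at most one dark
triangle more than inner vertices, hence at most two events at the corners. There are at least
three. -/
theorem triangleRule_of_isOmission (hE : Fintype.card N = Fintype.card D + 2) (hstar : T.Star)
    {S : Finset N} {o : D → Fin 3} (ho : T.IsOmission S o) : T.TriangleRule S := by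
  classical
  intro R d hbd hRd hd
  by_contra! hclean
  have hval : ∀ e i, T.bd R (e, i) = if e = d i then 1 else 0 := by
    intro e i
    rw [hbd, Finset.sum_apply, Finset.sum_eq_single i]
    · simp [Pi.single_apply]
    · intro j _ hj
      simp [hj.symm]
    · simp
  have hbd' : ∀ e i, T.bd R (e, i) ≠ 0 ↔ e = d i := by
    intro e i
    rw [hval]
    simp
  -- By parity at a corner, the sides of the other two types meet there.
  have hv : ∀ j, T.dv (d (j + 2)) j = T.dv (d (j + 1)) j := by
    intro j
    have h := congrFun (T.cyc_bd R) (T.dv (d (j + 1)) j)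
    rw [cyc_apply_col, T.col_dv] at h
    simp only [hval] at h
    by_contra hne
    have : ∑ e, (if T.dv e j = T.dv (d (j + 1)) j then
        ((if e = d (j + 1) then 1 else 0) + if e = d (j + 2) then 1 else 0 : ZMod 2) else 0) =
        ∑ e, if e = d (j + 1) then 1 else 0 := by
      refine Finset.sum_congr rfl fun e _ => ?_
      by_cases h1 : e = d (j + 1)
      · subst h1
        have : d (j + 1) ≠ d (j + 2) := fun h => hne (by rw [h])
        simp [this]
      · by_cases h2 : e = d (j + 2)
        · subst h2
          rw [if_neg hne, if_neg h1]
        · simp [h1, h2]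
    rw [this] at h
    simp at h
  set v : Fin 3 → N := fun j => T.dv (d (j + 1)) j with hvdef
  have hv' : ∀ i j, j ≠ i → T.dv (d i) j = v j := by
    intro i j hij
    rcases fin_three_eq_add j i hij.symm with rfl | rfl
    · rfl
    · exact hv j
  have hvne : ∀ i j, i ≠ j → v i ≠ v j := fun i j hij h => hij (T.dv_inj h)
  have hside : ∀ γ : D × Fin 3, T.bd R γ ≠ 0 →
      R (Sum.inl γ.1) = 1 ∧ R (Sum.inr (T.σ γ.2 γ.1)) ≠ 1 := by
    rintro ⟨e, i⟩ h
    have h1 := (hbd' e i).1 h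
    subst h1
    refine ⟨hRd i, fun h1 => ?_⟩
    rw [bd_apply, hRd, h1] at h
    exact h rfl
  obtain ⟨hb, -⟩ := T.interior_bound hE R ⟨_, hRd 0⟩ (by
    intro z hz hz'
    have hsupp : ∀ x, (∀ j, x ≠ v j) → T.cyc z x = 0 := by
      intro x hx
      refine T.cyc_eq_zero_of_star hstar hz hz' ?_
      intro e k hek j hj hxe
      have h1 := (hbd' e k).1 hek
      subst h1
      exact hx j (hxe ▸ hv' k j hj)
    have hsum := T.sum_cyc z
    rw [← Finset.sum_subset (Finset.subset_univ {v 0, v 1, v 2}) (by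
      intro x _ hx
      simp only [Finset.mem_insert, Finset.mem_singleton, not_or] at hx
      refine hsupp x fun j => ?_
      fin_cases j
      exacts [hx.1, hx.2.1, hx.2.2]),
      Finset.sum_insert (by simp [hvne 0 1 (by decide), hvne 0 2 (by decide)]),
      Finset.sum_pair (hvne 1 2 (by decide))] at hsum
    -- Two sides correct the boundary at `v 0` and `v 1`; at `v 2` it is then correct because
    -- boundaries have sum zero.
    refine ⟨T.cyc z (v 0) • Pi.single (d 1, 1) 1 + T.cyc z (v 1) • Pi.single (d 0, 0) 1, ?_, ?_⟩
    · rintro ⟨e, i⟩ h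
      rw [hbd']
      by_contra hne
      apply h
      rw [Pi.add_apply, Pi.smul_apply, Pi.smul_apply, Pi.single_eq_of_ne, Pi.single_eq_of_ne]
      · simp
      · rintro h'
        simp only [Prod.mk.injEq] at h'
        obtain ⟨rfl, rfl⟩ := h'
        exact hne rfl
      · rintro h'
        simp only [Prod.mk.injEq] at h'
        obtain ⟨rfl, rfl⟩ := h'
        exact hne rfl
    · rw [map_add, map_add, map_smul, map_smul, cyc_single, cyc_single,
        hv' 1 (1 + 1) (by decide), hv' 1 (1 + 2) (by decide), hv' 0 (0 + 1) (by decide),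
        hv' 0 (0 + 2) (by decide), show (1 + 1 : Fin 3) = 2 from rfl,
        show (1 + 2 : Fin 3) = 0 from rfl, show (0 + 1 : Fin 3) = 1 from rfl,
        show (0 + 2 : Fin 3) = 2 from rfl]
      ext x
      have h01 := hvne 0 1 (by decide)
      have h02 := hvne 0 2 (by decide)
      have h12 := hvne 1 2 (by decide)
      by_cases h0 : x = v 0
      · subst h0
        simp [h01, h02, CharTwo.add_self_eq_zero]
      · by_cases h1 : x = v 1
        · subst h1
          simp [h01.symm, h12, CharTwo.add_self_eq_zero]
        · by_cases h2 : x = v 2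
          · subst h2
            simp only [Pi.add_apply, Pi.smul_apply, smul_eq_mul, Pi.single_eq_same,
              Pi.single_eq_of_ne h02.symm, Pi.single_eq_of_ne h12.symm, Pi.zero_apply]
            linear_combination hsum
          · simp [h0, h1, h2, hsupp x (by
              intro j
              fin_cases j
              exacts [h0, h1, h2])])
  have hcount := T.two_mul_card_dark ho R hclean
  have hp : (Finset.univ.filter (fun ε : D × Fin 3 =>
      T.bd R ε ≠ 0 ∧ R (Sum.inl ε.1) = 1)).card = 3 := by
    rw [show (Finset.univ.filter (fun ε : D × Fin 3 => T.bd R ε ≠ 0 ∧ R (Sum.inl ε.1) = 1)) =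
      Finset.univ.image (fun i : Fin 3 => (d i, i)) by
        ext ⟨e, i⟩
        simp only [Finset.mem_filter, Finset.mem_univ, true_and, Finset.mem_image, hbd',
          Prod.mk.injEq]
        constructor
        · rintro ⟨rfl, _⟩
          exact ⟨i, rfl, rfl⟩
        · rintro ⟨j, rfl, rfl⟩
          exact ⟨rfl, hRd j⟩]
    rw [Finset.card_image_of_injective _ (fun i j h => (Prod.mk.inj h).2)]
    simp
  have hq : (Finset.univ.filter (fun ε : D × Fin 3 =>
      T.bd R ε ≠ 0 ∧ R (Sum.inr (T.σ ε.2 ε.1)) = 1)).card = 0 := by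
    rw [Finset.card_eq_zero, Finset.filter_eq_empty_iff]
    rintro ε - ⟨h1, h2⟩
    exact (hside ε h1).2 h2
  have h3 := card_triangle_choices d o (Finset.univ.filter (fun ε : D × Fin 3 =>
      R (Sum.inl ε.1) = 1 ∧ ε.2 ≠ o ε.1 ∧ ¬ T.Inside R (T.dv ε.1 ε.2))) (by
    intro i j hj hjo
    simp only [Finset.mem_filter, Finset.mem_univ, true_and]
    exact ⟨hRd i, hjo, T.not_inside_of_bd ((hbd' _ _).2 rfl) hj⟩) hd
  omega

end Hypermap

/-! ### From omissions to sets of triangles -/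

namespace Hypermap

variable {D N : Type*} (T : Hypermap D N) [Fintype D] [Fintype N] [DecidableEq D] [DecidableEq N]

/-- Along a triangle the dark sides are all on the same side. -/
theorem inl_eq_one_of_bd_eq (R : D ⊕ D → ZMod 2) (d : Fin 3 → D)
    (hbd : T.bd R = ∑ i, Pi.single (d i, i) 1) (h0 : R (Sum.inl (d 0)) = 1) (i : Fin 3) :
    R (Sum.inl (d i)) = 1 := by
  have hval : ∀ e i, R (Sum.inl e) + R (Sum.inr (T.σ i e)) = if e = d i then 1 else 0 := by
    intro e i
    rw [← bd_apply, hbd, Finset.sum_apply, Finset.sum_eq_single i]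
    · simp [Pi.single_apply]
    · intro j _ hj
      simp [hj.symm]
    · simp
  -- Pair dark and light triangles by `σ i`: the difference of their numbers in `R` comes only from
  -- the side of type `i` and tells on which side its dark triangle lies. It does not depend on `i`.
  set f : ZMod 2 → ℤ := fun a => (a.val : ℤ) with hf
  have hi : ∀ i, ∑ e, f (R (Sum.inl e)) - ∑ e, f (R (Sum.inr e)) = 2 * f (R (Sum.inl (d i))) - 1 := by
    intro i
    rw [← Equiv.sum_comp (T.σ i) (fun e => f (R (Sum.inr e))), ← Finset.sum_sub_distrib,
      Finset.sum_eq_single (d i)]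
    · have := hval (d i) i
      rw [if_pos rfl] at this
      revert this
      generalize R (Sum.inl (d i)) = a, R (Sum.inr (T.σ i (d i))) = b
      revert a b; decide
    · intro e _ he
      have := hval e i
      rw [if_neg he, zmod_two_add_eq_zero] at this
      rw [this, sub_self]
    · simp
  have h1 := hi 0
  rw [hi i, h0] at h1
  have h2 : f (R (Sum.inl (d i))) = 1 := by
    have : f 1 = 1 := by decide
    omega
  revert h2
  generalize R (Sum.inl (d i)) = a
  revert a; decide

theorem fin_three_ite (j k : Fin 3) : ((if k = j + 1 then 1 else 0) +
    if k = j + 2 then 1 else 0 : ZMod 2) = if k ≠ j then 1 else 0 := by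
  revert j k; decide

/-- A choice of omitted vertices comes from a set of triangles. -/
theorem exists_region_of_isOmission (hE : Fintype.card N = Fintype.card D + 2)
    {S : Finset N} {o : D → Fin 3} (ho : T.IsOmission S o) :
    ∃ R, ∀ d i, T.bd R (d, i) = if o d = i then 1 else 0 := by
  -- The edges opposite to the omitted vertices form a cycle: a dark triangle contributes to the
  -- parity at `x` exactly when it does not omit `x`, and there are 0 or 2 such triangles.
  obtain ⟨R, hR⟩ := T.exists_bd_eq hE (y := fun ε => if o ε.1 = ε.2 then 1 else 0) (by
    ext x
    rw [cyc_apply_col]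
    have h1 : ∀ d, (if T.dv d (T.col x) = x then
        ((if o d = T.col x + 1 then 1 else 0) + if o d = T.col x + 2 then 1 else 0 : ZMod 2) else 0) =
        if d ∈ (T.darkAt x).filter (fun d => o d ≠ T.col x) then 1 else 0 := by
      intro d
      simp only [Finset.mem_filter, mem_darkAt]
      generalize T.col x = j, o d = k
      by_cases h : T.dv d j = x
      · simp only [h, if_true, true_and]
        exact fin_three_ite j k
      · simp [h]
    simp only [h1]
    rw [Finset.sum_ite_mem, Finset.univ_inter, Finset.sum_const, ho x]
    split_ifs
    · simp
    · simp
      rfl)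
  exact ⟨R, fun d i => by rw [hR]⟩

end Hypermap

/-! ### The triangulation of a plane bipartite graph -/

namespace StrongLabeling

theorem Shade.eq_black_of_ne {s : Shade} (h : s ≠ Shade.white) : s = Shade.black := by
  cases s
  · rfl
  · exact absurd rfl h

namespace PlaneDrawing

variable {V : Type*} {G : SimpleGraph V} (P : PlaneDrawing G) (c : G.Coloring Shade)

theorem ne_white_iff {s : Shade} : s ≠ Shade.white ↔ s = Shade.black :=
  ⟨Shade.eq_black_of_ne, by rintro rfl; exact fun h => nomatch h⟩

theorem snd_white_iff (d : G.Dart) : c d.snd = Shade.white ↔ ¬ c d.fst = Shade.white := by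
  have := c.valid d.adj
  revert this
  generalize c d.fst = a, c d.snd = b
  cases a <;> cases b <;> simp

theorem snd_eq_black {d : G.Dart} (h : c d.fst = Shade.white) : c d.snd = Shade.black :=
  Shade.eq_black_of_ne fun h' => (snd_white_iff c d).1 h' h

theorem snd_eq_white {d : G.Dart} (h : c d.fst = Shade.black) : c d.snd = Shade.white :=
  (snd_white_iff c d).2 (ne_white_iff.2 h)

/-- The next dart on the face to the left. -/
def next : Equiv.Perm G.Dart :=
  (Equiv.mk SimpleGraph.Dart.symm SimpleGraph.Dart.symm SimpleGraph.Dart.symm_symm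
    SimpleGraph.Dart.symm_symm).trans P.rot.symm

theorem next_apply (d : G.Dart) : P.next d = P.rot.symm d.symm := rfl

theorem next_symm_apply (d : G.Dart) : P.next.symm d = (P.rot d).symm := rfl

theorem rot_symm_fst (d : G.Dart) : (P.rot.symm d).fst = d.fst := by
  rw [← P.rot_fst (P.rot.symm d), Equiv.apply_symm_apply]

theorem next_fst (d : G.Dart) : (P.next d).fst = d.snd := by
  rw [next_apply, rot_symm_fst]; rfl

theorem next_symm_snd (d : G.Dart) : (P.next.symm d).snd = d.fst := by
  rw [next_symm_apply]; exact P.rot_fst d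

theorem leftFace_next (d : G.Dart) : P.leftFace (P.next d) = P.leftFace d :=
  (Quotient.sound (P.sameFace_walk d)).symm

theorem leftFace_next_symm (d : G.Dart) : P.leftFace (P.next.symm d) = P.leftFace d := by
  rw [← P.leftFace_next, Equiv.apply_symm_apply]

theorem leftFace_rot_symm (d : G.Dart) : P.leftFace (P.rot.symm d) = P.leftFace d.symm := by
  rw [← P.leftFace_next d.symm, next_apply, SimpleGraph.Dart.symm_symm]

variable [Finite V]

instance : Finite G.Dart := Finite.of_injective _ SimpleGraph.Dart.toProd_injective

theorem sameCycle_invariant {α β : Type*} [Finite α] {π : Equiv.Perm α} {g : α → β} {p : α → Prop}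
    (hp : ∀ a, p a → p (π a)) (hg : ∀ a, p a → g (π a) = g a) {a b : α} (h : π.SameCycle a b)
    (ha : p a) : g b = g a := by
  obtain ⟨n, rfl⟩ := h.exists_nat_pow_eq
  have : p ((π ^ n) a) ∧ g ((π ^ n) a) = g a := by
    induction n with
    | zero => exact ⟨ha, rfl⟩
    | succ n ih =>
      have ih := ih ⟨n, by simp⟩
      rw [pow_succ', Equiv.Perm.mul_apply]
      exact ⟨hp _ ih.1, (hg _ ih.1).trans ih.2⟩
  exact this.2

theorem eq_of_rot_invariant {β : Type*} {g : G.Dart → β} {v : V}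
    (hg : ∀ d : G.Dart, d.fst = v → g (P.rot d) = g d) {d e : G.Dart} (hd : d.fst = v)
    (he : e.fst = v) : g d = g e :=
  sameCycle_invariant (p := fun d => d.fst = v) (fun a ha => (P.rot_fst a).trans ha) hg
    (P.rot_sameCycle e d (he.trans hd.symm)) he

theorem eq_of_connected {β : Type*} (hG : G.Connected) {g : G.Dart → β}
    (hsymm : ∀ d, g d.symm = g d) (hrot : ∀ d, g (P.rot d) = g d) (d e : G.Dart) : g d = g e := by
  have h : ∀ u v : V, G.Reachable u v → ∀ d e : G.Dart, d.fst = u → e.fst = v → g d = g e := by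
    rintro u v ⟨w⟩
    induction w with
    | nil => exact fun d e hd he => P.eq_of_rot_invariant (fun d _ => hrot d) hd he
    | @cons u v w huv _ ih =>
      intro d e hd he
      let x : G.Dart := ⟨(u, v), huv⟩
      rw [P.eq_of_rot_invariant (fun d _ => hrot d) hd (show x.fst = u from rfl), ← hsymm]
      exact ih x.symm e rfl he
  exact h _ _ (hG.preconnected _ _) d e rfl rfl

/-- The darts with a white tail. -/
abbrev WhiteDart : Type _ := {d : G.Dart // c d.fst = Shade.white}

/-- The two triangles at an edge. -/
def tri : WhiteDart c ⊕ WhiteDart c → G.Dart := Sum.elim (fun d => d.1.symm) (fun d => d.1)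

theorem tri_bijective : Function.Bijective (tri c) := by
  constructor
  · rintro (⟨d, hd⟩ | ⟨d, hd⟩) (⟨e, he⟩ | ⟨e, he⟩) h <;> simp only [tri, Sum.elim_inl,
      Sum.elim_inr] at h
    · rw [SimpleGraph.Dart.symm_involutive.injective.eq_iff] at h
      subst h; rfl
    · subst h
      exact absurd hd ((snd_white_iff c d).1 he)
    · subst h
      exact absurd he ((snd_white_iff c e).1 hd)
    · subst h; rfl
  · intro d
    by_cases h : c d.fst = Shade.white
    · exact ⟨Sum.inr ⟨d, h⟩, rfl⟩
    · exact ⟨Sum.inl ⟨d.symm, (snd_white_iff c d).2 h⟩, d.symm_symm⟩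

/-- The triangles and the darts. -/
noncomputable def triEquiv : WhiteDart c ⊕ WhiteDart c ≃ G.Dart :=
  Equiv.ofBijective _ (tri_bijective c)

/-- The hypermap of a connected drawing, with the vertices and the faces of the drawing as its
vertices. -/
def hypermap (hG : G.Connected) {F : Type*} (lf : G.Dart → F)
    (hlf : ∀ d, lf (P.next d) = lf d) (hsurj : Function.Surjective lf)
    (hiso : ∀ v, ∃ d : G.Dart, d.fst = v) [DecidablePred fun v => c v = Shade.white] :
    Hypermap (WhiteDart c) (V ⊕ F) where
  -- Opposite to the face is the edge of `G` itself, so `σ 0` keeps the index. Opposite to the white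
  -- end one crosses the angle at the black end, and opposite to the black end the angle at the
  -- white end.
  σ := ![Equiv.refl _,
    { toFun := fun d => ⟨(P.rot d.1.symm).symm, by
        rw [show ((P.rot d.1.symm).symm).fst = (P.rot d.1.symm).snd from rfl, snd_white_iff,
          P.rot_fst, show d.1.symm.fst = d.1.snd from rfl, snd_white_iff, not_not]
        exact d.2⟩
      invFun := fun d => ⟨(P.rot.symm d.1.symm).symm, by
        rw [show ((P.rot.symm d.1.symm).symm).fst = (P.rot.symm d.1.symm).snd from rfl,
          snd_white_iff, P.rot_symm_fst, show d.1.symm.fst = d.1.snd from rfl, snd_white_iff, not_not]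
        exact d.2⟩
      left_inv := fun d => by simp
      right_inv := fun d => by simp },
    { toFun := fun d => ⟨P.rot.symm d.1, by rw [P.rot_symm_fst]; exact d.2⟩
      invFun := fun d => ⟨P.rot d.1, by rw [P.rot_fst]; exact d.2⟩
      left_inv := fun d => by simp
      right_inv := fun d => by simp }]
  dv d := ![Sum.inr (lf d.1.symm), Sum.inl d.1.fst, Sum.inl d.1.snd]
  lv d := ![Sum.inr (lf d.1), Sum.inl d.1.fst, Sum.inl d.1.snd]
  col := Sum.elim (fun v => if c v = Shade.white then 1 else 2) (fun _ => 0)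
  col_dv := by
    intro d i
    have h := (snd_white_iff c d.1).not_left.2 d.2
    fin_cases i
    · rfl
    · simp [d.2]
    · simp [h]
  compat := by
    have hlf' : ∀ d : G.Dart, lf (P.rot d).symm = lf d := fun d => by
      rw [← P.next_symm_apply, ← hlf, Equiv.apply_symm_apply]
    have hlf'' : ∀ d : G.Dart, lf (P.rot.symm d) = lf d.symm := fun d => by
      rw [← hlf d.symm, P.next_apply, SimpleGraph.Dart.symm_symm]
    intro d i j hij
    fin_cases i <;> fin_cases j <;> simp at hij ⊢
    · rw [hlf']
    · rw [P.rot_fst]; rfl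
    · rw [hlf'']
    · rw [P.rot_symm_fst]
  surj := by
    rintro (v | f)
    · obtain ⟨d, rfl⟩ := hiso v
      by_cases h : c d.fst = Shade.white
      · exact ⟨⟨d, h⟩, by simp [h]⟩
      · exact ⟨⟨d.symm, (snd_white_iff c d).2 h⟩, by simp [h]⟩
    · obtain ⟨d, rfl⟩ := hsurj f
      by_cases h : c d.fst = Shade.white
      · refine ⟨⟨P.rot d, by rw [P.rot_fst]; exact h⟩, ?_⟩
        simp only [Sum.elim_inr, Matrix.cons_val_zero]
        rw [← P.next_symm_apply, ← hlf, Equiv.apply_symm_apply]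
      · exact ⟨⟨d.symm, (snd_white_iff c d).2 h⟩, by simp⟩
  conn := by
    intro R hR
    have key : ∀ d : WhiteDart c, R (Sum.inl d) = R (Sum.inr d) ∧
        (∀ h, R (Sum.inl d) = R (Sum.inr ⟨(P.rot d.1.symm).symm, h⟩)) ∧
        (∀ h, R (Sum.inl d) = R (Sum.inr ⟨P.rot.symm d.1, h⟩)) := fun d =>
      ⟨hR d 0, fun _ => hR d 1, fun _ => hR d 2⟩
    set R' : G.Dart → ZMod 2 := fun d => R ((triEquiv c).symm d) with hR'
    have hw : ∀ d (h : c d.fst = Shade.white), R' d = R (Sum.inr ⟨d, h⟩) := by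
      intro d h
      simp only [hR']
      congr 1
      rw [Equiv.symm_apply_eq]
      rfl
    have hb : ∀ d (h : c d.fst = Shade.white), R' d.symm = R (Sum.inl ⟨d, h⟩) := by
      intro d h
      simp only [hR']
      congr 1
      rw [Equiv.symm_apply_eq]
      rfl
    have hsymm : ∀ d, R' d.symm = R' d := by
      intro d
      by_cases h : c d.fst = Shade.white
      · rw [hw d h, hb d h, (key _).1]
      · have h' : c d.symm.fst = Shade.white := (snd_white_iff c d).2 h
        rw [hw d.symm h', ← (key _).1, ← hb, SimpleGraph.Dart.symm_symm]
    have hrot : ∀ d, R' (P.rot d) = R' d := by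
      intro d
      by_cases h : c d.fst = Shade.white
      · have h1 : c (P.rot d).fst = Shade.white := by rw [P.rot_fst]; exact h
        rw [hw d h, ← hsymm, hb _ h1, (key _).2.2 (by rw [P.rot_symm_fst]; exact h1)]
        congr 3
        exact P.rot.symm_apply_apply d
      · have h' : c d.symm.fst = Shade.white := (snd_white_iff c d).2 h
        have h1 : c (P.rot d).symm.fst = Shade.white :=
          (snd_white_iff c (P.rot d)).2 (by rwa [P.rot_fst])
        have h2 := (key ⟨d.symm, h'⟩).2.1 (by simpa using h1)
        rw [← hb] at h2
        rw [← hsymm, hw _ h1, show R' d = R' d.symm.symm by rw [SimpleGraph.Dart.symm_symm], h2]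
        congr 3
    intro a b
    have h1 : ∀ a, R a = R' (tri c a) := by
      intro a
      simp only [hR']
      congr 1
      rw [Equiv.eq_symm_apply]
      rfl
    rw [h1, h1]
    exact P.eq_of_connected hG hsymm hrot _ _

end PlaneDrawing

end StrongLabeling

/-! ### Faces as orbits, and the stellation of a connected drawing -/

namespace StrongLabeling

namespace PlaneDrawing

variable {V : Type*} {G : SimpleGraph V} (P : PlaneDrawing G) (c : G.Coloring Shade) [Finite V]

theorem exists_dart [Nontrivial V] (hG : G.Connected) (v : V) : ∃ d : G.Dart, d.fst = v := by
  obtain ⟨w, hw⟩ := hG.preconnected.exists_adj_of_nontrivial v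
  exact ⟨⟨(v, w), hw⟩, rfl⟩

theorem leftFace_surjective [Nontrivial V] (hG : G.Connected) :
    Function.Surjective P.leftFace := by
  intro f
  induction f using Quotient.inductionOn with
  | h a =>
    rcases a with d | ⟨v, hv⟩
    · exact ⟨d, rfl⟩
    · obtain ⟨w, hw⟩ := hG.preconnected.exists_adj_of_nontrivial v
      exact absurd hw (hv w)

theorem card_whiteDart : Nat.card (WhiteDart c) = Nat.card G.edgeSet := by
  refine Nat.card_congr (Equiv.ofBijective (fun d => ⟨d.1.edge, d.1.edge_mem⟩) ⟨?_, ?_⟩)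
  · rintro ⟨d, hd⟩ ⟨e, he⟩ h
    simp only [Subtype.mk.injEq, SimpleGraph.dart_edge_eq_iff] at h
    rcases h with rfl | rfl
    · rfl
    · exact absurd he ((snd_white_iff c e).1 hd)
  · rintro ⟨e, he⟩
    induction e using Sym2.ind with
    | _ u v =>
      by_cases h : c u = Shade.white
      · exact ⟨⟨⟨(u, v), he⟩, h⟩, rfl⟩
      · refine ⟨⟨⟨(v, u), he.symm⟩, (snd_white_iff c ⟨(u, v), he⟩).2 h⟩, ?_⟩
        exact Subtype.ext Sym2.eq_swap

theorem euler_connected (hG : G.Connected) :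
    Nat.card V + Nat.card P.Face = Nat.card (WhiteDart c) + 2 := by
  have h1 : Nat.card G.ConnectedComponent = 1 := by
    rw [Nat.card_eq_one_iff_unique]
    obtain ⟨v⟩ := hG.nonempty
    exact ⟨hG.preconnected.subsingleton_connectedComponent, ⟨G.connectedComponentMk v⟩⟩
  have : Nat.card V + Nat.card P.Face = _ := P.euler
  rw [card_whiteDart]
  omega

/-- In a connected drawing, the faces are the orbits of `next`. -/
theorem sameCycle_next (c : G.Coloring Shade) [Nontrivial V] (hG : G.Connected) {d e : G.Dart}
    (h : P.leftFace d = P.leftFace e) : P.next.SameCycle d e := by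
  classical
  -- The orbits of `next` also give a hypermap, so `Hypermap.card_le` bounds their number by that of
  -- the faces given by Euler's formula. Hence the surjection from orbits to faces is bijective.
  let F := Quotient (Equiv.Perm.SameCycle.setoid P.next)
  let T := P.hypermap c hG (F := F) (fun d => Quotient.mk _ d)
    (fun d => Quotient.sound (Equiv.Perm.sameCycle_apply_left.2 (Equiv.Perm.SameCycle.refl _ _)))
    Quotient.mk_surjective (exists_dart hG)
  have := Fintype.ofFinite (WhiteDart c)
  have := Fintype.ofFinite V
  have := Fintype.ofFinite F
  have h1 := T.card_le
  rw [Fintype.card_sum, ← Nat.card_eq_fintype_card, ← Nat.card_eq_fintype_card,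
    ← Nat.card_eq_fintype_card] at h1
  have h2 := P.euler_connected c hG
  let g : F → P.Face := Quotient.lift P.leftFace (by
    intro a b hab
    exact (sameCycle_invariant (p := fun _ => True) (fun _ _ => trivial)
      (fun a _ => P.leftFace_next a) hab trivial).symm)
  have hg : Function.Surjective g := by
    intro f
    obtain ⟨d, rfl⟩ := P.leftFace_surjective hG f
    exact ⟨Quotient.mk _ d, rfl⟩
  have hgb := (Nat.bijective_iff_surjective_and_card g).2
    ⟨hg, le_antisymm (by omega) (Nat.card_le_card_of_surjective g hg)⟩
  exact Quotient.exact (hgb.1 (a₁ := Quotient.mk _ d) (a₂ := Quotient.mk _ e) h)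

theorem eq_of_next_invariant (c : G.Coloring Shade) [Nontrivial V] (hG : G.Connected) {β : Type*} {g : G.Dart → β}
    {f : P.Face} (hg : ∀ d : G.Dart, P.leftFace d = f → g (P.next d) = g d) {d e : G.Dart}
    (hd : P.leftFace d = f) (he : P.leftFace e = f) : g d = g e :=
  sameCycle_invariant (p := fun d => P.leftFace d = f) (fun a ha => (P.leftFace_next a).trans ha) hg
    (P.sameCycle_next c hG (he.trans hd.symm)) he

noncomputable instance : Fintype (WhiteDart c) := Fintype.ofFinite _

noncomputable instance : Fintype (V ⊕ P.Face) := Fintype.ofFinite _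

open scoped Classical in
/-- The hypermap of the vertices and faces of a connected drawing. -/
noncomputable def stellation [Nontrivial V] (hG : G.Connected) :
    Hypermap (WhiteDart c) (V ⊕ P.Face) :=
  P.hypermap c hG P.leftFace P.leftFace_next (P.leftFace_surjective hG) (exists_dart hG)

section Stellation

variable [Nontrivial V] (hG : G.Connected)

theorem stellation_card (hG : G.Connected) :
    Fintype.card (V ⊕ P.Face) = Fintype.card (WhiteDart c) + 2 := by
  have := P.euler_connected c hG
  rwa [← Nat.card_eq_fintype_card, ← Nat.card_eq_fintype_card, Nat.card_sum]

theorem bd_tri_zero (R : G.Dart → ZMod 2) (d : WhiteDart c) :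
    (P.stellation c hG).bd (R ∘ tri c) (d, 0) = R d.1 + R d.1.symm := add_comm _ _

theorem bd_tri_one (R : G.Dart → ZMod 2) (d : WhiteDart c) :
    (P.stellation c hG).bd (R ∘ tri c) (d, 1) = R d.1.symm + R (P.next.symm d.1.symm) := rfl

theorem bd_tri_two (R : G.Dart → ZMod 2) (d : WhiteDart c) :
    (P.stellation c hG).bd (R ∘ tri c) (d, 2) =
      R (P.rot.symm d.1) + R (P.next.symm (P.rot.symm d.1)) := by
  rw [next_symm_apply, Equiv.apply_symm_apply]
  exact add_comm _ _

theorem eq_comp_tri (R : WhiteDart c ⊕ WhiteDart c → ZMod 2) :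
    R = (R ∘ (triEquiv c).symm) ∘ tri c := by
  ext a
  exact congrArg R ((triEquiv c).symm_apply_apply a).symm

theorem edge_eq_of_white {f g : G.Dart → ZMod 2} (hf : ∀ d, f d.symm = f d)
    (hg : ∀ d, g d.symm = g d) (h : ∀ d : WhiteDart c, f d.1 = g d.1) (d : G.Dart) :
    f d = g d := by
  by_cases hd : c d.fst = Shade.white
  · exact h ⟨d, hd⟩
  · rw [← hf, ← hg]
    exact h ⟨d.symm, (snd_white_iff c d).2 hd⟩

theorem angle_eq_of_white {f g : G.Dart → ZMod 2}
    (h1 : ∀ d : WhiteDart c, f d.1.symm = g d.1.symm)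
    (h2 : ∀ d : WhiteDart c, f (P.rot.symm d.1) = g (P.rot.symm d.1)) (d : G.Dart) :
    f d = g d := by
  by_cases hd : c d.fst = Shade.white
  · have := h2 ⟨P.rot d, by rw [P.rot_fst]; exact hd⟩
    rwa [Equiv.symm_apply_apply] at this
  · have := h1 ⟨d.symm, (snd_white_iff c d).2 hd⟩
    rwa [SimpleGraph.Dart.symm_symm] at this

theorem stellation_tv (a : WhiteDart c ⊕ WhiteDart c) : (P.stellation c hG).tv a 0 =
    Sum.inr (P.leftFace (tri c a)) := by
  rcases a with d | d <;> rfl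

theorem stellation_tv_vertex (a : WhiteDart c ⊕ WhiteDart c) (s : V) :
    (∃ i, (P.stellation c hG).tv a i = Sum.inl s) ↔ (tri c a).fst = s ∨ (tri c a).snd = s := by
  have hd : ∀ (d : WhiteDart c) (f : P.Face),
      (∃ i, (![Sum.inr f, Sum.inl d.1.fst, Sum.inl d.1.snd] : Fin 3 → V ⊕ P.Face) i = Sum.inl s) ↔
      d.1.fst = s ∨ d.1.snd = s := by
    intro d f
    constructor
    · rintro ⟨i, hi⟩
      fin_cases i
      · exact absurd hi (by rintro ⟨⟩)
      · exact Or.inl (Sum.inl.inj hi)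
      · exact Or.inr (Sum.inl.inj hi)
    · rintro (h | h)
      · exact ⟨1, congrArg Sum.inl h⟩
      · exact ⟨2, congrArg Sum.inl h⟩
  rcases a with d | d
  · exact (hd d _).trans or_comm
  · exact hd d _

theorem inside_iff (R : G.Dart → ZMod 2) (s : V) :
    (P.stellation c hG).Inside (R ∘ tri c) (Sum.inl s) ↔
      ∀ d : G.Dart, d.fst = s ∨ d.snd = s → R d = 1 := by
  constructor
  · intro h d hd
    obtain ⟨a, rfl⟩ := (tri_bijective c).2 d
    obtain ⟨i, hi⟩ := (P.stellation_tv_vertex c hG a s).2 hd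
    exact h a i hi
  · intro h a i hi
    exact h _ ((P.stellation_tv_vertex c hG a s).1 ⟨i, hi⟩)

/-- The triangles around a vertex are linked by one orbit of `rot`, those around a face by one orbit
of `next`. -/
theorem stellation_star : (P.stellation c hG).Star := by
  intro x R hR a b ha hb
  have hR' := eq_comp_tri c R
  set R' := R ∘ (triEquiv c).symm
  rw [hR'] at hR ⊢
  simp only [Function.comp_apply]
  have hcolw : ∀ {v : V}, c v = Shade.white → (P.stellation c hG).col (Sum.inl v) = 1 :=
    fun h => if_pos h
  have hcolb : ∀ {v : V}, c v ≠ Shade.white → (P.stellation c hG).col (Sum.inl v) = 2 :=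
    fun h => if_neg h
  rcases x with v | f
  · have hedge : ∀ d : G.Dart, d.fst = v → R' d.symm = R' d := by
      rintro d rfl
      by_cases h : c d.fst = Shade.white
      · have := hR ⟨d, h⟩ (by rw [hcolw h]; rfl) 0 (by rw [hcolw h]; decide)
        rw [bd_tri_zero, Hypermap.zmod_two_add_eq_zero] at this
        exact this.symm
      · have := hR ⟨d.symm, (snd_white_iff c d).2 h⟩ (by rw [hcolb h]; rfl) 0
          (by rw [hcolb h]; decide)
        rw [bd_tri_zero, Hypermap.zmod_two_add_eq_zero] at this
        simpa using this
    have hangle : ∀ d : G.Dart, d.fst = v → R' (P.next.symm d) = R' d := by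
      rintro d rfl
      by_cases h : c d.fst = Shade.white
      · have h1 : c (P.rot d).fst = Shade.white := by rw [P.rot_fst]; exact h
        have := hR ⟨P.rot d, h1⟩ (by rw [hcolw h]; exact congrArg Sum.inl (P.rot_fst d)) 2
          (by rw [hcolw h]; decide)
        rw [bd_tri_two, Hypermap.zmod_two_add_eq_zero, Equiv.symm_apply_apply] at this
        exact this.symm
      · have := hR ⟨d.symm, (snd_white_iff c d).2 h⟩ (by rw [hcolb h]; rfl) 1
          (by rw [hcolb h]; decide)
        rw [bd_tri_one, Hypermap.zmod_two_add_eq_zero, SimpleGraph.Dart.symm_symm] at this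
        exact this.symm
    have hrot : ∀ d : G.Dart, d.fst = v → R' (P.rot d) = R' d := by
      intro d hd
      rw [← hangle d hd, next_symm_apply, hedge _ ((P.rot_fst d).trans hd)]
    have key : ∀ d : G.Dart, d.fst = v ∨ d.snd = v → ∃ e : G.Dart, e.fst = v ∧ R' d = R' e := by
      rintro d (h | h)
      · exact ⟨d, h, rfl⟩
      · refine ⟨d.symm, h, ?_⟩
        rw [← hedge d.symm h, SimpleGraph.Dart.symm_symm]
    obtain ⟨d, hd, hd'⟩ := key (tri c a) ((P.stellation_tv_vertex c hG a v).1 ⟨_, ha⟩)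
    obtain ⟨e, he, he'⟩ := key (tri c b) ((P.stellation_tv_vertex c hG b v).1 ⟨_, hb⟩)
    rw [hd', he']
    exact P.eq_of_rot_invariant hrot hd he
  · have hangle : ∀ d : G.Dart, P.leftFace d = f → R' (P.next d) = R' d := by
      intro d hd
      have key : R' (P.next d) + R' (P.next.symm (P.next d)) = 0 := by
        have hd' : P.leftFace (P.next d) = f := (P.leftFace_next d).trans hd
        generalize P.next d = e at hd'
        by_cases h : c e.fst = Shade.white
        · have h1 : c (P.rot e).fst = Shade.white := by rw [P.rot_fst]; exact h
          have := hR ⟨P.rot e, h1⟩ (by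
            refine congrArg Sum.inr ?_
            rw [← hd', ← P.leftFace_next_symm e]
            rfl) 2 (show (2 : Fin 3) ≠ 0 by decide)
          rwa [bd_tri_two, Equiv.symm_apply_apply] at this
        · have := hR ⟨e.symm, (snd_white_iff c e).2 h⟩ (by
            refine congrArg Sum.inr ?_
            rw [← hd']
            simp) 1 (show (1 : Fin 3) ≠ 0 by decide)
          rwa [bd_tri_one, SimpleGraph.Dart.symm_symm] at this
      rwa [Hypermap.zmod_two_add_eq_zero, Equiv.symm_apply_apply] at key
    have ha' := (P.stellation_tv c hG a).symm.trans ha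
    have hb' := (P.stellation_tv c hG b).symm.trans hb
    exact P.eq_of_next_invariant c hG hangle (Sum.inr.inj ha') (Sum.inr.inj hb')

end Stellation

end PlaneDrawing

end StrongLabeling

/-! ### Regions and the two rules in terms of darts -/

namespace StrongLabeling

namespace PlaneDrawing

variable {V : Type*} {G : SimpleGraph V} (P : PlaneDrawing G) (c : G.Coloring Shade) [Finite V]

noncomputable instance : Fintype G.Dart := Fintype.ofFinite _

open scoped Classical in
theorem sum_dart {M : Type*} [AddCommMonoid M] (f : G.Dart → M) :
    ∑ d, f d = ∑ d : WhiteDart c, f d.1.symm + ∑ d : WhiteDart c, f d.1 := by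
  rw [← Fintype.sum_equiv (triEquiv c) (fun a => f (tri c a)) f (fun _ => rfl),
    Fintype.sum_sum_type]
  rfl

-- A boundary has even degree at `v`. The terms `R d` cancel, and `rot` permutes the remaining ones.
open scoped Classical in
theorem vertex_parity (R : G.Dart → ZMod 2) (v : V) :
    ∑ d : G.Dart, (if d.fst = v then (R d + R d.symm) + (R d + R (P.next.symm d)) else 0) = 0 := by
  have h1 : ∀ d : G.Dart, (if d.fst = v then (R d + R d.symm) + (R d + R (P.next.symm d)) else 0) =
      (if d.fst = v then R d.symm else 0) + (if d.fst = v then R (P.rot d).symm else 0) := by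
    intro d
    split_ifs
    · have := CharTwo.add_self_eq_zero (R d)
      rw [next_symm_apply]
      linear_combination this
    · simp
  have h2 : ∑ d : G.Dart, (if d.fst = v then R (P.rot d).symm else 0) =
      ∑ d : G.Dart, (if d.fst = v then R d.symm else 0) := by
    rw [← Equiv.sum_comp P.rot (fun d => if d.fst = v then R d.symm else 0)]
    simp only [P.rot_fst]
  simp only [h1, Finset.sum_add_distrib]
  rw [h2, CharTwo.add_self_eq_zero]

open scoped Classical in
theorem face_parity (R : G.Dart → ZMod 2) (f : P.Face) :
    ∑ d : G.Dart, (if P.leftFace d = f then R d + R (P.next.symm d) else 0) = 0 := by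
  have h1 : ∀ d : G.Dart, (if P.leftFace d = f then R d + R (P.next.symm d) else 0) =
      (if P.leftFace d = f then R d else 0) +
      (if P.leftFace d = f then R (P.next.symm d) else 0) := by
    intro d
    split_ifs <;> simp
  have h2 : ∑ d : G.Dart, (if P.leftFace d = f then R (P.next.symm d) else 0) =
      ∑ d : G.Dart, (if P.leftFace d = f then R d else 0) := by
    rw [← Equiv.sum_comp P.next.symm (fun d => if P.leftFace d = f then R d else 0)]
    simp only [P.leftFace_next_symm]
  simp only [h1, Finset.sum_add_distrib]
  rw [h2, CharTwo.add_self_eq_zero]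

theorem region_ext (c : G.Coloring Shade) [Nontrivial V] (hG : G.Connected) {R S : G.Dart → ZMod 2}
    (h1 : ∀ d, R d + R d.symm = S d + S d.symm)
    (h2 : ∀ d, R d + R (P.next.symm d) = S d + S (P.next.symm d)) {a : G.Dart} (ha : R a = S a) :
    R = S := by
  have h := (P.stellation c hG).eq_of_bd_eq (R := R ∘ tri c) (S := S ∘ tri c)
    (a := (triEquiv c).symm a) (by
      ext ⟨d, i⟩
      fin_cases i
      · exact (P.bd_tri_zero c hG R d).trans ((h1 d.1).trans (P.bd_tri_zero c hG S d).symm)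
      · exact (P.bd_tri_one c hG R d).trans ((h2 _).trans (P.bd_tri_one c hG S d).symm)
      · exact (P.bd_tri_two c hG R d).trans ((h2 _).trans (P.bd_tri_two c hG S d).symm)) (by
      change R ((triEquiv c) ((triEquiv c).symm a)) = S ((triEquiv c) ((triEquiv c).symm a))
      rw [Equiv.apply_symm_apply, ha])
  ext d
  obtain ⟨b, rfl⟩ := (tri_bijective c).2 d
  exact congrFun h b

open scoped Classical in
/-- Each cycle is the boundary of a set of triangles. -/
theorem exists_region (c : G.Coloring Shade) [Nontrivial V] (hG : G.Connected)
    (ye ya : G.Dart → ZMod 2) (hs : ∀ d, ye d.symm = ye d)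
    (hv : ∀ v, ∑ d : G.Dart, (if d.fst = v then ye d + ya d else 0) = 0)
    (hf : ∀ f, ∑ d : G.Dart, (if P.leftFace d = f then ya d else 0) = 0) :
    ∃ R : G.Dart → ZMod 2, (∀ d, R d + R d.symm = ye d) ∧
      ∀ d, R d + R (P.next.symm d) = ya d := by
  set T := P.stellation c hG with hT
  obtain ⟨R, hR⟩ := T.exists_bd_eq (P.stellation_card c hG)
    (y := fun ε => (![ye ε.1.1, ya ε.1.1.symm, ya (P.rot.symm ε.1.1)] : Fin 3 → ZMod 2) ε.2) (by
    have hσ : ∀ g : G.Dart → ZMod 2, ∑ d : WhiteDart c, g (P.rot.symm d.1) =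
        ∑ d : WhiteDart c, g d.1 := fun g => Equiv.sum_comp (T.σ 2) (fun d => g d.1)
    ext x
    rw [Hypermap.cyc_apply_col, Pi.zero_apply]
    rcases x with v | f
    · refine Eq.trans ?_ (hv v)
      rw [sum_dart c]
      by_cases h : c v = Shade.white
      · have hcol : T.col (Sum.inl v) = 1 := if_pos h
        rw [hcol]
        have h1 : ∑ d : WhiteDart c, (if d.1.symm.fst = v then ye d.1.symm + ya d.1.symm else 0) =
            0 := by
          refine Finset.sum_eq_zero fun d _ => if_neg ?_
          rintro rfl
          exact (snd_white_iff c d.1).1 h d.2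
        have h2 := hσ (fun d => if d.fst = v then ya d else 0)
        simp only [P.rot_symm_fst] at h2
        have h3 : ∀ d : WhiteDart c, (if d.1.fst = v then ye d.1 + ya d.1 else 0) =
            (if d.1.fst = v then ye d.1 else 0) + (if d.1.fst = v then ya d.1 else 0) := by
          intro d; split_ifs <;> simp
        simp only [h1, zero_add, h3, Finset.sum_add_distrib]
        rw [← h2, ← Finset.sum_add_distrib]
        refine Finset.sum_congr rfl fun d _ => ?_
        have h4 : T.dv d 1 = Sum.inl v ↔ d.1.fst = v :=
          ⟨fun h => Sum.inl.inj h, fun h => congrArg Sum.inl h⟩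
        simp only [h4]
        split_ifs
        · exact add_comm _ _
        · simp
      · have hcol : T.col (Sum.inl v) = 2 := if_neg h
        rw [hcol]
        have h1 : ∑ d : WhiteDart c, (if d.1.fst = v then ye d.1 + ya d.1 else 0) = 0 := by
          refine Finset.sum_eq_zero fun d _ => if_neg ?_
          rintro rfl
          exact h d.2
        rw [h1, add_zero]
        refine Finset.sum_congr rfl fun d _ => ?_
        have h4 : T.dv d 2 = Sum.inl v ↔ d.1.symm.fst = v :=
          ⟨fun h => Sum.inl.inj h, fun h => congrArg Sum.inl h⟩
        simp only [h4, hs]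
        rfl
    · refine Eq.trans ?_ (hf f)
      rw [sum_dart c]
      have hcol : T.col (Sum.inr f) = 0 := rfl
      rw [hcol]
      have h2 := hσ (fun d => if P.leftFace d = f then ya d else 0)
      simp only [P.leftFace_rot_symm] at h2
      rw [← h2, ← Finset.sum_add_distrib]
      refine Finset.sum_congr rfl fun d _ => ?_
      have h4 : T.dv d 0 = Sum.inr f ↔ P.leftFace d.1.symm = f :=
        ⟨fun h => Sum.inr.inj h, fun h => congrArg Sum.inr h⟩
      simp only [h4]
      split_ifs
      · rfl
      · simp)
  rw [eq_comp_tri c R] at hR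
  refine ⟨R ∘ (triEquiv c).symm, ?_, ?_⟩
  · refine edge_eq_of_white c (fun d => ?_) hs fun d => ?_
    · rw [SimpleGraph.Dart.symm_symm]; exact add_comm _ _
    · rw [← P.bd_tri_zero c hG, ← hT, hR]
      rfl
  · refine P.angle_eq_of_white c (fun d => ?_) fun d => ?_
    · rw [← P.bd_tri_one c hG, ← hT, hR]
      rfl
    · rw [← P.bd_tri_two c hG, ← hT, hR]
      rfl

section Rules

variable (s₀ s₁ : V)

/-- All triangles at `s` belong to `R`. -/
def Within (R : G.Dart → ZMod 2) (s : V) : Prop := ∀ d : G.Dart, d.fst = s ∨ d.snd = s → R d = 1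

open scoped Classical in
/-- If a vertex appears twice on a face, there are special vertices on both sides. -/
def DigonRule : Prop :=
  ∀ (R : G.Dart → ZMod 2) (x y : G.Dart), x ≠ y → (∀ d, R d.symm = R d) →
    (∀ d, R d + R (P.next.symm d) = (if d = x then 1 else 0) + (if d = y then 1 else 0)) →
    Within R s₀ ∨ Within R s₁

open scoped Classical in
/-- The triangles formed by an edge `e` and the angles `x` and `y` in a face at its ends have a
special vertex inside if the right side of `e` is in the interior. -/
def TriangleRule : Prop :=
  ∀ (R : G.Dart → ZMod 2) (e x y : G.Dart), c e.fst = Shade.white → c x.fst = Shade.white →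
    c y.fst = Shade.black → (∀ d, R d + R d.symm = if d = e ∨ d = e.symm then 1 else 0) →
    (∀ d, R d + R (P.next.symm d) = (if d = x then 1 else 0) + (if d = y then 1 else 0)) →
    R e.symm = 1 → ¬ (P.next.symm x = e.symm ∧ y = e.symm) →
    Within R s₀ ∨ Within R s₁

variable [Nontrivial V] (hG : G.Connected)

open scoped Classical in
/-- The special vertices. -/
noncomputable def special : Finset (V ⊕ P.Face) := {Sum.inl s₀, Sum.inl s₁}

theorem exists_inside_iff (R : G.Dart → ZMod 2) :
    (∃ s ∈ P.special s₀ s₁, (P.stellation c hG).Inside (R ∘ tri c) s) ↔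
      Within R s₀ ∨ Within R s₁ := by
  simp only [special, Finset.mem_insert, Finset.mem_singleton, exists_eq_or_imp, exists_eq_left,
    inside_iff]
  rfl

-- Only angles occur as sides in the digon rule for drawings: with `R` symmetric, no edge of `G` is
-- on the boundary.
open scoped Classical in
theorem digonRule_of_stellation (h : (P.stellation c hG).DigonRule (P.special s₀ s₁)) :
    P.DigonRule s₀ s₁ := by
  intro R x y hxy hs ha
  rw [← P.exists_inside_iff c s₀ s₁ hG]
  have hedge : ∀ d, R d + R d.symm = 0 := fun d => by rw [hs]; exact CharTwo.add_self_eq_zero _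
  -- The angle of `x` is the side of type 2 of a dark triangle if its vertex is white, and of type 1
  -- if it is black.
  have hex : ∀ x : G.Dart, ∃ ε : WhiteDart c × Fin 3, (∀ d, (d, 0) ≠ ε) ∧
      (∀ d, (d, 1) = ε ↔ d.1.symm = x) ∧ (∀ d, (d, 2) = ε ↔ P.rot.symm d.1 = x) := by
    intro x
    by_cases hx : c x.fst = Shade.white
    · refine ⟨(⟨P.rot x, by rw [P.rot_fst]; exact hx⟩, 2), by simp, ?_, ?_⟩
      · intro d
        refine ⟨fun h => absurd (Prod.mk.inj h).2 (by decide), ?_⟩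
        rintro rfl
        exact absurd d.2 ((snd_white_iff c d.1).1 hx)
      · intro d
        rw [Prod.mk.injEq, Subtype.ext_iff, Equiv.symm_apply_eq]
        simp
    · refine ⟨(⟨x.symm, (snd_white_iff c x).2 hx⟩, 1), by simp, ?_, ?_⟩
      · intro d
        rw [Prod.mk.injEq, Subtype.ext_iff]
        simp only [and_true]
        exact ⟨fun h => by rw [h]; simp, fun h => by rw [← h]; simp⟩
      · intro d
        refine ⟨fun h => absurd (Prod.mk.inj h).2 (by decide), ?_⟩
        rintro rfl
        rw [P.rot_symm_fst] at hx
        exact absurd d.2 hx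
  obtain ⟨ε, h0, h1, h2⟩ := hex x
  obtain ⟨δ, k0, k1, k2⟩ := hex y
  refine h (R ∘ tri c) ε δ ?_ ?_
  · rintro rfl
    obtain ⟨d, i⟩ := ε
    apply hxy
    fin_cases i
    · exact absurd rfl (h0 d)
    · rw [← (h1 d).1 rfl, ← (k1 d).1 rfl]
    · rw [← (h2 d).1 rfl, ← (k2 d).1 rfl]
  · ext ⟨d, i⟩
    rw [Pi.add_apply, Pi.single_apply, Pi.single_apply]
    fin_cases i
    · refine (P.bd_tri_zero c hG R d).trans ?_
      rw [hedge]
      simp [h0, k0]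
    · refine (P.bd_tri_one c hG R d).trans ?_
      rw [ha]
      simp [h1, k1]
    · refine (P.bd_tri_two c hG R d).trans ?_
      rw [ha]
      simp [h2, k2]

-- The dark sides of the angles and of `e` all lie on the same side of the triangle, so `R e.symm =
-- 1` suffices to put all three dark triangles inside.
open scoped Classical in
theorem triangleRule_of_stellation (h : (P.stellation c hG).TriangleRule (P.special s₀ s₁)) :
    P.TriangleRule c s₀ s₁ := by
  intro R e x y he hx hy hedge hangle hRe hne
  rw [← P.exists_inside_iff c s₀ s₁ hG]
  have hy' : c y.symm.fst = Shade.white := (snd_white_iff c y).2 (ne_white_iff.2 hy)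
  have hx' : c (P.rot x).fst = Shade.white := by rw [P.rot_fst]; exact hx
  let d : Fin 3 → WhiteDart c := ![⟨e, he⟩, ⟨y.symm, hy'⟩, ⟨P.rot x, hx'⟩]
  have hwb : ∀ {a b : G.Dart}, c a.fst = Shade.white → c b.fst = Shade.white → a ≠ b.symm := by
    rintro a b ha hb rfl
    exact (snd_white_iff c b).1 ha hb
  have hbd : (P.stellation c hG).bd (R ∘ tri c) = ∑ i, Pi.single (d i, i) 1 := by
    ext ⟨a, i⟩
    rw [Fin.sum_univ_three, Pi.add_apply, Pi.add_apply, Pi.single_apply, Pi.single_apply,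
      Pi.single_apply]
    fin_cases i
    · refine (P.bd_tri_zero c hG R a).trans ?_
      rw [hedge]
      simp [d, Subtype.ext_iff, hwb a.2 he]
    · refine (P.bd_tri_one c hG R a).trans ?_
      rw [hangle, if_neg (fun h => hwb hx a.2 h.symm), zero_add]
      have : a.1.symm = y ↔ a.1 = y.symm :=
        ⟨fun h => by rw [← h]; simp, fun h => by rw [h]; simp⟩
      simp [d, Subtype.ext_iff, this]
    · refine (P.bd_tri_two c hG R a).trans ?_
      have h1 : P.rot.symm a.1 ≠ y := by
        rintro rfl
        rw [P.rot_symm_fst, a.2] at hy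
        exact nomatch hy
      rw [hangle, if_neg h1, add_zero]
      simp [d, Subtype.ext_iff, Equiv.symm_apply_eq]
  refine h (R ∘ tri c) d hbd ?_ ?_
  · exact fun i => (P.stellation c hG).inl_eq_one_of_bd_eq _ d hbd hRe i
  · intro hall
    apply hne
    have h1 := congrArg Subtype.val (hall 1)
    have h2 := congrArg Subtype.val (hall 2)
    simp only [d, Fin.isValue, Matrix.cons_val_one, Matrix.cons_val_zero, Matrix.cons_val] at h1 h2
    rw [next_symm_apply, h2, ← h1]
    simp

open scoped Classical in
theorem stellation_digonRule (h : P.DigonRule s₀ s₁) :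
    (P.stellation c hG).DigonRule (P.special s₀ s₁) := by
  set T := P.stellation c hG with hT
  rintro R ⟨d, i⟩ ⟨e, j⟩ hne hbd
  have hcyc : T.cyc (Pi.single (d, i) 1) = T.cyc (Pi.single (e, j) 1) := by
    have := T.cyc_bd R
    rw [hbd, map_add] at this
    ext x
    exact Hypermap.zmod_two_add_eq_zero.1 (congrFun this x)
  rw [Hypermap.cyc_single, Hypermap.cyc_single] at hcyc
  -- The two sides of a digon have the same boundary, hence the same ends and the same type.
  have hmem : ∀ k, k ≠ i → (k ≠ j ∧ T.dv d k = T.dv e k) := by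
    intro k hk
    have h1 := congrFun hcyc (T.dv d k)
    have h2 : ∀ (a : WhiteDart c) (m : Fin 3), m ≠ k → T.dv d k ≠ T.dv a m :=
      fun a m hm h => hm (T.dv_inj h).symm
    have h3 : ∀ (a : WhiteDart c) (m : Fin 3), m ≠ k →
      (Pi.single (T.dv a m) 1 : V ⊕ P.Face → ZMod 2) (T.dv d k) = 0 :=
      fun a m hm => Pi.single_eq_of_ne (h2 a m hm) _
    have h4 : (Pi.single (T.dv d (i + 1)) 1 + Pi.single (T.dv d (i + 2)) 1 : V ⊕ P.Face → ZMod 2)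
        (T.dv d k) = 1 := by
      rw [Pi.add_apply]
      rcases Hypermap.fin_three_eq_add i k hk with rfl | rfl
      · rw [Pi.single_eq_same, h3 d _ (Hypermap.fin_three_add_ne i).symm, add_zero]
      · rw [Pi.single_eq_same, h3 d _ (Hypermap.fin_three_add_ne i), zero_add]
    rw [h4, Pi.add_apply] at h1
    by_contra hcon
    by_cases hkj : k = j
    · subst hkj
      rw [h3 e _ (Hypermap.fin_three_ne_add_one k).symm,
        h3 e _ (Hypermap.fin_three_ne_add_two k).symm] at h1
      exact one_ne_zero h1
    · have h5 : T.dv d k ≠ T.dv e k := fun h => hcon ⟨hkj, h⟩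
      rcases Hypermap.fin_three_eq_add j k hkj with rfl | rfl
      · rw [Pi.single_eq_of_ne h5, h3 e _ (Hypermap.fin_three_add_ne j).symm] at h1
        exact one_ne_zero h1
      · rw [Pi.single_eq_of_ne h5, h3 e _ (Hypermap.fin_three_add_ne j)] at h1
        exact one_ne_zero h1
  have hij : i = j := by
    by_contra h
    exact (hmem j (Ne.symm h)).1 rfl
  subst hij
  have hde : d ≠ e := fun h => hne (by rw [h])
  have hR := eq_comp_tri c R
  set R' := R ∘ (triEquiv c).symm
  rw [hR]
  rw [hR] at hbd
  rw [P.exists_inside_iff c s₀ s₁ hG]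
  have hval : ∀ a k, T.bd (R' ∘ tri c) (a, k) =
      (if k = i ∧ a = d then 1 else 0) + (if k = i ∧ a = e then 1 else 0) := by
    intro a k
    rw [hbd, Pi.add_apply, Pi.single_apply, Pi.single_apply]
    simp [and_comm]
  have h0 : ∀ a : WhiteDart c, R' a.1 + R' a.1.symm =
      (if 0 = i ∧ a = d then 1 else 0) + (if 0 = i ∧ a = e then 1 else 0) :=
    fun a => (P.bd_tri_zero c hG R' a).symm.trans (hval a 0)
  have h1 : ∀ a : WhiteDart c, R' a.1.symm + R' (P.next.symm a.1.symm) =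
      (if 1 = i ∧ a = d then 1 else 0) + (if 1 = i ∧ a = e then 1 else 0) :=
    fun a => (P.bd_tri_one c hG R' a).symm.trans (hval a 1)
  have h2 : ∀ a : WhiteDart c, R' (P.rot.symm a.1) + R' (P.next.symm (P.rot.symm a.1)) =
      (if 2 = i ∧ a = d then 1 else 0) + (if 2 = i ∧ a = e then 1 else 0) :=
    fun a => (P.bd_tri_two c hG R' a).symm.trans (hval a 2)
  have hsymm : i ≠ 0 → ∀ a, R' a.symm = R' a := by
    intro hi a
    have := edge_eq_of_white c (f := fun a => R' a + R' a.symm) (g := fun _ => 0)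
      (fun a => by rw [SimpleGraph.Dart.symm_symm]; exact add_comm _ _) (fun _ => rfl)
      (fun a => by simp [h0 a, hi.symm]) a
    exact (Hypermap.zmod_two_add_eq_zero.1 this).symm
  have hw : ∀ {a b : WhiteDart c}, a.1.symm ≠ b.1 := by
    intro a b h
    have := b.2
    rw [← h] at this
    exact (snd_white_iff c a.1).1 this a.2
  fin_cases i
  -- Two edges of `G` with the same ends coincide.
  · exfalso
    have e1 : d.1.fst = e.1.fst := Sum.inl.inj (hmem 1 (by simp)).2
    have e2 : d.1.snd = e.1.snd := Sum.inl.inj (hmem 2 (by simp)).2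
    exact hde (Subtype.ext (SimpleGraph.Dart.ext _ _ (Prod.ext e1 e2)))
  · refine h R' d.1.symm e.1.symm ?_ (hsymm (by simp)) ?_
    · intro h
      exact hde (Subtype.ext (SimpleGraph.Dart.symm_involutive.injective h))
    · refine P.angle_eq_of_white c ?_ ?_
      · intro a
        rw [h1]
        simp only [SimpleGraph.Dart.symm_involutive.injective.eq_iff, Subtype.ext_iff]
        simp
      · intro a
        have hb : c (P.rot.symm a.1).fst = Shade.white := by rw [P.rot_symm_fst]; exact a.2
        have n1 : P.rot.symm a.1 ≠ d.1.symm := fun h => hw (a := d) (b := ⟨_, hb⟩) h.symm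
        have n2 : P.rot.symm a.1 ≠ e.1.symm := fun h => hw (a := e) (b := ⟨_, hb⟩) h.symm
        rw [h2, if_neg n1, if_neg n2]
        simp
  · refine h R' (P.rot.symm d.1) (P.rot.symm e.1) ?_ (hsymm (by simp)) ?_
    · intro h
      exact hde (Subtype.ext (P.rot.symm.injective h))
    · refine P.angle_eq_of_white c ?_ ?_
      · intro a
        have hb : ∀ b : WhiteDart c, c (P.rot.symm b.1).fst = Shade.white :=
          fun b => by rw [P.rot_symm_fst]; exact b.2
        have n1 : a.1.symm ≠ P.rot.symm d.1 := hw (a := a) (b := ⟨_, hb d⟩)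
        have n2 : a.1.symm ≠ P.rot.symm e.1 := hw (a := a) (b := ⟨_, hb e⟩)
        rw [h1, if_neg n1, if_neg n2]
        simp
      · intro a
        rw [h2]
        simp only [P.rot.symm.injective.eq_iff, Subtype.ext_iff]
        simp

open scoped Classical in
theorem stellation_triangleRule (h : P.TriangleRule c s₀ s₁) :
    (P.stellation c hG).TriangleRule (P.special s₀ s₁) := by
  set T := P.stellation c hG with hT
  intro R d hbd hRd hne
  have hR := eq_comp_tri c R
  set R' := R ∘ (triEquiv c).symm
  rw [hR] at hbd hRd ⊢
  rw [P.exists_inside_iff c s₀ s₁ hG]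
  have hval : ∀ a k, T.bd (R' ∘ tri c) (a, k) = if a = d k then 1 else 0 := by
    intro a k
    rw [hbd, Finset.sum_apply, Finset.sum_eq_single k]
    · simp [Pi.single_apply]
    · intro j _ hj
      simp [hj.symm]
    · simp
  have h0 : ∀ a : WhiteDart c, R' a.1 + R' a.1.symm = if a = d 0 then 1 else 0 :=
    fun a => (P.bd_tri_zero c hG R' a).symm.trans (hval a 0)
  have h1 : ∀ a : WhiteDart c, R' a.1.symm + R' (P.next.symm a.1.symm) = if a = d 1 then 1 else 0 :=
    fun a => (P.bd_tri_one c hG R' a).symm.trans (hval a 1)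
  have h2 : ∀ a : WhiteDart c, R' (P.rot.symm a.1) + R' (P.next.symm (P.rot.symm a.1)) =
      if a = d 2 then 1 else 0 :=
    fun a => (P.bd_tri_two c hG R' a).symm.trans (hval a 2)
  have hrw : ∀ a : WhiteDart c, c (P.rot.symm a.1).fst = Shade.white :=
    fun b => by rw [P.rot_symm_fst]; exact b.2
  have hw : ∀ {a b : G.Dart}, c a.fst = Shade.white → c b.fst = Shade.white → a.symm ≠ b := by
    rintro a b ha hb rfl
    exact (snd_white_iff c a).1 hb ha
  refine h R' (d 0).1 (P.rot.symm (d 2).1) (d 1).1.symm (d 0).2 (hrw _) (snd_eq_black c (d 1).2)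
    ?_ ?_ (hRd 0) ?_
  · refine edge_eq_of_white c ?_ ?_ ?_
    · intro a
      rw [SimpleGraph.Dart.symm_symm]; exact add_comm _ _
    · intro a
      have e1 : a.symm = (d 0).1 ↔ a = (d 0).1.symm :=
        ⟨fun h => by rw [← h]; simp, fun h => by rw [h]; simp⟩
      have e2 : a.symm = (d 0).1.symm ↔ a = (d 0).1 :=
        SimpleGraph.Dart.symm_involutive.injective.eq_iff
      simp only [e1, e2, or_comm]
    · intro a
      rw [h0]
      simp [Subtype.ext_iff, (hw (d 0).2 a.2).symm]
  · refine P.angle_eq_of_white c ?_ ?_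
    · intro a
      rw [h1, if_neg (hw a.2 (hrw _)), zero_add]
      simp only [SimpleGraph.Dart.symm_involutive.injective.eq_iff, Subtype.ext_iff]
    · intro a
      rw [h2, if_neg (hw (d 1).2 (hrw a)).symm, add_zero]
      simp only [P.rot.symm.injective.eq_iff, Subtype.ext_iff]
  · rintro ⟨e1, e2⟩
    rw [next_symm_apply, Equiv.apply_symm_apply] at e1
    refine hne fun i => ?_
    fin_cases i
    · rfl
    · exact Subtype.ext (SimpleGraph.Dart.symm_involutive.injective e2)
    · exact Subtype.ext (SimpleGraph.Dart.symm_involutive.injective e1)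

end Rules

end PlaneDrawing

end StrongLabeling

/-! ### The digon rule and weak 2-connectivity -/

namespace StrongLabeling

theorem reachable_invariant {W : Type*} {H : SimpleGraph W} {p : W → Prop}
    (hp : ∀ a b, H.Adj a b → p a → p b) {a b : W} (h : H.Reachable a b) (ha : p a) : p b := by
  obtain ⟨w⟩ := h
  induction w with
  | nil => exact ha
  | cons hadj _ ih => exact ih (hp _ _ hadj ha)

namespace PlaneDrawing

variable {V : Type*} {G : SimpleGraph V} (P : PlaneDrawing G) (c : G.Coloring Shade) [Finite V]
  [Nontrivial V]

theorem exists_dart_of_onOuterFace (hG : G.Connected) {s : V} (hs : P.OnOuterFace s) :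
    ∃ d : G.Dart, d.fst = s ∧ P.leftFace d = P.outer := by
  obtain ⟨d | ⟨v, hv⟩, h1, h2⟩ := hs
  · exact ⟨d, h1, h2⟩
  · obtain ⟨w, hw⟩ := hG.preconnected.exists_adj_of_nontrivial v
    exact absurd hw (hv w)

open scoped Classical in
theorem fst_eq_of_digon {R : G.Dart → ZMod 2} {x y : G.Dart} (hs : ∀ d, R d.symm = R d)
    (ha : ∀ d, R d + R (P.next.symm d) = (if d = x then 1 else 0) + (if d = y then 1 else 0)) :
    y.fst = x.fst := by
  have h := P.vertex_parity R x.fst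
  by_contra hne
  have h1 : ∀ d : G.Dart, (if d.fst = x.fst then (R d + R d.symm) + (R d + R (P.next.symm d)) else 0) =
      if d = x then 1 else 0 := by
    intro d
    rw [ha, hs, CharTwo.add_self_eq_zero, zero_add]
    by_cases hd : d = x
    · subst hd
      have : d ≠ y := fun h => hne (by rw [h])
      simp [this]
    · by_cases hd' : d = y
      · subst hd'
        simp [hne, hd]
      · simp [hd, hd']
  simp only [h1, Finset.sum_ite_eq', Finset.mem_univ, if_true] at h
  exact one_ne_zero h

-- A digon at `v` is crossed by no edge of `G`, so it splits the vertices other than `v` into two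
-- nonempty parts. As `G + s₀s₁ - v` is connected, the edge `s₀s₁` joins the two parts, which puts
-- one of its ends inside.
open scoped Classical in
theorem digonRule_of_weaklyTwoConnected {s₀ s₁ : V} (hW : WeaklyTwoConnected G s₀ s₁) :
    P.DigonRule s₀ s₁ := by
  intro R x y hxy hs ha
  by_contra! hcon
  have hyx := P.fst_eq_of_digon hs ha
  set v := x.fst with hv
  have hrot : ∀ {u}, u ≠ v → ∀ d : G.Dart, d.fst = u → R (P.rot d) = R d := by
    rintro u hu d rfl
    have := ha d
    rw [if_neg (fun h => hu (by rw [h])), if_neg (fun h => hu (by rw [h, hyx])), add_zero,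
      Hypermap.zmod_two_add_eq_zero, next_symm_apply, hs] at this
    exact this.symm
  have hwithin : ∀ {u}, u ≠ v → ∀ d : G.Dart, d.fst = u → R d = 1 → Within R u := by
    rintro u hu d hd h e (he | he)
    · rw [← h]
      exact P.eq_of_rot_invariant (hrot hu) he hd
    · rw [← h, ← hs]
      exact P.eq_of_rot_invariant (hrot hu) (d := e.symm) he hd
  have hex : ∀ d : G.Dart, ∃ e : G.Dart, e.fst ≠ v ∧ R e = R d := by
    intro d
    by_cases h : d.fst = v
    · exact ⟨d.symm, fun h' => d.adj.ne (h.trans h'.symm), hs d⟩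
    · exact ⟨d, h, rfl⟩
  have hx := ha x
  rw [if_pos rfl, if_neg hxy, add_zero] at hx
  have hval : ∃ d e : G.Dart, R d = 1 ∧ R e = 0 := by
    rcases Hypermap.zmod_two_cases (R x) with h | h
    · rw [h, zero_add] at hx
      exact ⟨_, _, hx, h⟩
    · refine ⟨_, P.next.symm x, h, ?_⟩
      rw [h] at hx
      simpa using hx
  obtain ⟨d, e, hd, he⟩ := hval
  obtain ⟨d, hdv, hd'⟩ := hex d
  obtain ⟨e, hev, he'⟩ := hex e
  rw [hd] at hd'
  rw [he] at he'
  have hconn : ((G ⊔ SimpleGraph.edge s₀ s₁).induce ({v}ᶜ : Set V)).Connected := by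
    rcases hW with h | h
    · exact (h.2.2 v).mono (SimpleGraph.comap_monotone _ le_sup_left)
    · exact h.2.2 v
  -- Being inside spreads along edges of `G`; along `s₀s₁` nothing is to be checked, since neither
  -- end is inside.
  have := reachable_invariant (p := fun a => Within R a.1) (by
    rintro ⟨a, ha'⟩ ⟨b, hb⟩ hab hp
    simp only [SimpleGraph.comap_adj, SimpleGraph.sup_adj, SimpleGraph.edge_adj,
      Function.Embedding.subtype_apply] at hab
    rcases hab with hab | ⟨hab, _⟩
    · exact hwithin hb ⟨(b, a), hab.symm⟩ rfl (hp _ (Or.inr rfl))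
    · simp only at hp
      rcases hab with ⟨rfl, rfl⟩ | ⟨rfl, rfl⟩
      · exact absurd hp hcon.1
      · exact absurd hp hcon.2) (hconn.preconnected ⟨d.fst, hdv⟩ ⟨e.fst, hev⟩)
    (hwithin hdv d rfl hd')
  rw [this e (Or.inl rfl)] at he'
  exact one_ne_zero he'

open scoped Classical in
theorem exists_digon (c : G.Coloring Shade) (hG : G.Connected) {x y : G.Dart} (hv : y.fst = x.fst)
    (hf : P.leftFace y = P.leftFace x) : ∃ R : G.Dart → ZMod 2, (∀ d, R d.symm = R d) ∧
      ∀ d, R d + R (P.next.symm d) = (if d = x then 1 else 0) + (if d = y then 1 else 0) := by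
  obtain ⟨R, h1, h2⟩ := P.exists_region c hG (fun _ => 0)
    (fun d => (if d = x then 1 else 0) + (if d = y then 1 else 0)) (fun _ => rfl) (by
    intro v
    simp only [zero_add, ite_add_zero, Finset.sum_add_distrib, ← ite_and, and_comm (b := _ = x),
      and_comm (b := _ = y)]
    simp only [ite_and, Finset.sum_ite_eq', Finset.mem_univ, if_true, hv]
    exact CharTwo.add_self_eq_zero _) (by
    intro f
    simp only [ite_add_zero, Finset.sum_add_distrib, ← ite_and, and_comm (b := _ = x),
      and_comm (b := _ = y)]
    simp only [ite_and, Finset.sum_ite_eq', Finset.mem_univ, if_true, hf]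
    exact CharTwo.add_self_eq_zero _)
  exact ⟨R, fun d => (Hypermap.zmod_two_add_eq_zero.1 (h1 d)).symm, h2⟩

section Digon

variable {P} {s₀ s₁ : V} (hD : P.DigonRule s₀ s₁)

include hD

-- The rule applies to a region and to its complement, which has the same boundary.
open scoped Classical in
theorem DigonRule.separates {t₀ t₁ : G.Dart} (h₀ : t₀.fst = s₀) (h₁ : t₁.fst = s₁)
    {R : G.Dart → ZMod 2} {x y : G.Dart} (hxy : x ≠ y) (hs : ∀ d, R d.symm = R d)
    (ha : ∀ d, R d + R (P.next.symm d) = (if d = x then 1 else 0) + (if d = y then 1 else 0)) :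
    (Within R s₀ ∧ Within (1 + R) s₁) ∨ (Within R s₁ ∧ Within (1 + R) s₀) := by
  have h1 := hD R x y hxy hs ha
  have h2 := hD (1 + R) x y hxy (fun d => by simp [hs]) (fun d => by
    rw [← ha d, Pi.add_apply, Pi.add_apply, Pi.one_apply, Pi.one_apply]
    have : (1 : ZMod 2) + 1 = 0 := rfl
    linear_combination this)
  have h3 : ∀ {s} {t : G.Dart}, t.fst = s → Within R s → ¬ Within (1 + R) s := by
    intro s t ht h h'
    have e1 := h t (Or.inl ht)
    have e2 := h' t (Or.inl ht)
    rw [Pi.add_apply, e1, Pi.one_apply] at e2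
    exact absurd e2 (by decide)
  have h4 := @h3 s₀ t₀ h₀
  have h5 := @h3 s₁ t₁ h₁
  tauto

open scoped Classical in
theorem DigonRule.apply_add_apply {t₀ t₁ : G.Dart} (h₀ : t₀.fst = s₀) (h₁ : t₁.fst = s₁)
    {R : G.Dart → ZMod 2} {x y : G.Dart} (hxy : x ≠ y) (hs : ∀ d, R d.symm = R d)
    (ha : ∀ d, R d + R (P.next.symm d) = (if d = x then 1 else 0) + (if d = y then 1 else 0)) :
    R t₀ + R t₁ = 1 := by
  rcases hD.separates h₀ h₁ hxy hs ha with ⟨h1, h2⟩ | ⟨h1, h2⟩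
  · have e1 := h1 t₀ (Or.inl h₀)
    have e2 := h2 t₁ (Or.inl h₁)
    rw [Pi.add_apply, Pi.one_apply, add_eq_left] at e2
    rw [e1, e2, add_zero]
  · have e1 := h1 t₁ (Or.inl h₁)
    have e2 := h2 t₀ (Or.inl h₀)
    rw [Pi.add_apply, Pi.one_apply, add_eq_left] at e2
    rw [e1, e2, zero_add]

/-- A digon through another face cannot separate the special vertices, because it does not meet the
outer face, where both of them lie. -/
theorem DigonRule.leftFace_eq (c : G.Coloring Shade) (hG : G.Connected) (h₀ : P.OnOuterFace s₀)
    (h₁ : P.OnOuterFace s₁) {x y : G.Dart} (hxy : x ≠ y) (hv : y.fst = x.fst)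
    (hf : P.leftFace y = P.leftFace x) : P.leftFace x = P.outer := by
  classical
  by_contra hne
  obtain ⟨t₀, ht₀, hf₀⟩ := P.exists_dart_of_onOuterFace hG h₀
  obtain ⟨t₁, ht₁, hf₁⟩ := P.exists_dart_of_onOuterFace hG h₁
  obtain ⟨R, hs, ha⟩ := P.exists_digon c hG hv hf
  have h := hD.apply_add_apply ht₀ ht₁ hxy hs ha
  have : R t₀ = R t₁ := by
    refine P.eq_of_next_invariant c hG (f := P.outer) ?_ hf₀ hf₁
    intro d hd
    have hd' := (P.leftFace_next d).trans hd
    have := ha (P.next d)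
    rw [if_neg (fun h => hne (by rw [← h, hd'])), if_neg (fun h => hne (by rw [← hf, ← h, hd'])),
      add_zero, Hypermap.zmod_two_add_eq_zero, Equiv.symm_apply_apply] at this
    exact this
  rw [this, CharTwo.add_self_eq_zero] at h
  exact zero_ne_one h

/-- The three digons formed by pairs of these angles all separate the special vertices, but one of
them is the sum of the other two. -/
theorem DigonRule.not_three (c : G.Coloring Shade) (hG : G.Connected) {x y z : G.Dart}
    (hxy : x ≠ y) (hyz : y ≠ z) (hxz : x ≠ z) (hv : y.fst = x.fst) (hv' : z.fst = x.fst)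
    (hf : P.leftFace y = P.leftFace x) (hf' : P.leftFace z = P.leftFace x) : False := by
  classical
  obtain ⟨t₀, ht₀⟩ := exists_dart hG s₀
  obtain ⟨t₁, ht₁⟩ := exists_dart hG s₁
  obtain ⟨R, hs, ha⟩ := P.exists_digon c hG hv hf
  obtain ⟨S, hs', ha'⟩ := P.exists_digon c hG hv' hf'
  have h1 := hD.apply_add_apply ht₀ ht₁ hxy hs ha
  have h2 := hD.apply_add_apply ht₀ ht₁ hxz hs' ha'
  have h3 := hD.apply_add_apply (R := R + S) ht₀ ht₁ hyz (fun d => by simp [hs, hs']) (fun d => by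
    have e1 := ha d
    have e2 := ha' d
    have e3 := CharTwo.add_self_eq_zero (if d = x then (1 : ZMod 2) else 0)
    simp only [Pi.add_apply]
    linear_combination e1 + e2 + e3)
  simp only [Pi.add_apply] at h3
  have h4 : (1 : ZMod 2) = 1 + 1 := by
    linear_combination -h3 + h1 + h2
  exact absurd h4 (by decide)

/-- The triangles touching `A` have only angles at `v` as boundary. By parity these come at least
two to a face, so they are all in the outer face, where there are at most two. This digon has no
special vertex inside. -/
theorem DigonRule.not_separating (c : G.Coloring Shade) (hG : G.Connected) (h₀ : P.OnOuterFace s₀)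
    (h₁ : P.OnOuterFace s₁) {A : Set V} {v : V} (h₀A : s₀ ∉ A) (h₁A : s₁ ∉ A)
    (hA : A.Nonempty) (hB : ∃ b, b ∉ A ∧ b ≠ v)
    (hcl : ∀ a b, a ∈ A → G.Adj a b → b ≠ v → b ∈ A) : False := by
  classical
  set R : G.Dart → ZMod 2 := fun d => if d.fst ∈ A ∨ d.snd ∈ A then 1 else 0 with hR
  have hs : ∀ d, R d.symm = R d := by
    intro d
    simp only [hR]
    exact if_congr or_comm rfl rfl
  have hzero : ∀ d : G.Dart, d.fst ∉ A → d.fst ≠ v → R d = 0 := by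
    intro d hd hdv
    refine if_neg ?_
    rintro (h | h)
    · exact hd h
    · exact hd (hcl _ _ h d.adj.symm hdv)
  have hangle : ∀ d : G.Dart, d.fst ≠ v → R d + R (P.next.symm d) = 0 := by
    intro d hdv
    rw [Hypermap.zmod_two_add_eq_zero, next_symm_apply, hs]
    by_cases hd : d.fst ∈ A
    · simp only [hR]
      rw [if_pos (Or.inl hd), if_pos (Or.inl (by rwa [P.rot_fst]))]
    · rw [hzero d hd hdv, hzero _ (by rwa [P.rot_fst]) (by rwa [P.rot_fst])]
  have hM : ∃ z, R z + R (P.next.symm z) ≠ 0 := by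
    by_contra! hM
    obtain ⟨a, ha⟩ := hA
    obtain ⟨b, hb, hbv⟩ := hB
    obtain ⟨d, rfl⟩ := exists_dart hG a
    obtain ⟨e, rfl⟩ := exists_dart hG b
    have := P.region_ext c hG (R := R) (S := fun _ => R d) (a := d)
      (fun d => by rw [hs, CharTwo.add_self_eq_zero, CharTwo.add_self_eq_zero])
      (fun d => by rw [hM, CharTwo.add_self_eq_zero]) rfl
    have h1 := congrFun this e
    rw [hzero e hb hbv] at h1
    simp only [hR, if_pos (Or.inl ha)] at h1
    exact zero_ne_one h1
  have hMv : ∀ z, R z + R (P.next.symm z) ≠ 0 → z.fst = v := by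
    intro z hz
    by_contra h
    exact hz (hangle z h)
  have hmate : ∀ z, R z + R (P.next.symm z) ≠ 0 → ∃ y, y ≠ z ∧ P.leftFace y = P.leftFace z ∧
      R y + R (P.next.symm y) ≠ 0 := by
    intro z hz
    by_contra! hcon
    have := P.face_parity R (P.leftFace z)
    rw [Finset.sum_eq_single z] at this
    · rw [if_pos rfl] at this
      exact hz this
    · intro d _ hd
      split_ifs with h
      · exact hcon d hd h
      · rfl
    · simp
  have houter : ∀ z, R z + R (P.next.symm z) ≠ 0 → P.leftFace z = P.outer := by
    intro z hz
    obtain ⟨y, hyz, hf, hy⟩ := hmate z hz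
    exact hD.leftFace_eq c hG h₀ h₁ hyz.symm ((hMv y hy).trans (hMv z hz).symm) hf
  obtain ⟨z, hz⟩ := hM
  obtain ⟨y, hyz, hf, hy⟩ := hmate z hz
  have hone : ∀ {a : ZMod 2}, a ≠ 0 → a = 1 := fun {a} h =>
    (Hypermap.zmod_two_cases a).resolve_left h
  have ha : ∀ d, R d + R (P.next.symm d) = (if d = z then 1 else 0) + (if d = y then 1 else 0) := by
    intro d
    by_cases hdz : d = z
    · subst hdz
      rw [if_pos rfl, if_neg hyz.symm, hone hz, add_zero]
    · by_cases hdy : d = y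
      · subst hdy
        rw [if_pos rfl, if_neg hdz, hone hy, zero_add]
      · rw [if_neg hdz, if_neg hdy, add_zero]
        by_contra hd
        refine hD.not_three c hG hyz.symm (Ne.symm hdy) (Ne.symm hdz)
          ((hMv y hy).trans (hMv z hz).symm) ((hMv d hd).trans (hMv z hz).symm) hf
          ((houter d hd).trans (houter z hz).symm)
  -- The vertex `v` itself may be special, but it is a corner and not inside.
  have hno : ∀ s, s ∉ A → ¬ Within R s := by
    intro s hsA hin
    by_cases hsv : s = v
    · have e1 := hin z (Or.inl ((hMv z hz).trans hsv.symm))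
      have e2 := hin (P.next.symm z) (Or.inr (by rw [next_symm_snd, hMv z hz, hsv]))
      rw [e1, e2] at hz
      exact hz rfl
    · obtain ⟨d, rfl⟩ := exists_dart hG s
      have := hin d (Or.inl rfl)
      rw [hzero d hsA hsv] at this
      exact zero_ne_one this
  rcases hD R z y hyz.symm hs ha with h | h
  · exact hno _ h₀A h
  · exact hno _ h₁A h

/-- A disconnection of `G + s₀s₁ - v` leaves a component without special vertices, since these are
joined. A third vertex is a neighbour of `s₀`. -/
theorem DigonRule.weaklyTwoConnected (c : G.Coloring Shade) (hG : G.Connected) (hne : s₀ ≠ s₁)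
    (hadj : ¬ G.Adj s₀ s₁) (h₀ : P.OnOuterFace s₀) (h₁ : P.OnOuterFace s₁) :
    WeaklyTwoConnected G s₀ s₁ := by
  classical
  right
  refine ⟨?_, hG.mono le_sup_left, ?_⟩
  · obtain ⟨w, hw⟩ := hG.preconnected.exists_adj_of_nontrivial s₀
    have := Fintype.ofFinite V
    rw [Nat.card_eq_fintype_card]
    have h1 : ({s₀, w, s₁} : Finset V).card ≤ Fintype.card V := Finset.card_le_univ _
    rwa [Finset.card_insert_of_notMem (by
      simp only [Finset.mem_insert, Finset.mem_singleton, not_or]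
      exact ⟨hw.ne, hne⟩), Finset.card_pair (by
      rintro rfl
      exact hadj hw)] at h1
  · intro v
    set H := (G ⊔ SimpleGraph.edge s₀ s₁).induce ({v}ᶜ : Set V) with hH
    have hnonempty : Nonempty ({v}ᶜ : Set V) := by
      by_cases h : s₀ = v
      · exact ⟨⟨s₁, fun h' => hne (h.trans (Set.mem_singleton_iff.1 h').symm)⟩⟩
      · exact ⟨⟨s₀, h⟩⟩
    refine SimpleGraph.Connected.mk ?_
    by_contra hpre
    unfold SimpleGraph.Preconnected at hpre
    push Not at hpre
    obtain ⟨u, u', huu'⟩ := hpre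
    have key : ∀ u u' : ({v}ᶜ : Set V), ¬ H.Reachable u u' →
        (∀ h, ¬ H.Reachable u ⟨s₀, h⟩) → (∀ h, ¬ H.Reachable u ⟨s₁, h⟩) → False := by
      intro u u' huu' hs₀ hs₁
      refine hD.not_separating c hG h₀ h₁ (A := {a | ∃ h, H.Reachable u ⟨a, h⟩}) (v := v) ?_ ?_
        ⟨u.1, u.2, SimpleGraph.Reachable.refl _⟩ ⟨u'.1, ?_, u'.2⟩ ?_
      · rintro ⟨h, h'⟩
        exact hs₀ h h'
      · rintro ⟨h, h'⟩
        exact hs₁ h h'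
      · rintro ⟨h, h'⟩
        exact huu' h'
      · rintro a b ⟨h, h'⟩ hab hb
        refine ⟨hb, h'.trans (SimpleGraph.Adj.reachable ?_)⟩
        simp only [hH, SimpleGraph.comap_adj, SimpleGraph.sup_adj]
        exact Or.inl hab
    have hss : ∀ h h', H.Reachable ⟨s₀, h⟩ ⟨s₁, h'⟩ := by
      intro h h'
      refine SimpleGraph.Adj.reachable ?_
      simp only [hH, SimpleGraph.comap_adj, SimpleGraph.sup_adj, SimpleGraph.edge_adj]
      exact Or.inr ⟨Or.inl ⟨rfl, rfl⟩, hne⟩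
    by_cases hu : (∀ h, ¬ H.Reachable u ⟨s₀, h⟩) ∧ (∀ h, ¬ H.Reachable u ⟨s₁, h⟩)
    · exact key u u' huu' hu.1 hu.2
    · by_cases hu' : (∀ h, ¬ H.Reachable u' ⟨s₀, h⟩) ∧ (∀ h, ¬ H.Reachable u' ⟨s₁, h⟩)
      · exact key u' u (fun h => huu' h.symm) hu'.1 hu'.2
      · have hor : ∀ w : ({v}ᶜ : Set V), ¬ ((∀ h, ¬ H.Reachable w ⟨s₀, h⟩) ∧
            (∀ h, ¬ H.Reachable w ⟨s₁, h⟩)) →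
            (∃ h, H.Reachable w ⟨s₀, h⟩) ∨ ∃ h, H.Reachable w ⟨s₁, h⟩ := by
          intro w hw
          by_contra! h
          exact hw h
        rcases hor u hu with ⟨h, hr⟩ | ⟨h, hr⟩ <;> rcases hor u' hu' with ⟨h', hr'⟩ | ⟨h', hr'⟩
        · exact huu' (hr.trans hr'.symm)
        · exact huu' (hr.trans ((hss h h').trans hr'.symm))
        · exact huu' (hr.trans ((hss h' h).symm.trans hr'.symm))
        · exact huu' (hr.trans hr'.symm)

end Digon

end PlaneDrawing

end StrongLabeling

/-! ### The triangle rule when there is no block with a right chord -/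

namespace StrongLabeling

namespace PlaneDrawing

variable {V : Type*} {G : SimpleGraph V} (P : PlaneDrawing G) (c : G.Coloring Shade) [Finite V]
  [Nontrivial V]

open scoped Classical in
theorem fst_eq_of_triangle {R : G.Dart → ZMod 2} {e x y : G.Dart} (hx : c x.fst = Shade.white)
    (hy : c y.fst = Shade.black) (he : c e.fst = Shade.white)
    (hedge : ∀ d, R d + R d.symm = if d = e ∨ d = e.symm then 1 else 0)
    (hangle : ∀ d, R d + R (P.next.symm d) = (if d = x then 1 else 0) + (if d = y then 1 else 0)) :
    x.fst = e.fst ∧ y.fst = e.snd := by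
  have hb : c e.snd = Shade.black := snd_eq_black c he
  have hne : ∀ {u v : V}, c u = Shade.white → c v = Shade.black → u ≠ v := by
    rintro u v hu hv rfl
    rw [hu] at hv
    exact nomatch hv
  have h : ∀ v, (if e.fst = v then (1 : ZMod 2) else 0) + (if e.snd = v then 1 else 0) +
      ((if x.fst = v then 1 else 0) + (if y.fst = v then 1 else 0)) = 0 := by
    intro v
    refine Eq.trans ?_ (P.vertex_parity R v)
    have hs : ∀ d : G.Dart, (if d = e ∨ d = e.symm then (1 : ZMod 2) else 0) =
        (if d = e then 1 else 0) + (if d = e.symm then 1 else 0) := by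
      intro d
      by_cases h1 : d = e
      · subst h1
        simp [(SimpleGraph.Dart.symm_ne d).symm]
      · simp [h1]
    simp only [hedge, hangle, hs, ite_add_zero, Finset.sum_add_distrib]
    simp only [← ite_and, and_comm (b := _ = e), and_comm (b := _ = e.symm),
      and_comm (b := _ = x), and_comm (b := _ = y)]
    simp only [ite_and, Finset.sum_ite_eq', Finset.mem_univ, if_true]
    rfl
  constructor
  · by_contra hcon
    have := h x.fst
    rw [if_neg (Ne.symm hcon), if_neg (hne hx hb).symm, if_pos rfl, if_neg (hne hx hy).symm] at this
    exact absurd this (by decide)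
  · by_contra hcon
    have := h y.fst
    rw [if_neg (hne he hy), if_neg (Ne.symm hcon), if_pos rfl, if_neg (hne hx hy)] at this
    exact absurd this (by decide)

open scoped Classical in
/-- A path inside a connected set gives a chain of edges. -/
theorem exists_chain {S C : Set V} {w b : V}
    (hstep : ∀ Q : V → Prop, (∀ u v, Q u → G.Adj u v → u ∈ S → v ∈ S → u ∈ C ∨ v ∈ C → Q v) →
      Q w → Q b) :
    ∃ z : G.Dart → ZMod 2, (∀ d, z d.symm = z d) ∧
      (∀ d, z d ≠ 0 → (d.fst ∈ C ∨ d.snd ∈ C) ∧ d.fst ∈ S ∧ d.snd ∈ S) ∧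
      ∀ v, ∑ d : G.Dart, (if d.fst = v then z d else 0) =
        (if w = v then 1 else 0) + (if b = v then 1 else 0) := by
  refine hstep (fun b => ∃ z : G.Dart → ZMod 2, (∀ d, z d.symm = z d) ∧
      (∀ d, z d ≠ 0 → (d.fst ∈ C ∨ d.snd ∈ C) ∧ d.fst ∈ S ∧ d.snd ∈ S) ∧
      ∀ v, ∑ d : G.Dart, (if d.fst = v then z d else 0) =
        (if w = v then 1 else 0) + (if b = v then 1 else 0)) ?_ ?_
  · rintro u v ⟨z, h1, h2, h3⟩ huv hu hv hC
    let e : G.Dart := ⟨(u, v), huv⟩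
    refine ⟨fun d => z d + ((if d = e then 1 else 0) + (if d = e.symm then 1 else 0)), ?_, ?_, ?_⟩
    · intro d
      have h4 : d.symm = e ↔ d = e.symm := SimpleGraph.Dart.symm_involutive.eq_iff
      have h5 : d.symm = e.symm ↔ d = e := SimpleGraph.Dart.symm_involutive.injective.eq_iff
      simp only [h1, h4, h5]
      rw [add_comm (if d = e then (1 : ZMod 2) else 0)]
    · intro d hd
      by_cases h4 : d = e
      · subst h4
        exact ⟨hC, hu, hv⟩
      · by_cases h5 : d = e.symm
        · subst h5
          exact ⟨hC.symm, hv, hu⟩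
        · refine h2 d ?_
          dsimp only at hd
          rwa [if_neg h4, if_neg h5, add_zero, add_zero] at hd
    · intro t
      simp only [ite_add_zero, Finset.sum_add_distrib, h3]
      simp only [← ite_and, and_comm (b := _ = e), and_comm (b := _ = e.symm)]
      simp only [ite_and, Finset.sum_ite_eq', Finset.mem_univ, if_true]
      have h4 : (if e.symm.fst = t then (1 : ZMod 2) else 0) = if v = t then 1 else 0 := rfl
      have h5 := CharTwo.add_self_eq_zero (if u = t then (1 : ZMod 2) else 0)
      linear_combination h4 + h5
  · refine ⟨fun _ => 0, fun _ => rfl, fun d h => absurd rfl h, fun v => ?_⟩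
    rw [CharTwo.add_self_eq_zero]
    simp

-- At one end of `e` the corner of the triangle is not the angle right next to `e`. There the next
-- dart leads into `R`, and since `G` is simple it does not lead to the other end of `e`.
open scoped Classical in
theorem exists_inside_vertex {R : G.Dart → ZMod 2} {e x y : G.Dart}
    (hx : x.fst = e.fst) (hy : y.fst = e.snd)
    (hedge : ∀ d, R d + R d.symm = if d = e ∨ d = e.symm then 1 else 0)
    (hangle : ∀ d, R d + R (P.next.symm d) = (if d = x then 1 else 0) + (if d = y then 1 else 0))
    (hR : R e.symm = 1) (hxy : ¬ (P.next.symm x = e.symm ∧ y = e.symm)) :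
    ∃ d : G.Dart, d.fst ≠ e.fst ∧ d.fst ≠ e.snd ∧ R d = 1 := by
  have hwb := e.adj.ne
  have hdart : ∀ {a b : G.Dart}, a.fst = b.fst → a.snd = b.snd → a = b :=
    fun h h' => SimpleGraph.Dart.ext _ _ (Prod.ext h h')
  by_cases hye : y = e.symm
  · set z := P.next e.symm with hz
    have hzf : z.fst = e.fst := P.next_fst e.symm
    have hzx : z ≠ x := fun h => hxy ⟨by rw [← h, hz, Equiv.symm_apply_apply], hye⟩
    have hze : z ≠ e := by
      intro h
      apply hzx
      rw [h]
      have hrot : P.rot.symm e = e := by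
        have : P.rot.symm e.symm.symm = e := h
        rwa [SimpleGraph.Dart.symm_symm] at this
      obtain ⟨n, hn⟩ := P.rot_sameCycle e x hx.symm
      have h2 : P.rot e = e := by rw [← hrot, Equiv.apply_symm_apply, hrot]
      rw [← hn]
      exact (Function.IsFixedPt.perm_zpow h2 n).symm
    have h1 := hangle z
    rw [hz, Equiv.symm_apply_apply, ← hz, hR, if_neg hzx, if_neg (fun h => hwb (by
      rw [← hzf, h, hy])), add_zero, Hypermap.zmod_two_add_eq_zero] at h1
    have h2 := hedge z
    rw [if_neg (by
      rintro (h | h)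
      · exact hze h
      · exact hwb (by rw [← hzf, h]; rfl)), h1, Hypermap.zmod_two_add_eq_zero] at h2
    refine ⟨z.symm, fun h => z.adj.ne (hzf.trans h.symm), fun h => hze (hdart hzf h), h2.symm⟩
  · have h1 := hangle e.symm
    rw [hR, if_neg (fun h => hwb (by rw [← hx, ← h]; rfl)), if_neg (Ne.symm hye), add_zero,
      Hypermap.zmod_two_add_eq_zero, next_symm_apply] at h1
    set z := P.rot e.symm with hz
    have hzf : z.fst = e.snd := P.rot_fst e.symm
    refine ⟨z.symm, fun h => ?_, fun h => z.adj.ne (hzf.trans h.symm), h1.symm⟩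
    have hze : P.rot e.symm = e.symm := hdart hzf h
    obtain ⟨n, hn⟩ := P.rot_sameCycle e.symm y hy.symm
    apply hye
    rw [← hn]
    exact Function.IsFixedPt.perm_zpow hze n

-- Take a triangle on the right of `e` without special vertices inside. A component `C` of `G` minus
-- the ends of `e` lies inside, and a path through `C` closes `e` to a cycle of `G` within the
-- triangle. The outer face is outside this cycle, so `e` is a right chord.
open scoped Classical in
theorem triangleRule_of_not_hasBlockWithRightChord (hG : G.Connected) {s₀ s₁ : V} (hne : s₀ ≠ s₁)
    (hadj : ¬ G.Adj s₀ s₁) (h₀ : P.OnOuterFace s₀) (h₁ : P.OnOuterFace s₁)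
    (hW : WeaklyTwoConnected G s₀ s₁) (hB : ¬ P.HasBlockWithRightChord c s₀ s₁) :
    P.TriangleRule c s₀ s₁ := by
  intro R e x y he hx hy hedge hangle hR hxy
  by_contra! hcon
  obtain ⟨hxe, hye⟩ := P.fst_eq_of_triangle c hx hy he hedge hangle
  have hrot : ∀ {u}, u ≠ e.fst → u ≠ e.snd → ∀ d : G.Dart, d.fst = u ∨ d.snd = u →
      R d.symm = R d := by
    rintro u hw hb d hd
    have := hedge d
    rw [if_neg, Hypermap.zmod_two_add_eq_zero] at this
    · exact this.symm
    · rintro (rfl | rfl)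
      · exact hd.elim (fun h => hw h.symm) (fun h => hb h.symm)
      · exact hd.elim (fun h => hb h.symm) (fun h => hw h.symm)
  have hconst : ∀ {u}, u ≠ e.fst → u ≠ e.snd → ∀ d : G.Dart, d.fst = u → ∀ d' : G.Dart,
      d'.fst = u ∨ d'.snd = u → R d' = R d := by
    intro u hw hb d hd
    have key : ∀ d' : G.Dart, d'.fst = u → R d' = R d := by
      intro d' hd'
      refine P.eq_of_rot_invariant (fun d hd => ?_) hd' hd
      have := hangle d
      rw [if_neg (fun h => hw (by rw [← hd, h, hxe])), if_neg (fun h => hb (by rw [← hd, h, hye])),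
        add_zero, Hypermap.zmod_two_add_eq_zero, next_symm_apply,
        hrot hw hb _ (Or.inl ((P.rot_fst d).trans hd))] at this
      exact this.symm
    rintro d' (h | h)
    · exact key d' h
    · rw [← hrot hw hb d' (Or.inr h)]
      exact key d'.symm h
  obtain ⟨u, huw, hub, hRu⟩ := P.exists_inside_vertex hxe hye hedge hangle hR hxy
  have hup : u.fst ∈ ({e.symm.fst, e.symm.snd}ᶜ : Set V) := by
    rintro (h | h)
    · exact hub h
    · exact huw h
  set H := G.induce ({e.symm.fst, e.symm.snd}ᶜ : Set V) with hH
  set K : H.ConnectedComponent := H.connectedComponentMk ⟨u.fst, hup⟩ with hK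
  set C : Set V := Subtype.val '' K.supp with hC
  have hnot : ∀ {v}, v ∈ C → v ≠ e.fst ∧ v ≠ e.snd := by
    rintro _ ⟨⟨v, hv⟩, _, rfl⟩
    exact ⟨fun h => hv (Or.inr h), fun h => hv (Or.inl h)⟩
  have hclosed : ∀ {a b}, a ∈ C → G.Adj a b → b ≠ e.fst → b ≠ e.snd → b ∈ C := by
    rintro _ b ⟨⟨a, ha⟩, haK, rfl⟩ hab hw hb
    refine ⟨⟨b, fun h => h.elim hb hw⟩, ?_, rfl⟩
    exact SimpleGraph.ConnectedComponent.mem_supp_of_adj_mem_supp _ haK (by exact hab)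
  have hreach : ∀ {p : V → Prop} {a b : V}, (∀ a b, a ∈ C → b ∈ C → G.Adj a b → p a → p b) →
      a ∈ C → b ∈ C → p a → p b := by
    rintro p _ _ hp ⟨a, ha, rfl⟩ ⟨b, hb, rfl⟩ hpa
    have : H.Reachable a b := SimpleGraph.ConnectedComponent.reachable_of_mem_supp K ha hb
    have h2 := reachable_invariant (p := fun v => v ∈ K.supp ∧ p v.1) (by
      rintro v v' hadj ⟨hv, hpv⟩
      have hv' := SimpleGraph.ConnectedComponent.mem_supp_of_adj_mem_supp _ hv hadj
      exact ⟨hv', hp _ _ ⟨v, hv, rfl⟩ ⟨v', hv', rfl⟩ hadj hpv⟩) this ⟨ha, hpa⟩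
    exact h2.2
  have huC : u.fst ∈ C := ⟨⟨u.fst, hup⟩, rfl, rfl⟩
  have hin : ∀ v ∈ C, Within R v := by
    intro v hv
    refine hreach (p := Within R) ?_ huC hv ?_
    · intro a b _ hb hab hpa d hd
      rw [hconst (hnot hb).1 (hnot hb).2 ⟨(b, a), hab.symm⟩ rfl d hd]
      exact hpa _ (Or.inr rfl)
    · intro d hd
      rw [hconst huw hub u rfl d hd, hRu]
  have hs₀ : s₀ ∉ C := fun h => hcon.1 (hin _ h)
  have hs₁ : s₁ ∉ C := fun h => hcon.2 (hin _ h)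
  -- By weak 2-connectivity, `C` is adjacent to both ends of `e`, since it contains no special
  -- vertex.
  have hattach : ∀ v v' : V, v ≠ v' → ((v = e.fst ∧ v' = e.snd) ∨ (v = e.snd ∧ v' = e.fst)) →
      ∃ a ∈ C, G.Adj a v := by
    intro v v' hvv' hv
    by_contra! hna
    have hconn : ((G ⊔ SimpleGraph.edge s₀ s₁).induce ({v'}ᶜ : Set V)).Connected := by
      rcases hW with h | h
      · exact (h.2.2 v').mono (SimpleGraph.comap_monotone _ le_sup_left)
      · exact h.2.2 v'
    have huv' : u.fst ≠ v' := by
      rcases hv with ⟨_, rfl⟩ | ⟨_, rfl⟩ <;> assumption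
    have := reachable_invariant (p := fun a => a.1 ∈ C) (by
      rintro ⟨a, ha⟩ ⟨b, hb⟩ hab hp
      simp only [SimpleGraph.comap_adj, SimpleGraph.sup_adj, SimpleGraph.edge_adj,
        Function.Embedding.subtype_apply] at hab
      simp only at hp
      have hb' : b ≠ v' := hb
      rcases hab with hab | ⟨⟨rfl, rfl⟩ | ⟨rfl, rfl⟩, _⟩
      · have hbv : b ≠ v := by
          rintro rfl
          exact hna a hp hab
        rcases hv with ⟨rfl, rfl⟩ | ⟨rfl, rfl⟩
        · exact hclosed hp hab hbv hb'
        · exact hclosed hp hab hb' hbv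
      · exact absurd hp hs₀
      · exact absurd hp hs₁) (hconn.preconnected ⟨u.fst, huv'⟩ ⟨v, hvv'⟩) huC
    rcases hv with ⟨rfl, _⟩ | ⟨rfl, _⟩
    · exact (hnot this).1 rfl
    · exact (hnot this).2 rfl
  obtain ⟨a, ha, haw⟩ := hattach e.fst e.snd e.adj.ne (Or.inl ⟨rfl, rfl⟩)
  obtain ⟨b, hb, hbb⟩ := hattach e.snd e.fst e.adj.ne.symm (Or.inr ⟨rfl, rfl⟩)
  set S : Set V := C ∪ {e.symm.fst, e.symm.snd} with hS
  have hCS : ∀ {v}, v ∈ C → v ∈ S := fun h => Or.inl h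
  have hwS : e.fst ∈ S := Or.inr (Or.inr rfl)
  have hbS : e.snd ∈ S := Or.inr (Or.inl rfl)
  obtain ⟨z, hz1, hz2, hz3⟩ := exists_chain (S := S) (C := C) (w := e.fst) (b := e.snd) (by
    intro Q hQ hw
    have h1 : Q a := hQ _ _ hw haw.symm hwS (hCS ha) (Or.inr ha)
    have h2 : Q b := hreach (fun p q hp hq hpq h => hQ p q h hpq (hCS hp) (hCS hq) (Or.inl hp))
      ha hb h1
    exact hQ _ _ h2 hbb (hCS hb) hbS (Or.inl hb))
  -- The side of the cycle (path through `C` plus `e`) that contains the right of `e`; it is a union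
  -- of faces.
  obtain ⟨R₂, h2e, h2a, h2⟩ : ∃ R₂ : G.Dart → ZMod 2,
      (∀ d, R₂ d + R₂ d.symm = z d + if d = e ∨ d = e.symm then 1 else 0) ∧
      (∀ d, R₂ d + R₂ (P.next.symm d) = 0) ∧ R₂ e = 0 := by
    obtain ⟨R₂, h1, h2⟩ := P.exists_region c hG
      (fun d => z d + if d = e ∨ d = e.symm then 1 else 0) (fun _ => 0) (by
      intro d
      have h4 : d.symm = e ↔ d = e.symm := SimpleGraph.Dart.symm_involutive.eq_iff
      have h5 : d.symm = e.symm ↔ d = e := SimpleGraph.Dart.symm_involutive.injective.eq_iff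
      simp only [hz1, h4, h5]
      rw [if_congr or_comm rfl rfl]) (by
      intro v
      have hs : ∀ d : G.Dart, (if d = e ∨ d = e.symm then (1 : ZMod 2) else 0) =
          (if d = e then 1 else 0) + (if d = e.symm then 1 else 0) := by
        intro d
        by_cases h1 : d = e
        · subst h1
          simp [(SimpleGraph.Dart.symm_ne d).symm]
        · simp [h1]
      simp only [hs, ite_add_zero, Finset.sum_add_distrib, hz3]
      simp only [← ite_and, and_comm (b := _ = e), and_comm (b := _ = e.symm)]
      simp only [ite_and, Finset.sum_ite_eq', Finset.mem_univ, if_true]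
      have h4 : (if e.symm.fst = v then (1 : ZMod 2) else 0) = if e.snd = v then 1 else 0 := rfl
      rw [h4]
      simp only [ite_self, Finset.sum_const_zero, add_zero]
      exact CharTwo.add_self_eq_zero _) (by simp)
    rcases Hypermap.zmod_two_cases (R₂ e) with h | h
    · exact ⟨R₂, h1, h2, h⟩
    · have h3 : (1 : ZMod 2) + 1 = 0 := rfl
      refine ⟨1 + R₂, fun d => ?_, fun d => ?_, ?_⟩
      · rw [← h1 d, Pi.add_apply, Pi.add_apply, Pi.one_apply, Pi.one_apply]
        linear_combination h3
      · rw [← h2 d, Pi.add_apply, Pi.add_apply, Pi.one_apply, Pi.one_apply]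
        linear_combination h3
      · rw [Pi.add_apply, h]
        exact h3
  have hze : z e = 0 := by
    by_contra h
    rcases (hz2 e h).1 with h | h
    · exact (hnot h).1 rfl
    · exact (hnot h).2 rfl
  have h2' : R₂ e.symm = 1 := by
    have := h2e e
    rw [h2, hze, if_pos (Or.inl rfl), zero_add, zero_add] at this
    exact this
  -- The part of `R₂` outside `R`. It turns out to have no boundary, so it is empty.
  set Q : G.Dart → ZMod 2 := fun d => R₂ d * (1 + R d) with hQ
  have hQe : ∀ d, Q d + Q d.symm = 0 := by
    have h3 : (1 : ZMod 2) + 1 = 0 := rfl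
    intro d
    simp only [hQ]
    by_cases hd : d = e
    · rw [hd, h2, hR, h3, zero_mul, mul_zero, add_zero]
    · by_cases hd' : d = e.symm
      · rw [hd', SimpleGraph.Dart.symm_symm, h2, hR, h3, zero_mul, mul_zero, add_zero]
      · have h4 := hedge d
        have h5 := h2e d
        rw [if_neg (by tauto), Hypermap.zmod_two_add_eq_zero] at h4
        rw [if_neg (by tauto), add_zero] at h5
        rw [← h4]
        by_cases hzd : z d = 0
        · rw [hzd, Hypermap.zmod_two_add_eq_zero] at h5
          rw [h5]
          exact CharTwo.add_self_eq_zero _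
        · have : R d = 1 := by
            rcases (hz2 d hzd).1 with h | h
            · exact hin _ h d (Or.inl rfl)
            · exact hin _ h d (Or.inr rfl)
          rw [this, h3, mul_zero, mul_zero, add_zero]
  have hQa : ∀ d, Q d + Q (P.next.symm d) =
      R₂ d * ((if d = x then 1 else 0) + (if d = y then 1 else 0)) := by
    intro d
    have h3 : (1 : ZMod 2) + 1 = 0 := rfl
    have := h2a d
    rw [Hypermap.zmod_two_add_eq_zero] at this
    simp only [hQ]
    rw [← this, ← hangle d]
    linear_combination R₂ d * h3
  have hwb := e.adj.ne
  -- At this end of `e`, only the angle `x` can be in the boundary of `Q`, so parity excludes it.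
  have hQx : R₂ x = 0 := by
    have := P.vertex_parity Q e.fst
    rw [Finset.sum_eq_single x] at this
    · rw [if_pos hxe, hQe, hQa, if_pos rfl, if_neg (fun h => hwb (by rw [← hxe, ← hye, h]))] at this
      simpa using this
    · intro d _ hdx
      split_ifs with h
      · rw [hQe, hQa, if_neg hdx, if_neg (fun h' => hwb (by rw [← hye, ← h, h']))]
        simp
      · rfl
    · simp
  have hQy : R₂ y = 0 := by
    have := P.vertex_parity Q e.snd
    rw [Finset.sum_eq_single y] at this
    · rw [if_pos hye, hQe, hQa, if_pos rfl, if_neg (fun h => hwb (by rw [← hxe, ← hye, h]))] at this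
      simpa using this
    · intro d _ hdy
      split_ifs with h
      · rw [hQe, hQa, if_neg hdy, if_neg (fun h' => hwb (by rw [← hxe, ← h, h']))]
        simp
      · rfl
    · simp
  have hQ0 : Q = 0 := by
    refine P.region_ext c hG (a := e) (fun d => by simp [hQe]) (fun d => ?_) (by simp [hQ, h2])
    rw [hQa]
    by_cases h : d = x
    · rw [h, hQx]
      simp
    · by_cases h' : d = y
      · rw [h', hQy]
        simp
      · simp [h, h']
  have hface : ∀ {f} {d d' : G.Dart}, P.leftFace d = f → P.leftFace d' = f → R₂ d = R₂ d' := by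
    intro f d d' hd hd'
    refine P.eq_of_next_invariant c hG (fun d _ => ?_) hd hd'
    have := h2a (P.next d)
    rwa [Equiv.symm_apply_apply, Hypermap.zmod_two_add_eq_zero] at this
  -- At most one special vertex is an end of `e`, as they are nonadjacent. The other one shows that
  -- the outer face is not in `R₂`.
  have hfree : ∃ s, P.OnOuterFace s ∧ s ≠ e.fst ∧ s ≠ e.snd ∧ ¬ Within R s := by
    by_cases h : s₀ = e.fst ∨ s₀ = e.snd
    · refine ⟨s₁, h₁, fun h' => ?_, fun h' => ?_, hcon.2⟩
      · rcases h with h | h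
        · exact hne (h.trans h'.symm)
        · exact hadj (by rw [h, h']; exact e.adj.symm)
      · rcases h with h | h
        · exact hadj (by rw [h, h']; exact e.adj)
        · exact hne (h.trans h'.symm)
    · exact ⟨s₀, h₀, fun h' => h (Or.inl h'), fun h' => h (Or.inr h'), hcon.1⟩
  obtain ⟨s, hsO, hsw, hsb, hsR⟩ := hfree
  obtain ⟨t, hts, htO⟩ := P.exists_dart_of_onOuterFace hG hsO
  have hRt : R t = 0 := by
    refine (Hypermap.zmod_two_cases _).resolve_right fun h => hsR fun d hd => ?_
    rw [hconst hsw hsb t hts d hd, h]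
  have hR₂t : R₂ t = 0 := by
    have := congrFun hQ0 t
    simpa only [hQ, hRt, add_zero, mul_one, Pi.zero_apply] using this
  apply hB
  refine ⟨e.symm, snd_eq_black c he, he, K, ?_, ?_⟩
  · intro v hv
    have hvC : v.1 ∈ C := ⟨v, hv, rfl⟩
    exact ⟨fun h => hs₀ (h ▸ hvC), fun h => hs₁ (h ▸ hvC)⟩
  · intro hsame
    -- Moving between faces without crossing edges of the block does not cross the cycle.
    have key : ∀ f g, P.SameFaceOfInduced S f g →
        ((∀ d, P.leftFace d = f → R₂ d = 1) ↔ (∀ d, P.leftFace d = g → R₂ d = 1)) := by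
      intro f g hfg
      induction hfg with
      | rel f g h =>
        obtain ⟨d, hdS, rfl, rfl⟩ := h
        have hzd : z d = 0 := by
          by_contra h
          exact hdS (hz2 d h).2
        have hd : R₂ d = R₂ d.symm := by
          have := h2e d
          rwa [hzd, if_neg (by
            rintro (rfl | rfl)
            · exact hdS ⟨hwS, hbS⟩
            · exact hdS ⟨hbS, hwS⟩), add_zero, Hypermap.zmod_two_add_eq_zero] at this
        constructor
        · intro h d' hd'
          rw [hface hd' rfl, ← hd, h d rfl]
        · intro h d' hd'
          rw [hface hd' rfl, hd, h _ rfl]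
      | refl => rfl
      | symm _ _ _ ih => exact ih.symm
      | trans _ _ _ _ _ ih ih' => exact ih.trans ih'
    have := (key _ _ hsame).1 (fun d hd => by rw [hface hd rfl, h2']) t htO
    rw [hR₂t] at this
    exact zero_ne_one this

end PlaneDrawing

end StrongLabeling

/-! ### Regions bounded by one edge and angles -/

namespace StrongLabeling

namespace PlaneDrawing

variable {V : Type*} {G : SimpleGraph V} (P : PlaneDrawing G) (c : G.Coloring Shade) [Finite V]

open scoped Classical in
theorem exists_mate {R : G.Dart → ZMod 2} {x : G.Dart} (h : R x + R (P.next.symm x) ≠ 0) :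
    ∃ y, y ≠ x ∧ P.leftFace y = P.leftFace x ∧ R y + R (P.next.symm y) ≠ 0 := by
  by_contra! hcon
  have := P.face_parity R (P.leftFace x)
  rw [Finset.sum_eq_single x] at this
  · rw [if_pos rfl] at this
    exact h this
  · intro d _ hd
    split_ifs with h
    · exact hcon d hd h
    · rfl
  · simp

variable [Nontrivial V]

/-- A region whose boundary consists of angles and possibly of the edge `e`. -/
def SymmOff (e : G.Dart) (R : G.Dart → ZMod 2) : Prop :=
  ∀ d, d ≠ e → d ≠ e.symm → R d.symm = R d

theorem SymmOff.add {e : G.Dart} {R S : G.Dart → ZMod 2} (hR : SymmOff e R) (hS : SymmOff e S) :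
    SymmOff e (R + S) := fun d h h' => by
  rw [Pi.add_apply, Pi.add_apply, hR d h h', hS d h h']

theorem SymmOff.one (e : G.Dart) : SymmOff e 1 := fun _ _ _ => rfl

-- Only the edge `e` could be in the boundary, and an edge alone is not a cycle.
open scoped Classical in
theorem SymmOff.eq_zero (c : G.Coloring Shade) (hG : G.Connected) {e : G.Dart}
    {R : G.Dart → ZMod 2} (hR : SymmOff e R) (ha : ∀ d, R d + R (P.next.symm d) = 0)
    (he : R e.symm = 0) : R = 0 := by
  have hedge : R e + R e.symm = 0 := by
    have := P.vertex_parity R e.fst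
    rw [Finset.sum_eq_single e] at this
    · rwa [if_pos rfl, ha, add_zero] at this
    · intro d _ hd
      split_ifs with h
      · rw [ha, hR d hd (fun h' => e.adj.ne (by rw [← h, h']; rfl)), CharTwo.add_self_eq_zero,
          add_zero]
      · rfl
    · simp
  refine P.region_ext c hG (a := e.symm) (fun d => ?_) (fun d => by simp [ha]) he
  by_cases h : d = e
  · simp [h, hedge]
  · by_cases h' : d = e.symm
    · rw [h', SimpleGraph.Dart.symm_symm, add_comm, hedge]
      rfl
    · rw [hR d h h', CharTwo.add_self_eq_zero]
      rfl

open scoped Classical in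
/-- A region bounded by the edge `e` and two angles. -/
structure IsTriangle (e p q : G.Dart) (R : G.Dart → ZMod 2) : Prop where
  symmOff : SymmOff e R
  angle : ∀ d, R d + R (P.next.symm d) = (if d = p then 1 else 0) + (if d = q then 1 else 0)
  apply_symm : R e.symm = 1

variable {P}

theorem IsTriangle.not_within {e p q : G.Dart} {R : G.Dart → ZMod 2} (h : P.IsTriangle e p q R)
    (hpq : p.fst ≠ q.fst) : ¬ Within R p.fst ∧ ¬ Within R q.fst := by
  constructor
  · intro hW
    have h1 := h.angle p
    rw [hW p (Or.inl rfl), hW (P.next.symm p) (Or.inr (P.next_symm_snd p)), if_pos rfl,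
      if_neg (fun h => hpq (by rw [h]))] at h1
    exact absurd h1 (by decide)
  · intro hW
    have h1 := h.angle q
    rw [hW q (Or.inl rfl), hW (P.next.symm q) (Or.inr (P.next_symm_snd q)), if_pos rfl,
      if_neg (fun h => hpq (by rw [h]))] at h1
    exact absurd h1 (by decide)

variable {c} {s₀ s₁ : V}

-- The edge and the two angles form a cycle, and `R` is the side of it with the right of `e`. It is
-- not facial because the face used is not the one on the right of `e`.
open scoped Classical in
theorem TriangleRule.exists_isTriangle (hT : P.TriangleRule c s₀ s₁) (hG : G.Connected)
    {e : G.Dart} (he : c e.fst = Shade.white) {ε p q : G.Dart} (hε : ε = e ∨ ε = e.symm)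
    (hp : p.fst = ε.fst) (hq : q.fst = ε.snd) (hf : P.leftFace q = P.leftFace p)
    (hne : P.leftFace p ≠ P.leftFace e.symm) :
    ∃ R, P.IsTriangle e p q R ∧ (Within R s₀ ∨ Within R s₁) := by
  have key : ∀ p q : G.Dart, p.fst = e.fst → q.fst = e.snd → P.leftFace q = P.leftFace p →
      P.leftFace q ≠ P.leftFace e.symm →
      ∃ R, P.IsTriangle e p q R ∧ (Within R s₀ ∨ Within R s₁) := by
    intro p q hp hq hf hne
    have hs : ∀ d : G.Dart, (if d = e ∨ d = e.symm then (1 : ZMod 2) else 0) =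
        (if d = e then 1 else 0) + (if d = e.symm then 1 else 0) := by
      intro d
      by_cases h1 : d = e
      · subst h1
        simp [(SimpleGraph.Dart.symm_ne d).symm]
      · simp [h1]
    obtain ⟨R, h1, h2⟩ := P.exists_region c hG (fun d => if d = e ∨ d = e.symm then 1 else 0)
      (fun d => (if d = p then 1 else 0) + (if d = q then 1 else 0)) (by
      intro d
      have h4 : d.symm = e ↔ d = e.symm := SimpleGraph.Dart.symm_involutive.eq_iff
      have h5 : d.symm = e.symm ↔ d = e := SimpleGraph.Dart.symm_involutive.injective.eq_iff
      simp only [h4, h5]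
      rw [if_congr or_comm rfl rfl]) (by
      intro v
      simp only [hs, ite_add_zero, Finset.sum_add_distrib]
      simp only [← ite_and, and_comm (b := _ = e), and_comm (b := _ = e.symm),
        and_comm (b := _ = p), and_comm (b := _ = q)]
      simp only [ite_and, Finset.sum_ite_eq', Finset.mem_univ, if_true, hp, hq]
      exact CharTwo.add_self_eq_zero _) (by
      intro f
      simp only [ite_add_zero, Finset.sum_add_distrib]
      simp only [← ite_and, and_comm (b := _ = p), and_comm (b := _ = q)]
      simp only [ite_and, Finset.sum_ite_eq', Finset.mem_univ, if_true, hf]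
      exact CharTwo.add_self_eq_zero _)
    obtain ⟨R, h1, h2, h3⟩ : ∃ R : G.Dart → ZMod 2,
        (∀ d, R d + R d.symm = if d = e ∨ d = e.symm then 1 else 0) ∧
        (∀ d, R d + R (P.next.symm d) = (if d = p then 1 else 0) + (if d = q then 1 else 0)) ∧
        R e.symm = 1 := by
      rcases Hypermap.zmod_two_cases (R e.symm) with h | h
      · have h3 : (1 : ZMod 2) + 1 = 0 := rfl
        refine ⟨1 + R, fun d => ?_, fun d => ?_, ?_⟩
        · rw [← h1 d, Pi.add_apply, Pi.add_apply, Pi.one_apply, Pi.one_apply]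
          linear_combination h3
        · rw [← h2 d, Pi.add_apply, Pi.add_apply, Pi.one_apply, Pi.one_apply]
          linear_combination h3
        · rw [Pi.add_apply, h]
          rfl
      · exact ⟨R, h1, h2, h⟩
    refine ⟨R, ⟨fun d hd hd' => ?_, h2, h3⟩, ?_⟩
    · have := h1 d
      rw [if_neg (by tauto), Hypermap.zmod_two_add_eq_zero] at this
      exact this.symm
    · refine hT R e p q he (by rw [hp]; exact he) (by rw [hq]; exact snd_eq_black c he) h1 h2 h3 ?_
      rintro ⟨_, rfl⟩
      exact hne rfl
  rcases hε with rfl | rfl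
  · exact key p q hp hq hf (hf ▸ hne)
  · obtain ⟨R, h1, h2⟩ := key q p hq hp hf.symm hne
    exact ⟨R, ⟨h1.symmOff, fun d => (h1.angle d).trans (add_comm _ _), h1.apply_symm⟩, h2⟩

end PlaneDrawing

end StrongLabeling

/-! ### Special vertices outside regions with corners on the outer face -/

namespace StrongLabeling

namespace PlaneDrawing

variable {V : Type*} {G : SimpleGraph V} {P : PlaneDrawing G} {c : G.Coloring Shade} [Finite V]
  [Nontrivial V]

theorem angle_add (R S : G.Dart → ZMod 2) (d : G.Dart) : (R + S) d + (R + S) (P.next.symm d) =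
    (R d + R (P.next.symm d)) + (S d + S (P.next.symm d)) := by
  simp only [Pi.add_apply]
  ring

theorem angle_one (d : G.Dart) : (1 : G.Dart → ZMod 2) d + (1 : G.Dart → ZMod 2) (P.next.symm d) =
    0 := rfl

/-- Passing from `K` to `K + 1 + T` removes the angles `p` and `q` from the boundary and creates no
new ones; by `symmOff_add` it also keeps the right of `e` outside. -/
theorem IsTriangle.angle_ne_zero {e p q : G.Dart} {T K : G.Dart → ZMod 2} (h : P.IsTriangle e p q T)
    (hpq : p ≠ q) (hp : K p + K (P.next.symm p) ≠ 0) (hq : K q + K (P.next.symm q) ≠ 0) {d : G.Dart}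
    (hd : (K + 1 + T) d + (K + 1 + T) (P.next.symm d) ≠ 0) :
    d ≠ p ∧ d ≠ q ∧ K d + K (P.next.symm d) ≠ 0 := by
  have hone : ∀ {a : ZMod 2}, a ≠ 0 → a = 1 := fun {a} h =>
    (Hypermap.zmod_two_cases a).resolve_left h
  rw [angle_add, angle_add, angle_one, add_zero, h.angle] at hd
  refine ⟨?_, ?_, ?_⟩
  · rintro rfl
    rw [hone hp, if_pos rfl, if_neg hpq] at hd
    exact hd rfl
  · rintro rfl
    rw [hone hq, if_pos rfl, if_neg hpq.symm] at hd
    exact hd rfl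
  · intro h0
    rw [h0, zero_add] at hd
    by_cases hdp : d = p
    · rw [hdp] at h0
      exact hp h0
    · by_cases hdq : d = q
      · rw [hdq] at h0
        exact hq h0
      · rw [if_neg hdp, if_neg hdq] at hd
        exact hd rfl

theorem IsTriangle.symmOff_add {e p q : G.Dart} {T K : G.Dart → ZMod 2} (h : P.IsTriangle e p q T)
    (hK : SymmOff e K) (h0 : K e.symm = 0) : SymmOff e (K + 1 + T) ∧ (K + 1 + T) e.symm = 0 := by
  refine ⟨(hK.add (SymmOff.one e)).add h.symmOff, ?_⟩
  rw [Pi.add_apply, Pi.add_apply, h0, h.apply_symm]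
  rfl

-- Suppose `a ≠ b` and `a' ≠ b'`. By `h7` either `a = f`, and then `d = b`, or the same holds with
-- primes. One of these two equal pairs vanishes, so both of its counterparts are 1, although they
-- should differ.
set_option synthInstance.maxSize 1000 in
theorem zmod_two_quadrangle {a a' b b' d d' f f' : ZMod 2} (h1 : a = 1 ∨ a' = 1)
    (h2 : b = 1 ∨ b' = 1) (h3 : d = 1 ∨ d' = 1) (h4 : f = 1 ∨ f' = 1) (h5 : a + f + (d + b) = 0)
    (h6 : a' + f' + (d' + b') = 0) (h7 : a + f + (a' + f') = 1) : a + b = 0 ∨ a' + b' = 0 := by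
  revert a a' b b' d d' f f'
  decide

section Chord

variable {s₀ s₁ : V} (hD : P.DigonRule s₀ s₁) (hT : P.TriangleRule c s₀ s₁) (hG : G.Connected)
  (hne : s₀ ≠ s₁) (hadj : ¬ G.Adj s₀ s₁) (h₀ : P.OnOuterFace s₀) (h₁ : P.OnOuterFace s₁)

include hadj hne in
theorem free_of_special {ε : G.Dart} {s s' : V} (hs : (s = s₀ ∧ s' = s₁) ∨ (s = s₁ ∧ s' = s₀))
    (h : s = ε.fst ∨ s = ε.snd) : s' ≠ ε.fst ∧ s' ≠ ε.snd := by
  have h1 : s' ≠ s := by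
    rcases hs with ⟨rfl, rfl⟩ | ⟨rfl, rfl⟩
    · exact hne.symm
    · exact hne
  have h2 : ¬ G.Adj s s' := by
    rcases hs with ⟨rfl, rfl⟩ | ⟨rfl, rfl⟩
    · exact hadj
    · exact fun h => hadj h.symm
  rcases h with rfl | rfl
  · exact ⟨h1, fun h => h2 (h ▸ ε.adj)⟩
  · exact ⟨fun h => h2 (h ▸ ε.adj.symm), h1⟩

/-- Some special vertex which is not an end of `e` is outside `K`. -/
def FreeOutside (s₀ s₁ : V) (e : G.Dart) (K : G.Dart → ZMod 2) : Prop :=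
  ∃ s, (s = s₀ ∨ s = s₁) ∧ s ≠ e.fst ∧ s ≠ e.snd ∧ ∀ t : G.Dart, t.fst = s → K t = 0

theorem FreeOutside.symm {e ε : G.Dart} (hε : ε = e ∨ ε = e.symm) {K : G.Dart → ZMod 2}
    (h : FreeOutside s₀ s₁ ε K) : FreeOutside s₀ s₁ e K := by
  rcases hε with rfl | rfl
  · exact h
  · obtain ⟨s, h1, h2, h3, h4⟩ := h
    exact ⟨s, h1, h3, h2, h4⟩

include hD hT hG hne hadj h₀ h₁

/-- Two angles at an end of an edge. -/
theorem freeOutside_of_digon {e ε p q : G.Dart} (he : c e.fst = Shade.white)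
    (hε : ε = e ∨ ε = e.symm) (hp : p.fst = ε.fst) (hq : q.fst = ε.fst) (hpq : p ≠ q)
    (hfp : P.leftFace p = P.outer) (hfq : P.leftFace q = P.outer)
    (hout : P.leftFace e.symm ≠ P.outer) {K : G.Dart → ZMod 2} (hK : SymmOff e K)
    (hK0 : K e.symm = 0)
    (ha : ∀ d, K d + K (P.next.symm d) ≠ 0 ↔ d = p ∨ d = q) : FreeOutside s₀ s₁ e K := by
  classical
  have hone : ∀ {a : ZMod 2}, a ≠ 0 → a = 1 := fun {a} h =>
    (Hypermap.zmod_two_cases a).resolve_left h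
  have ha' : ∀ d, K d + K (P.next.symm d) = (if d = p then 1 else 0) + (if d = q then 1 else 0) := by
    intro d
    by_cases h : d = p
    · rw [hone ((ha d).2 (Or.inl h)), if_pos h, if_neg (fun h' => hpq (h.symm.trans h')), add_zero]
    · by_cases h' : d = q
      · rw [hone ((ha d).2 (Or.inr h')), if_pos h', if_neg h, zero_add]
      · rw [if_neg h, if_neg h', add_zero]
        by_contra hcon
        exact ((ha d).1 hcon).elim h h'
  -- If the other end of `e` is special, the digon is the sum of two triangles with a common corner
  -- there. Both contain the other special vertex, which is therefore not in `K`.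
  by_cases hsp : ∃ s s', ((s = s₀ ∧ s' = s₁) ∨ (s = s₁ ∧ s' = s₀)) ∧ s = ε.snd
  · obtain ⟨s, s', hss, hs⟩ := hsp
    obtain ⟨hf1, hf2⟩ := free_of_special hne hadj hss (Or.inr hs)
    have hsO : P.OnOuterFace s := by
      rcases hss with ⟨rfl, _⟩ | ⟨rfl, _⟩ <;> assumption
    obtain ⟨β, hβ, hfβ⟩ := P.exists_dart_of_onOuterFace hG hsO
    have hpβ : ∀ {x : G.Dart}, x.fst = ε.fst → P.leftFace x = P.outer →
        ∃ T, P.IsTriangle e x β T ∧ Within T s' := by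
      intro x hx hfx
      obtain ⟨T, h1, h2⟩ := hT.exists_isTriangle hG he hε hx (hβ.trans hs) (hfβ.trans hfx.symm)
        (by rw [hfx]; exact hout.symm)
      refine ⟨T, h1, ?_⟩
      have h3 := (h1.not_within (by rw [hx, hβ, hs]; exact ε.adj.ne)).2
      rw [hβ] at h3
      rcases hss with ⟨rfl, rfl⟩ | ⟨rfl, rfl⟩
      · exact h2.resolve_left h3
      · exact h2.resolve_right h3
    obtain ⟨T, hT1, hT2⟩ := hpβ hp hfp
    obtain ⟨S, hS1, hS2⟩ := hpβ hq hfq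
    have hzero : K + (T + S) = 0 := by
      refine SymmOff.eq_zero P c hG (hK.add (hT1.symmOff.add hS1.symmOff)) (fun d => ?_) ?_
      · rw [angle_add, angle_add, ha', hT1.angle, hS1.angle]
        have e1 := CharTwo.add_self_eq_zero (if d = p then (1 : ZMod 2) else 0)
        have e2 := CharTwo.add_self_eq_zero (if d = q then (1 : ZMod 2) else 0)
        have e3 := CharTwo.add_self_eq_zero (if d = β then (1 : ZMod 2) else 0)
        linear_combination e1 + e2 + e3
      · rw [Pi.add_apply, Pi.add_apply, hK0, hT1.apply_symm, hS1.apply_symm]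
        rfl
    refine FreeOutside.symm hε ⟨s', ?_, hf1, hf2, ?_⟩
    · rcases hss with ⟨_, rfl⟩ | ⟨_, rfl⟩ <;> simp
    · intro t ht
      have := congrFun hzero t
      have h3 : (1 : ZMod 2) + 1 = 0 := rfl
      rwa [Pi.add_apply, Pi.add_apply, hT2 t (Or.inl ht), hS2 t (Or.inl ht), h3, add_zero] at this
  -- Otherwise `K` is a genuine digon and the digon rule applies to its complement.
  · obtain ⟨D, hD1, hD2⟩ := P.exists_digon c hG (x := p) (y := q) (hq.trans hp.symm)
      (hfq.trans hfp.symm)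
    obtain ⟨D, hD1, hD2, hD3⟩ : ∃ D : G.Dart → ZMod 2, (∀ d, D d.symm = D d) ∧
        (∀ d, D d + D (P.next.symm d) = (if d = p then 1 else 0) + (if d = q then 1 else 0)) ∧
        D e.symm = 0 := by
      rcases Hypermap.zmod_two_cases (D e.symm) with h | h
      · exact ⟨D, hD1, hD2, h⟩
      · refine ⟨D + 1, fun d => ?_, fun d => ?_, ?_⟩
        · rw [Pi.add_apply, Pi.add_apply, hD1]
          rfl
        · rw [angle_add, hD2, angle_one, add_zero]
        · rw [Pi.add_apply, h]
          rfl
    have hzero : K + D = 0 := by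
      refine SymmOff.eq_zero P c hG (hK.add fun d _ _ => hD1 d) (fun d => ?_) ?_
      · rw [angle_add, ha', hD2]
        exact CharTwo.add_self_eq_zero _
      · rw [Pi.add_apply, hK0, hD3, add_zero]
    have hKs : ∀ d, (K + 1) d.symm = (K + 1) d := by
      intro d
      have h1 := congrFun hzero d
      have h2 := congrFun hzero d.symm
      rw [Pi.add_apply, Pi.zero_apply] at h1 h2
      rw [Pi.add_apply, Pi.add_apply]
      simp only [Pi.one_apply]
      linear_combination h2 - h1 - hD1 d
    have hW := hD (K + 1) p q hpq hKs (fun d => by rw [angle_add, angle_one, add_zero, ha'])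
    obtain ⟨s, hs, hWs⟩ : ∃ s, (s = s₀ ∨ s = s₁) ∧ Within (K + 1) s := by
      rcases hW with h | h
      · exact ⟨_, Or.inl rfl, h⟩
      · exact ⟨_, Or.inr rfl, h⟩
    refine FreeOutside.symm hε ⟨s, hs, ?_, ?_, ?_⟩
    · rintro rfl
      have h1 := ha' p
      have h2 := hWs p (Or.inl hp)
      have h3 := hWs (P.next.symm p) (Or.inr ((P.next_symm_snd p).trans hp))
      rw [Pi.add_apply, Pi.one_apply, add_eq_right] at h2 h3
      rw [h2, h3, if_pos rfl, if_neg hpq] at h1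
      exact absurd h1 (by decide)
    · intro h
      apply hsp
      rcases hs with rfl | rfl
      · exact ⟨_, _, Or.inl ⟨rfl, rfl⟩, h⟩
      · exact ⟨_, _, Or.inr ⟨rfl, rfl⟩, h⟩
    · intro t ht
      have h2 := hWs t (Or.inl ht)
      rwa [Pi.add_apply, Pi.one_apply, add_eq_right] at h2

/-- Two angles at each end of an edge. -/
theorem freeOutside_of_quadrangle {e ε p q r u : G.Dart} (he : c e.fst = Shade.white)
    (hε : ε = e ∨ ε = e.symm) (hp : p.fst = ε.fst) (hr : r.fst = ε.fst) (hpr : p ≠ r)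
    (hq : q.fst = ε.snd) (hu : u.fst = ε.snd)
    (hfp : P.leftFace p = P.outer) (hfq : P.leftFace q = P.outer)
    (hfr : P.leftFace r = P.outer) (hfu : P.leftFace u = P.outer)
    (hout : P.leftFace e.symm ≠ P.outer) {K T T' : G.Dart → ZMod 2}
    (hpq : P.IsTriangle e p q T) (hW : Within T s₀ ∨ Within T s₁) (hru : P.IsTriangle e r u T')
    (hW' : Within T' s₀ ∨ Within T' s₁) (hK : K = T + T') : FreeOutside s₀ s₁ e K := by
  classical
  have htri : ∀ {x y : G.Dart}, x.fst = ε.fst → y.fst = ε.snd → P.leftFace x = P.outer →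
      P.leftFace y = P.outer → ∃ T, P.IsTriangle e x y T ∧ (Within T s₀ ∨ Within T s₁) := by
    intro x y hx hy hfx hfy
    exact hT.exists_isTriangle hG he hε hx hy (hfy.trans hfx.symm) (by rw [hfx]; exact hout.symm)
  have hnot : ∀ {x y : G.Dart} {T : G.Dart → ZMod 2}, x.fst = ε.fst → y.fst = ε.snd → P.IsTriangle e x y T →
      ¬ Within T ε.fst ∧ ¬ Within T ε.snd := by
    intro x y T hx hy hxy
    have := hxy.not_within (by rw [hx, hy]; exact ε.adj.ne)
    rwa [hx, hy] at this
  refine FreeOutside.symm hε ?_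
  -- If an end of `e` is special, both triangles contain the other special vertex, and it drops out
  -- of their sum.
  by_cases hsp : ∃ s s', ((s = s₀ ∧ s' = s₁) ∨ (s = s₁ ∧ s' = s₀)) ∧ (s = ε.fst ∨ s = ε.snd)
  · obtain ⟨s, s', hss, hs⟩ := hsp
    obtain ⟨hf1, hf2⟩ := free_of_special hne hadj hss hs
    have hW2 : ∀ {T : G.Dart → ZMod 2}, (Within T s₀ ∨ Within T s₁) → (¬ Within T ε.fst ∧ ¬ Within T ε.snd) →
        Within T s' := by
      intro T hT1 hT2
      have h3 : ¬ Within T s := by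
        rcases hs with rfl | rfl
        · exact hT2.1
        · exact hT2.2
      rcases hss with ⟨rfl, rfl⟩ | ⟨rfl, rfl⟩
      · exact hT1.resolve_left h3
      · exact hT1.resolve_right h3
    refine ⟨s', ?_, hf1, hf2, ?_⟩
    · rcases hss with ⟨_, rfl⟩ | ⟨_, rfl⟩ <;> simp
    · intro t ht
      rw [hK, Pi.add_apply, hW2 hW (hnot hp hq hpq) t (Or.inl ht),
        hW2 hW' (hnot hr hu hru) t (Or.inl ht)]
      rfl
  -- The crossed pairings of the four angles give two more triangles. The four sum to zero, and `T +
  -- S'` is a digon up to complement, so it separates the special vertices.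
  · obtain ⟨S, hS1, hS2⟩ := htri hp hu hfp hfu
    obtain ⟨S', hS1', hS2'⟩ := htri hr hq hfr hfq
    obtain ⟨t₀, ht₀⟩ := exists_dart hG s₀
    obtain ⟨t₁, ht₁⟩ := exists_dart hG s₁
    have hzero : (T + S') + (S + T') = 0 := by
      refine SymmOff.eq_zero P c hG ((hpq.symmOff.add hS1'.symmOff).add
        (hS1.symmOff.add hru.symmOff)) (fun d => ?_) ?_
      · rw [angle_add, angle_add, angle_add, hpq.angle, hS1'.angle, hS1.angle, hru.angle]
        have e1 := CharTwo.add_self_eq_zero (if d = p then (1 : ZMod 2) else 0)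
        have e2 := CharTwo.add_self_eq_zero (if d = q then (1 : ZMod 2) else 0)
        have e3 := CharTwo.add_self_eq_zero (if d = r then (1 : ZMod 2) else 0)
        have e4 := CharTwo.add_self_eq_zero (if d = u then (1 : ZMod 2) else 0)
        linear_combination e1 + e2 + e3 + e4
      · simp only [Pi.add_apply, hpq.apply_symm, hru.apply_symm, hS1.apply_symm, hS1'.apply_symm]
        rfl
    obtain ⟨D, hD1, hD2⟩ := P.exists_digon c hG (x := p) (y := r) (hr.trans hp.symm)
      (hfr.trans hfp.symm)
    have hsum : T t₀ + S' t₀ + (T t₁ + S' t₁) = 1 := by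
      have hdig := hD.apply_add_apply ht₀ ht₁ hpr hD1 hD2
      have hang : ∀ d, (T + S' + D) d + (T + S' + D) (P.next.symm d) = 0 := by
        intro d
        rw [angle_add, angle_add, hpq.angle, hS1'.angle, hD2]
        have e1 := CharTwo.add_self_eq_zero (if d = p then (1 : ZMod 2) else 0)
        have e2 := CharTwo.add_self_eq_zero (if d = q then (1 : ZMod 2) else 0)
        have e3 := CharTwo.add_self_eq_zero (if d = r then (1 : ZMod 2) else 0)
        linear_combination e1 + e2 + e3
      have hoff : SymmOff e (T + S' + D) :=
        (hpq.symmOff.add hS1'.symmOff).add fun d _ _ => hD1 d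
      have hcst : ∀ t, (T + S' + D) t = (T + S' + D) e.symm := by
        rcases Hypermap.zmod_two_cases ((T + S' + D) e.symm) with h | h
        · intro t
          rw [h, SymmOff.eq_zero P c hG hoff hang h]
          rfl
        · have h2 := SymmOff.eq_zero P c hG (hoff.add (SymmOff.one e))
            (fun d => by rw [angle_add, hang, angle_one, add_zero]) (by
              rw [Pi.add_apply, h]
              rfl)
          intro t
          have h3 := congrFun h2 t
          rw [Pi.add_apply, Pi.one_apply, Pi.zero_apply, Hypermap.zmod_two_add_eq_zero] at h3
          rw [h3, h]
      have h1 := hcst t₀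
      rw [← hcst t₁] at h1
      simp only [Pi.add_apply] at h1
      generalize T t₀ = a at *
      generalize T t₁ = a' at *
      generalize S' t₀ = b at *
      generalize S' t₁ = b' at *
      generalize D t₀ = d at *
      generalize D t₁ = d' at *
      clear * - h1 hdig
      revert h1 hdig
      revert a a' b b' d d'
      decide
    have hval : ∀ {T : G.Dart → ZMod 2}, (Within T s₀ ∨ Within T s₁) → T t₀ = 1 ∨ T t₁ = 1 :=
      fun h => h.imp (fun h => h t₀ (Or.inl ht₀)) (fun h => h t₁ (Or.inl ht₁))
    have hfin : K t₀ = 0 ∨ K t₁ = 0 := by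
      have z0 := congrFun hzero t₀
      have z1 := congrFun hzero t₁
      have v1 := hval hW
      have v2 := hval hW'
      have v3 := hval hS2
      have v4 := hval hS2'
      rw [hK]
      simp only [Pi.add_apply, Pi.zero_apply] at z0 z1 ⊢
      exact zmod_two_quadrangle v1 v2 v3 v4 z0 z1 hsum
    have hKconst : ∀ {s}, s ≠ ε.fst → s ≠ ε.snd → ∀ t t' : G.Dart, t.fst = s → t'.fst = s →
        K t' = K t := by
      intro s hs hs' t t' ht ht'
      refine P.eq_of_rot_invariant (fun d hd => ?_) ht' ht
      have h1 : K d + K (P.next.symm d) = 0 := by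
        rw [hK, angle_add, hpq.angle, hru.angle, if_neg (fun h => hs (by rw [← hd, h, hp])),
          if_neg (fun h => hs' (by rw [← hd, h, hq])), if_neg (fun h => hs (by rw [← hd, h, hr])),
          if_neg (fun h => hs' (by rw [← hd, h, hu]))]
        rfl
      have h2 : (P.rot d).fst = s := (P.rot_fst d).trans hd
      have h3 : SymmOff e K := hK ▸ hpq.symmOff.add hru.symmOff
      rw [Hypermap.zmod_two_add_eq_zero, next_symm_apply, h3] at h1
      · exact h1.symm
      · rintro h
        rcases hε with rfl | rfl
        · exact hs (by rw [← h2, h])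
        · exact hs' (by rw [← h2, h]; rfl)
      · rintro h
        rcases hε with rfl | rfl
        · exact hs' (by rw [← h2, h]; rfl)
        · exact hs (by rw [← h2, h])
    have hfree : ∀ s s', ((s = s₀ ∧ s' = s₁) ∨ (s = s₁ ∧ s' = s₀)) → s ≠ ε.fst ∧ s ≠ ε.snd :=
      fun s s' h => ⟨fun h' => hsp ⟨s, s', h, Or.inl h'⟩, fun h' => hsp ⟨s, s', h, Or.inr h'⟩⟩
    rcases hfin with h | h
    · obtain ⟨hf1, hf2⟩ := hfree s₀ s₁ (Or.inl ⟨rfl, rfl⟩)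
      exact ⟨s₀, Or.inl rfl, hf1, hf2, fun t ht => by rw [hKconst hf1 hf2 t₀ t ht₀ ht, h]⟩
    · obtain ⟨hf1, hf2⟩ := hfree s₁ s₀ (Or.inr ⟨rfl, rfl⟩)
      exact ⟨s₁, Or.inr rfl, hf1, hf2, fun t ht => by rw [hKconst hf1 hf2 t₁ t ht₁ ht, h]⟩

end Chord

end PlaneDrawing

end StrongLabeling

/-! ### No block with a right chord when the two rules hold -/

namespace StrongLabeling

namespace PlaneDrawing

variable {V : Type*} {G : SimpleGraph V} {P : PlaneDrawing G} {c : G.Coloring Shade} [Finite V]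
  [Nontrivial V]

section Chord

variable {s₀ s₁ : V} (hD : P.DigonRule s₀ s₁) (hT : P.TriangleRule c s₀ s₁) (hG : G.Connected)
  (hne : s₀ ≠ s₁) (hadj : ¬ G.Adj s₀ s₁) (h₀ : P.OnOuterFace s₀) (h₁ : P.OnOuterFace s₁)

include hD hT hG hne hadj h₀ h₁

/-- By `DigonRule.not_three` there are at most two angles at each end of `e`. By parity the boundary
has no angle, two at one end, one at each end, or two at each end. -/
theorem freeOutside_of_outer {e : G.Dart} (he : c e.fst = Shade.white)
    (hout : P.leftFace e.symm ≠ P.outer) {K : G.Dart → ZMod 2} (hK : SymmOff e K)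
    (hK0 : K e.symm = 0)
    (ha : ∀ d, K d + K (P.next.symm d) ≠ 0 → (d.fst = e.fst ∨ d.fst = e.snd) ∧
      P.leftFace d = P.outer) : FreeOutside s₀ s₁ e K := by
  classical
  have hone : ∀ {a : ZMod 2}, a ≠ 0 → a = 1 := fun {a} h =>
    (Hypermap.zmod_two_cases a).resolve_left h
  have htwo : ∀ {a b : ZMod 2}, a + 1 + b = 0 → a = 1 + b := by decide
  by_cases hex : ∃ p, K p + K (P.next.symm p) ≠ 0
  swap
  · push Not at hex
    have hzero := SymmOff.eq_zero P c hG hK hex hK0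
    rw [hzero]
    by_cases h : s₀ = e.fst ∨ s₀ = e.snd
    · obtain ⟨hf1, hf2⟩ := free_of_special hne hadj (Or.inl ⟨rfl, rfl⟩) h
      exact ⟨s₁, Or.inr rfl, hf1, hf2, fun _ _ => rfl⟩
    · exact ⟨s₀, Or.inl rfl, fun h' => h (Or.inl h'), fun h' => h (Or.inr h'), fun _ _ => rfl⟩
  obtain ⟨p, hp⟩ := hex
  obtain ⟨ε, hε, hpε⟩ : ∃ ε : G.Dart, (ε = e ∨ ε = e.symm) ∧ p.fst = ε.fst := by
    rcases (ha p hp).1 with h | h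
    · exact ⟨e, Or.inl rfl, h⟩
    · exact ⟨e.symm, Or.inr rfl, h⟩
  have hfst : ∀ d, K d + K (P.next.symm d) ≠ 0 → d.fst = ε.fst ∨ d.fst = ε.snd := by
    intro d hd
    rcases hε with rfl | rfl
    · exact (ha d hd).1
    · exact (ha d hd).1.symm
  have hthree : ∀ {x y z}, x.fst = y.fst → x.fst = z.fst → K x + K (P.next.symm x) ≠ 0 →
      K y + K (P.next.symm y) ≠ 0 → K z + K (P.next.symm z) ≠ 0 → x ≠ y → y ≠ z → x ≠ z →
      False := by
    intro x y z hxy hxz hx hy hz h1 h2 h3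
    exact hD.not_three c hG h1 h2 h3 hxy.symm hxz.symm ((ha y hy).2.trans (ha x hx).2.symm)
      ((ha z hz).2.trans (ha x hx).2.symm)
  by_cases hq : ∃ q, K q + K (P.next.symm q) ≠ 0 ∧ q.fst = ε.snd
  swap
  · obtain ⟨q, hqp, hfq, hq'⟩ := P.exists_mate hp
    have hfst' : ∀ d, K d + K (P.next.symm d) ≠ 0 → d.fst = ε.fst :=
      fun d hd => (hfst d hd).resolve_right fun h => hq ⟨d, hd, h⟩
    refine freeOutside_of_digon hD hT hG hne hadj h₀ h₁ he hε hpε (hfst' q hq') hqp.symm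
      (ha p hp).2 (ha q hq').2 hout hK hK0 fun d => ⟨fun hd => ?_, ?_⟩
    · by_contra! hcon
      exact hthree (hpε.trans (hfst' q hq').symm) (hpε.trans (hfst' d hd).symm) hp hq' hd hqp.symm
        (Ne.symm hcon.2) (Ne.symm hcon.1)
    · rintro (rfl | rfl) <;> assumption
  · obtain ⟨q, hq, hqε⟩ := hq
    have key : ∀ {ε p q r : G.Dart}, (ε = e ∨ ε = e.symm) → p.fst = ε.fst → q.fst = ε.snd →
        r.fst = ε.fst → (∀ d, K d + K (P.next.symm d) ≠ 0 → d.fst = ε.fst ∨ d.fst = ε.snd) →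
        K p + K (P.next.symm p) ≠ 0 → K q + K (P.next.symm q) ≠ 0 → ∀ {T}, P.IsTriangle e p q T →
        (Within T s₀ ∨ Within T s₁) → (K + 1 + T) r + (K + 1 + T) (P.next.symm r) ≠ 0 →
        FreeOutside s₀ s₁ e K := by
      intro ε p q r hε hpε hqε hrε hfst hp hq T hT1 hT2 hr
      have hpq : p ≠ q := fun h => ε.adj.ne (by rw [← hpε, ← hqε, h])
      -- After removing `p` and `q`, the angle `r` needs a mate in its face. It must be at the other
      -- end, as there is already a second angle besides `r` at this one.
      obtain ⟨u, hur, hfu, hu⟩ := P.exists_mate hr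
      obtain ⟨hrp, hrq, hr'⟩ := hT1.angle_ne_zero hpq hp hq hr
      obtain ⟨hup, huq, hu'⟩ := hT1.angle_ne_zero hpq hp hq hu
      have huε : u.fst = ε.snd := (hfst u hu').resolve_left fun h =>
        hthree (hpε.trans hrε.symm) (hpε.trans h.symm) hp hr' hu' hrp.symm hur.symm hup.symm
      obtain ⟨S, hS1, hS2⟩ := hT.exists_isTriangle hG he hε hrε huε hfu
        (by rw [(ha r hr').2]; exact hout.symm)
      obtain ⟨hoff, hoff0⟩ := hT1.symmOff_add hK hK0
      obtain ⟨hoff', hoff0'⟩ := hS1.symmOff_add hoff hoff0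
      have hzero := SymmOff.eq_zero P c hG hoff' (fun d => by
        by_contra hd
        obtain ⟨hdr, hdu, hd'⟩ := hS1.angle_ne_zero hur.symm hr hu hd
        obtain ⟨hdp, hdq, hd''⟩ := hT1.angle_ne_zero hpq hp hq hd'
        rcases hfst d hd'' with h | h
        · exact hthree (hpε.trans hrε.symm) (hpε.trans h.symm) hp hr' hd'' hrp.symm hdr.symm
            hdp.symm
        · exact hthree (hqε.trans huε.symm) (hqε.trans h.symm) hq hu' hd'' huq.symm hdu.symm
            hdq.symm) hoff0'
      refine freeOutside_of_quadrangle hD hT hG hne hadj h₀ h₁ he hε hpε hrε hrp.symm hqε huε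
        (ha p hp).2 (ha q hq).2 (ha r hr').2 (ha u hu').2 hout hT1 hT2 hS1 hS2 ?_
      ext d
      have := congrFun hzero d
      simp only [Pi.add_apply, Pi.one_apply, Pi.zero_apply] at this ⊢
      generalize K d = k at *
      generalize T d = t at *
      generalize S d = s at *
      clear * - this
      revert this
      revert k t s
      decide
    obtain ⟨T, hT1, hT2⟩ := hT.exists_isTriangle hG he hε hpε hqε
      ((ha q hq).2.trans (ha p hp).2.symm) (by rw [(ha p hp).2]; exact hout.symm)
    by_cases hr : ∃ r, (K + 1 + T) r + (K + 1 + T) (P.next.symm r) ≠ 0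
    · obtain ⟨r, hr⟩ := hr
      have hpq : p ≠ q := fun h => ε.adj.ne (by rw [← hpε, ← hqε, h])
      rcases hfst r (hT1.angle_ne_zero hpq hp hq hr).2.2 with h | h
      · exact key hε hpε hqε h hfst hp hq hT1 hT2 hr
      · have hε' : ε.symm = e ∨ ε.symm = e.symm := by
          rcases hε with rfl | rfl
          · exact Or.inr rfl
          · exact Or.inl (SimpleGraph.Dart.symm_symm _)
        exact key (ε := ε.symm) hε' hqε hpε h (fun d hd => (hfst d hd).symm) hq hp
          ⟨hT1.symmOff, fun d => (hT1.angle d).trans (add_comm _ _), hT1.apply_symm⟩ hT2 hr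
    · push Not at hr
      obtain ⟨hoff, hoff0⟩ := hT1.symmOff_add hK hK0
      have hzero := SymmOff.eq_zero P c hG hoff hr hoff0
      obtain ⟨hW1, hW2⟩ := hT1.not_within (by rw [hpε, hqε]; exact ε.adj.ne)
      rw [hpε] at hW1
      rw [hqε] at hW2
      obtain ⟨s, hs, hWs⟩ : ∃ s, (s = s₀ ∨ s = s₁) ∧ Within T s := by
        rcases hT2 with h | h
        · exact ⟨_, Or.inl rfl, h⟩
        · exact ⟨_, Or.inr rfl, h⟩
      refine FreeOutside.symm hε ⟨s, hs, ?_, ?_, ?_⟩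
      · rintro rfl
        exact hW1 hWs
      · rintro rfl
        exact hW2 hWs
      · intro t ht
        have := congrFun hzero t
        simp only [Pi.add_apply, Pi.one_apply, hWs t (Or.inl ht), Pi.zero_apply] at this
        rw [htwo this]
        rfl

/-- Induction on the number of boundary angles. Two of them in a face other than the outer one are
at different ends of `e`, and `K + 1 + T` gets rid of them, where `T` is their triangle. This does
not change `K` on the outer face, which lies in `T`. -/
theorem exists_free_apply_eq_zero {e : G.Dart} (he : c e.fst = Shade.white)
    (hout : P.leftFace e.symm ≠ P.outer) {K : G.Dart → ZMod 2} (hK : SymmOff e K)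
    (hK0 : K e.symm = 0)
    (ha : ∀ d, K d + K (P.next.symm d) ≠ 0 → (d.fst = e.fst ∨ d.fst = e.snd) ∧
      P.leftFace d ≠ P.leftFace e.symm) :
    ∃ t : G.Dart, P.leftFace t = P.outer ∧ (t.fst = s₀ ∨ t.fst = s₁) ∧ t.fst ≠ e.fst ∧
      t.fst ≠ e.snd ∧ K t = 0 := by
  classical
  induction hn : (Finset.univ.filter fun d => K d + K (P.next.symm d) ≠ 0).card using
    Nat.strong_induction_on generalizing K with
  | _ n ih =>
  by_cases hall : ∀ d, K d + K (P.next.symm d) ≠ 0 → P.leftFace d = P.outer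
  · obtain ⟨s, hs, hs1, hs2, hs3⟩ := freeOutside_of_outer hD hT hG hne hadj h₀ h₁ he hout hK hK0
      (fun d hd => ⟨(ha d hd).1, hall d hd⟩)
    have hsO : P.OnOuterFace s := by rcases hs with rfl | rfl <;> assumption
    obtain ⟨t, ht, hft⟩ := P.exists_dart_of_onOuterFace hG hsO
    subst ht
    exact ⟨t, hft, hs, hs1, hs2, hs3 t rfl⟩
  · push Not at hall
    obtain ⟨p, hp, hfp⟩ := hall
    obtain ⟨q, hqp, hfq, hq⟩ := P.exists_mate hp
    obtain ⟨ε, hε, hpε, hqε⟩ : ∃ ε : G.Dart, (ε = e ∨ ε = e.symm) ∧ p.fst = ε.fst ∧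
        q.fst = ε.snd := by
      have hpq : q.fst ≠ p.fst := fun h =>
        hfp (hD.leftFace_eq c hG h₀ h₁ hqp.symm h hfq)
      rcases (ha p hp).1 with h | h <;> rcases (ha q hq).1 with h' | h'
      · exact absurd (h'.trans h.symm) hpq
      · exact ⟨e, Or.inl rfl, h, h'⟩
      · exact ⟨e.symm, Or.inr rfl, h, h'⟩
      · exact absurd (h'.trans h.symm) hpq
    obtain ⟨T, hT1, hT2⟩ := hT.exists_isTriangle hG he hε hpε hqε hfq (ha p hp).2
    obtain ⟨hoff, hoff0⟩ := hT1.symmOff_add hK hK0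
    obtain ⟨t, htO, hts, ht1, ht2, ht3⟩ := ih _ (by
      rw [← hn]
      refine Finset.card_lt_card ⟨fun d hd => ?_, fun h => ?_⟩
      · simp only [Finset.mem_filter, Finset.mem_univ, true_and] at hd ⊢
        exact (hT1.angle_ne_zero hqp.symm hp hq hd).2.2
      · have := h (Finset.mem_filter.2 ⟨Finset.mem_univ p, hp⟩)
        exact (hT1.angle_ne_zero hqp.symm hp hq (Finset.mem_filter.1 this).2).1 rfl)
      hoff hoff0 (fun d hd => ha d (hT1.angle_ne_zero hqp.symm hp hq hd).2.2) rfl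
    refine ⟨t, htO, hts, ht1, ht2, ?_⟩
    obtain ⟨s, hsO, hWs⟩ : ∃ s, P.OnOuterFace s ∧ Within T s := by
      rcases hT2 with h | h
      · exact ⟨_, h₀, h⟩
      · exact ⟨_, h₁, h⟩
    obtain ⟨t', ht', hft'⟩ := P.exists_dart_of_onOuterFace hG hsO
    -- `T` has no corner in the outer face, so it is constant there, with value 1 because it
    -- contains a special vertex.
    have hTt : T t = T t' := by
      refine P.eq_of_next_invariant c hG (fun d hd => ?_) htO hft'
      have hd' := (P.leftFace_next d).trans hd
      have := hT1.angle (P.next d)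
      rw [if_neg (fun h => hfp (by rw [← h, hd'])),
        if_neg (fun h => hfp (by rw [← hfq, ← h, hd'])), Equiv.symm_apply_apply, add_zero,
        Hypermap.zmod_two_add_eq_zero] at this
      exact this
    rw [Pi.add_apply, Pi.add_apply, Pi.one_apply, hTt, hWs t' (Or.inl ht')] at ht3
    have htwo : ∀ {a : ZMod 2}, a + 1 + 1 = 0 → a = 0 := by decide
    exact htwo ht3

/-- Let `K` consist of the triangles that do not touch `C` and are in faces not separated from the
outer face by the block. Its boundary is `e` at most and angles at the ends of `e`, so
`exists_free_apply_eq_zero` gives a place on the outer face, at a special vertex, that is not in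
`K`. But `K` contains it. -/
theorem not_hasBlockWithRightChord : ¬ P.HasBlockWithRightChord c s₀ s₁ := by
  classical
  rintro ⟨d, hdb, hdw, C', hCs, hsame⟩
  obtain ⟨e, rfl⟩ : ∃ e : G.Dart, d = e.symm := ⟨d.symm, (SimpleGraph.Dart.symm_symm d).symm⟩
  set C : Set V := Subtype.val '' C'.supp with hC
  set S : Set V := C ∪ {e.symm.fst, e.symm.snd} with hS
  have he : c e.fst = Shade.white := hdw
  have hnot : ∀ {v}, v ∈ C → v ≠ e.fst ∧ v ≠ e.snd := by
    rintro _ ⟨⟨v, hv⟩, _, rfl⟩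
    exact ⟨fun h => hv (Or.inr h), fun h => hv (Or.inl h)⟩
  have hclosed : ∀ {a b}, a ∈ C → G.Adj a b → b ≠ e.fst → b ≠ e.snd → b ∈ C := by
    rintro _ b ⟨⟨a, ha⟩, haK, rfl⟩ hab hw hb
    refine ⟨⟨b, fun h => h.elim hb hw⟩, ?_, rfl⟩
    exact SimpleGraph.ConnectedComponent.mem_supp_of_adj_mem_supp _ haK (by exact hab)
  have hs₀ : s₀ ∉ C := by
    rintro ⟨x, hx, h⟩
    exact (hCs x hx).1 h
  have hs₁ : s₁ ∉ C := by
    rintro ⟨x, hx, h⟩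
    exact (hCs x hx).2 h
  let p : P.Face → Prop := fun f => P.SameFaceOfInduced S f P.outer
  set K : G.Dart → ZMod 2 := fun d => if p (P.leftFace d) ∧ d.fst ∉ C ∧ d.snd ∉ C then 1 else 0
    with hKdef
  have hinS : ∀ d : G.Dart, d.fst ∉ C → d.snd ∉ C → d.fst ∈ S → d.snd ∈ S → d = e ∨ d = e.symm := by
    intro d h1 h2 h3 h4
    have h5 := h3.resolve_left h1
    have h6 := h4.resolve_left h2
    rcases h5 with h5 | h5 <;> rcases h6 with h6 | h6
    · exact absurd (h5.trans h6.symm) d.adj.ne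
    · exact Or.inr (SimpleGraph.Dart.ext _ _ (Prod.ext h5 h6))
    · exact Or.inl (SimpleGraph.Dart.ext _ _ (Prod.ext h5 h6))
    · exact absurd (h5.trans h6.symm) d.adj.ne
  have hK : SymmOff e K := by
    intro d hde hde'
    by_cases hd : d.fst ∈ C ∨ d.snd ∈ C
    · simp only [hKdef]
      rw [if_neg (fun h => hd.elim h.2.2 h.2.1), if_neg (fun h => hd.elim h.2.1 h.2.2)]
    · push Not at hd
      have hrel : P.SameFaceOfInduced S (P.leftFace d) (P.leftFace d.symm) :=
        Relation.EqvGen.rel _ _ ⟨d, fun h => (hinS d hd.1 hd.2 h.1 h.2).elim hde hde', rfl, rfl⟩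
      simp only [hKdef, p]
      refine if_congr ?_ rfl rfl
      constructor
      · rintro ⟨h1, h2, h3⟩
        exact ⟨Relation.EqvGen.trans _ _ _ hrel h1, h3, h2⟩
      · rintro ⟨h1, h2, h3⟩
        exact ⟨Relation.EqvGen.trans _ _ _ (Relation.EqvGen.symm _ _ hrel) h1, h3, h2⟩
  have hout : P.leftFace e.symm ≠ P.outer := fun h => hsame (by rw [h]; exact Relation.EqvGen.refl _)
  obtain ⟨t, htO, hts, ht1, ht2, ht3⟩ := exists_free_apply_eq_zero hD hT hG hne hadj h₀ h₁ he hout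
    hK (if_neg fun h => hsame h.1) (by
    intro d hd
    have hex : d.fst = e.fst ∨ d.fst = e.snd := by
      by_contra! hcon
      apply hd
      have h1 : (P.next.symm d).snd = d.fst := P.next_symm_snd d
      have htouch : ∀ x : G.Dart, (x.fst = d.fst ∨ x.snd = d.fst) →
          ((x.fst ∉ C ∧ x.snd ∉ C) ↔ d.fst ∉ C) := by
        rintro x (hx | hx)
        · rw [hx]
          exact ⟨fun h => h.1, fun h => ⟨h, fun h' => h (by
            rw [← hx] at hcon ⊢
            exact hclosed h' x.adj.symm hcon.1 hcon.2)⟩⟩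
        · rw [hx]
          exact ⟨fun h => h.2, fun h => ⟨fun h' => h (by
            rw [← hx] at hcon ⊢
            exact hclosed h' x.adj hcon.1 hcon.2), h⟩⟩
      simp only [hKdef, P.leftFace_next_symm, htouch _ (Or.inl rfl), htouch _ (Or.inr h1)]
      exact CharTwo.add_self_eq_zero _
    refine ⟨hex, fun h => hd ?_⟩
    simp only [hKdef, P.leftFace_next_symm, h]
    rw [if_neg (fun h => hsame h.1), if_neg (fun h => hsame h.1)]
    rfl)
  have htC : t.fst ∉ C := by rcases hts with h | h <;> rw [h] <;> assumption
  have : K t = 1 := by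
    refine if_pos ⟨by rw [htO]; exact Relation.EqvGen.refl _, htC, fun h => htC ?_⟩
    exact hclosed h t.adj.symm ht1 ht2
  rw [ht3] at this
  exact zero_ne_one this

end Chord

end PlaneDrawing

end StrongLabeling

/-! ### Changes along a cycle, and the vertex rule -/

namespace StrongLabeling

namespace PlaneDrawing

open scoped Classical in
/-- Along a cycle with exactly two changes, there is one change of each kind. -/
theorem existsUnique_change {α : Type*} [Fintype α] {π : Equiv.Perm α} {p : α → Prop}
    (hp : ∀ a, p a → p (π a)) (hc : ∀ a b, p a → p b → π.SameCycle a b) {g : α → ZMod 2}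
    (hg : (Finset.univ.filter fun x => p x ∧ g x ≠ g (π x)).card = 2) (a : ZMod 2) :
    ∃! x, p x ∧ g x = a ∧ g (π x) = a + 1 := by
  have hne : ∀ {a b : ZMod 2}, a ≠ b → b = a + 1 := by decide
  have hne' : ∀ {a b : ZMod 2}, a ≠ b → a = b + 1 := by decide
  have hone : ∀ {a : ZMod 2}, a ≠ a + 1 := by decide
  have htwo : ∀ {a : ZMod 2}, a = a + 1 + 1 := by decide
  have hex : ∀ a, ∃ x, p x ∧ g x = a ∧ g (π x) = a + 1 := by
    intro a
    obtain ⟨x, hx⟩ : (Finset.univ.filter fun x => p x ∧ g x ≠ g (π x)).Nonempty := by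
      rw [← Finset.card_pos, hg]
      exact two_pos
    obtain ⟨hpx, hgx⟩ := (Finset.mem_filter.1 hx).2
    by_cases h : g x = a
    · exact ⟨x, hpx, h, h ▸ hne hgx⟩
    -- The change at `x` goes to `a`; if it never went back, the value would stay `a` all around,
    -- but it is not `a` at `x`.
    · by_contra! hcon
      have hπ : g (π x) = a := by
        rw [hne hgx, hne' h]
        exact htwo.symm
      have := sameCycle_invariant (π := π) (g := g) (p := fun x => p x ∧ g x = a)
        (fun b hb => ⟨hp b hb.1, by_contra fun h' => hcon b hb.1 hb.2 (hne' h')⟩)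
        (fun b hb => (by_contra fun h' => hcon b hb.1 hb.2 (hne' h') : g (π b) = a).trans hb.2.symm)
        (hc _ _ (hp x hpx) hpx) ⟨hp x hpx, hπ⟩
      exact h (this.trans hπ)
  obtain ⟨x, hpx, h1, h2⟩ := hex a
  refine ⟨x, ⟨hpx, h1, h2⟩, ?_⟩
  rintro y ⟨hpy, k1, k2⟩
  by_contra hxy
  obtain ⟨z, hpz, m1, m2⟩ := hex (a + 1)
  have hsub : ({x, y, z} : Finset α) ⊆ Finset.univ.filter fun x => p x ∧ g x ≠ g (π x) := by
    intro t ht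
    simp only [Finset.mem_insert, Finset.mem_singleton] at ht
    rw [Finset.mem_filter]
    refine ⟨Finset.mem_univ _, ?_⟩
    rcases ht with rfl | rfl | rfl
    · exact ⟨hpx, by rw [h1, h2]; exact hone⟩
    · exact ⟨hpy, by rw [k1, k2]; exact hone⟩
    · exact ⟨hpz, by rw [m1, m2]; exact hone⟩
  have hcard := Finset.card_le_card hsub
  rw [hg, Finset.card_insert_of_notMem, Finset.card_pair] at hcard
  · omega
  · rintro rfl
    exact hone (k1.symm.trans m1)
  · simp only [Finset.mem_insert, Finset.mem_singleton, not_or]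
    exact ⟨fun h => hxy h.symm, fun h => hone (h1.symm.trans (h ▸ m1))⟩

variable {V : Type*} {G : SimpleGraph V} (P : PlaneDrawing G) (c : G.Coloring Shade) [Finite V]

theorem ncard_darts (v : V) : {d : G.Dart | d.fst = v}.ncard = (G.neighborSet v).ncard := by
  have : G.neighborSet v = (fun d : G.Dart => d.snd) '' {d : G.Dart | d.fst = v} := by
    ext w
    constructor
    · intro h
      exact ⟨⟨(v, w), h⟩, rfl, rfl⟩
    · rintro ⟨d, rfl, rfl⟩
      exact d.adj
  rw [this, Set.InjOn.ncard_image]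
  intro d hd e he hde
  exact SimpleGraph.Dart.ext _ _ (Prod.ext (Eq.trans hd (Eq.symm he)) hde)

theorem rot_pow_fst (i : ℕ) (d : G.Dart) : ((P.rot ^ i) d).fst = d.fst := by
  induction i with
  | zero => rfl
  | succ i ih => rw [pow_succ', Equiv.Perm.mul_apply, P.rot_fst, ih]

/-- The angles at a vertex in their cyclic order. -/
theorem rot_pow_bijOn (d : G.Dart) : Set.BijOn (fun i : ℕ => (P.rot ^ i) d)
    (Set.Iio (G.neighborSet d.fst).ncard) {x : G.Dart | x.fst = d.fst} := by
  have hper : Function.minimalPeriod P.rot d > 0 :=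
    Function.minimalPeriod_pos_of_mem_periodicPts (Function.Injective.mem_periodicPts P.rot.injective d)
  have key : Set.BijOn (fun i : ℕ => (P.rot ^ i) d)
      (Set.Iio (Function.minimalPeriod P.rot d)) {x : G.Dart | x.fst = d.fst} := by
    refine ⟨fun i _ => P.rot_pow_fst i d, ?_, ?_⟩
    · intro i hi j hj hij
      simp only [← Equiv.Perm.iterate_eq_pow] at hij
      exact Function.iterate_injOn_Iio_minimalPeriod hi hj hij
    · intro x hx
      obtain ⟨i, hi⟩ := (P.rot_sameCycle d x (Eq.symm hx)).exists_nat_pow_eq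
      refine ⟨i % Function.minimalPeriod P.rot d, Nat.mod_lt _ hper, ?_⟩
      simp only [← Equiv.Perm.iterate_eq_pow] at hi ⊢
      rw [Function.iterate_mod_minimalPeriod_eq, hi]
  have hcard : (G.neighborSet d.fst).ncard = Function.minimalPeriod P.rot d := by
    rw [← ncard_darts, ← key.image_eq, key.injOn.ncard_image, Set.ncard_Iio_nat]
  rwa [hcard]

theorem rot_pow_degree (d : G.Dart) : (P.rot ^ (G.neighborSet d.fst).ncard) d = d := by
  obtain ⟨i, hi, h⟩ := (P.rot_pow_bijOn d).surjOn
    (P.rot_pow_fst (G.neighborSet d.fst).ncard d)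
  by_cases h0 : i = 0
  · rw [← h, h0]
    rfl
  · obtain ⟨j, rfl⟩ := Nat.exists_eq_succ_of_ne_zero h0
    have hi' : j + 1 < (G.neighborSet d.fst).ncard := hi
    obtain ⟨n, hn⟩ : ∃ n, (G.neighborSet d.fst).ncard = n + 1 :=
      Nat.exists_eq_succ_of_ne_zero (by omega)
    rw [hn] at h hi'
    simp only [Nat.succ_eq_add_one, pow_succ', Equiv.Perm.mul_apply] at h
    have := (P.rot_pow_bijOn d).injOn (by rw [hn]; exact Nat.lt_succ_of_lt (Nat.lt_of_succ_lt_succ hi'))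
      (by rw [hn]; exact Nat.lt_succ_self n) (P.rot.injective h)
    omega

open scoped Classical in
/-- The vertex rule says that the labels change exactly twice. -/
theorem vertexRule_iff (l : Angle G → Fin 2) (v : V) : P.VertexRule l v ↔
    (Finset.univ.filter fun x : G.Dart => x.fst = v ∧
      l (Sum.inl x) ≠ l (Sum.inl (P.rot.symm x))).card = 2 := by
  have hone : ∀ {a : Fin 2}, a ≠ 0 ↔ a = 1 := by decide
  constructor
  · rintro ⟨d, k, rfl, hk, hkn, hl⟩
    set n := (G.neighborSet d.fst).ncard with hn
    have hbij := P.rot_pow_bijOn d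
    rw [← hn] at hbij
    have hdk : d ≠ (P.rot ^ k) d := fun h =>
      hk.ne (hbij.injOn (hk.trans hkn) hkn (h : (P.rot ^ 0) d = _))
    have : (Finset.univ.filter fun x : G.Dart => x.fst = d.fst ∧
        l (Sum.inl x) ≠ l (Sum.inl (P.rot.symm x))) = {d, (P.rot ^ k) d} := by
      ext x
      simp only [Finset.mem_filter, Finset.mem_univ, true_and, Finset.mem_insert,
        Finset.mem_singleton]
      have hcase : ∀ i < n, (l (Sum.inl ((P.rot ^ i) d)) ≠
          l (Sum.inl (P.rot.symm ((P.rot ^ i) d))) ↔ i = 0 ∨ i = k) := by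
        intro i hi
        obtain ⟨j, hj, hji⟩ : ∃ j < n, P.rot.symm ((P.rot ^ i) d) = (P.rot ^ j) d ∧
            (i = 0 ∧ j = n - 1 ∨ i = j + 1) := by
          rcases i with _ | i
          · refine ⟨n - 1, by omega, ?_, Or.inl ⟨rfl, rfl⟩⟩
            rw [Equiv.symm_apply_eq, ← Equiv.Perm.mul_apply, ← pow_succ',
              Nat.sub_add_cancel (by omega), hn, rot_pow_degree]
            rfl
          · refine ⟨i, by omega, ?_, Or.inr rfl⟩
            rw [Equiv.symm_apply_eq, ← Equiv.Perm.mul_apply, ← pow_succ']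
        rw [hji.1]
        have h1 := hl i hi
        have h2 := hl j hj
        have h3 : ∀ a b : Fin 2, a ≠ b ↔ ¬ (a = 0 ↔ b = 0) := by decide
        rw [h3, h1, h2]
        omega
      constructor
      · rintro ⟨hx, hflip⟩
        obtain ⟨i, hi, rfl⟩ := hbij.surjOn hx
        rcases (hcase i hi).1 hflip with rfl | rfl
        · exact Or.inl rfl
        · exact Or.inr rfl
      · rintro (rfl | rfl)
        · exact ⟨rfl, (hcase 0 (hk.trans hkn)).2 (Or.inl rfl)⟩
        · exact ⟨P.rot_pow_fst k d, (hcase k hkn).2 (Or.inr rfl)⟩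
    rw [this, Finset.card_pair hdk]
  · intro h
    have hsym : ∀ d e : G.Dart, d.fst = v → e.fst = v → Equiv.Perm.SameCycle P.rot.symm d e :=
      fun d e hd he => Equiv.Perm.SameCycle.inv (P.rot_sameCycle d e (hd.trans he.symm))
    have hu := existsUnique_change (π := P.rot.symm) (p := fun x : G.Dart => x.fst = v)
      (fun a ha => (P.rot_symm_fst a).trans ha) hsym
      (g := fun x => (l (Sum.inl x) : ZMod 2)) h
    -- Counterclockwise, `d` is the first 0 after a 1, and `y` is the first 1 after a 0.
    obtain ⟨d, ⟨hd, hd0, hd1⟩, hdu⟩ := hu 0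
    obtain ⟨y, ⟨hy, hy0, hy1⟩, hyu⟩ := hu 1
    subst hd
    set n := (G.neighborSet d.fst).ncard with hn
    have hbij := P.rot_pow_bijOn d
    rw [← hn] at hbij
    obtain ⟨k, hk, hky⟩ := hbij.surjOn hy
    simp only at hky
    have hkn : k < n := hk
    have hk0 : 0 < k := by
      rcases Nat.eq_zero_or_pos k with rfl | h
      · exfalso
        have : d = y := hky
        rw [this, hy0] at hd0
        exact absurd hd0 (by decide)
      · exact h
    refine ⟨d, k, rfl, hk0, hkn, ?_⟩
    have hstep : ∀ i, i + 1 < n → i + 1 ≠ k →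
        l (Sum.inl ((P.rot ^ (i + 1)) d)) = l (Sum.inl ((P.rot ^ i) d)) := by
      intro i hi hik
      have hsymm : P.rot.symm ((P.rot ^ (i + 1)) d) = (P.rot ^ i) d := by
        rw [Equiv.symm_apply_eq, ← Equiv.Perm.mul_apply, ← pow_succ']
      by_contra hcon
      have h2 : ∀ {a b : Fin 2}, a ≠ b → (a = 0 ∧ b = 1) ∨ (a = 1 ∧ b = 0) := by decide
      rcases h2 hcon with ⟨ha, hb⟩ | ⟨ha, hb⟩
      · have := hdu ((P.rot ^ (i + 1)) d) ⟨P.rot_pow_fst _ d, ha, by rw [hsymm]; exact hb⟩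
        exact absurd (hbij.injOn hi (by omega : 0 < n) this) (Nat.succ_ne_zero i)
      · have := hyu ((P.rot ^ (i + 1)) d) ⟨P.rot_pow_fst _ d, ha, by rw [hsymm]; exact hb⟩
        exact hik (hbij.injOn hi hkn (this.trans hky.symm))
    have hlow : ∀ i < k, l (Sum.inl ((P.rot ^ i) d)) = 0 := by
      intro i
      induction i with
      | zero => exact fun _ => hd0
      | succ i ih =>
        intro hi
        rw [hstep i (by omega) (by omega)]
        exact ih (by omega)
    have hhigh : ∀ j, k + j < n → l (Sum.inl ((P.rot ^ (k + j)) d)) = 1 := by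
      intro j
      induction j with
      | zero =>
        intro _
        rw [add_zero, hky]
        exact hy0
      | succ j ih =>
        intro hj
        rw [← add_assoc, hstep (k + j) (by omega) (by omega)]
        exact ih (by omega)
    intro i hi
    constructor
    · intro h0
      by_contra hik
      obtain ⟨j, rfl⟩ := Nat.exists_eq_add_of_le (not_lt.1 hik)
      rw [hhigh j hi] at h0
      exact absurd h0 (by decide)
    · exact hlow i

end PlaneDrawing

end StrongLabeling

/-! ### Labelings as records of events -/

namespace StrongLabeling

namespace PlaneDrawing

variable {V : Type*} {G : SimpleGraph V} (P : PlaneDrawing G) (c : G.Coloring Shade)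

/-- The changes of the labels `m` at an edge `d`: they change on its left side, and at two of the
three of its right side (where a change is an equality), its white end and its black end; `o d` is
the remaining one. -/
structure Records (m : G.Dart → ZMod 2) (o : WhiteDart c → Fin 3) : Prop where
  left : ∀ d : WhiteDart c, m d.1 ≠ m (P.next d.1)
  right : ∀ d : WhiteDart c, o d ≠ 0 ↔ m d.1.symm = m (P.next d.1.symm)
  white : ∀ d : WhiteDart c, o d ≠ 1 ↔ m d.1 ≠ m (P.rot.symm d.1)
  black : ∀ d : WhiteDart c, o d ≠ 2 ↔ m d.1.symm ≠ m (P.rot.symm d.1.symm)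

theorem edge_patterns : ∀ a b a' b' : Fin 2,
    (∃ i : Fin 2, (a, b, a', b') = (1 - i, i, i, i) ∨ (a, b, a', b') = (i, 1 - i, i, i) ∨
      (a, b, a', b') = (i, 1 - i, 1 - i, i)) ↔
    a ≠ b ∧ ∃ o : Fin 3, (o ≠ 0 ↔ b' = a') ∧ (o ≠ 1 ↔ a ≠ a') ∧ (o ≠ 2 ↔ b' ≠ b) := by
  decide

theorem edgeRule_iff (l : Angle G → Fin 2) :
    (∀ d : G.Dart, c d.fst = Shade.white → c d.snd = Shade.black → P.EdgeRule l d) ↔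
      ∃ o, P.Records c (fun x => (l (Sum.inl x) : Fin 2)) o := by
  have h : ∀ d : WhiteDart c, P.EdgeRule l d.1 ↔ (l (Sum.inl d.1) ≠ l (Sum.inl (P.next d.1)) ∧
      ∃ o : Fin 3, (o ≠ 0 ↔ l (Sum.inl d.1.symm) = l (Sum.inl (P.rot.symm d.1))) ∧
        (o ≠ 1 ↔ l (Sum.inl d.1) ≠ l (Sum.inl (P.rot.symm d.1))) ∧
        (o ≠ 2 ↔ l (Sum.inl d.1.symm) ≠ l (Sum.inl (P.next d.1)))) :=
    fun d => edge_patterns _ _ _ _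
  constructor
  · intro hl
    choose h1 o h2 h3 h4 using fun d : WhiteDart c => (h d).1 (hl d.1 d.2 (snd_eq_black c d.2))
    exact ⟨o, h1, fun d => by rw [next_apply, SimpleGraph.Dart.symm_symm]; exact h2 d, h3, h4⟩
  · rintro ⟨o, ho⟩ d hd _
    refine (h ⟨d, hd⟩).2 ⟨ho.left _, o ⟨d, hd⟩, ?_, ho.white _, ho.black _⟩
    have := ho.right ⟨d, hd⟩
    rwa [next_apply, SimpleGraph.Dart.symm_symm] at this

variable {P} {c} [Finite V]

-- Labels always differ on the left of an edge, so all equalities in a face are on right sides, one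
-- for each dark triangle that does not omit the face.
open scoped Classical in
theorem Records.card_face [Nontrivial V] (hG : G.Connected) {m : G.Dart → ZMod 2}
    {o : WhiteDart c → Fin 3} (h : P.Records c m o) (f : P.Face) :
    (((P.stellation c hG).darkAt (Sum.inr f)).filter
      (fun d => o d ≠ (P.stellation c hG).col (Sum.inr f))).card =
    (Finset.univ.filter fun x : G.Dart => P.leftFace x = f ∧ m x = m (P.next x)).card := by
  have hmem : ∀ d : WhiteDart c, d ∈ (P.stellation c hG).darkAt (Sum.inr f) ↔
      P.leftFace d.1.symm = f := fun d => by
    rw [Hypermap.mem_darkAt]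
    exact ⟨fun h => Sum.inr.inj h, fun h => congrArg Sum.inr h⟩
  refine Finset.card_bij (fun d _ => d.1.symm) ?_ ?_ ?_
  · intro d hd
    rw [Finset.mem_filter, hmem] at hd
    exact Finset.mem_filter.2 ⟨Finset.mem_univ _, hd.1, (h.right d).1 hd.2⟩
  · intro d _ e _ hde
    exact Subtype.ext (SimpleGraph.Dart.symm_involutive.injective hde)
  · intro x hx
    obtain ⟨hxf, hxm⟩ := (Finset.mem_filter.1 hx).2
    have hb : c x.symm.fst = Shade.white := by
      refine (snd_white_iff c x).2 fun hw => ?_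
      exact h.left ⟨x, hw⟩ hxm
    refine ⟨⟨x.symm, hb⟩, ?_, SimpleGraph.Dart.symm_symm x⟩
    rw [Finset.mem_filter, hmem, SimpleGraph.Dart.symm_symm]
    refine ⟨hxf, (h.right ⟨x.symm, hb⟩).2 ?_⟩
    rwa [SimpleGraph.Dart.symm_symm]

open scoped Classical in
theorem Records.card_vertex [Nontrivial V] (hG : G.Connected) {m : G.Dart → ZMod 2}
    {o : WhiteDart c → Fin 3} (h : P.Records c m o) (v : V) :
    (((P.stellation c hG).darkAt (Sum.inl v)).filter
      (fun d => o d ≠ (P.stellation c hG).col (Sum.inl v))).card =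
    (Finset.univ.filter fun x : G.Dart => x.fst = v ∧ m x ≠ m (P.rot.symm x)).card := by
  by_cases hv : c v = Shade.white
  · have hcol : (P.stellation c hG).col (Sum.inl v) = 1 := if_pos hv
    have hmem : ∀ d : WhiteDart c, d ∈ (P.stellation c hG).darkAt (Sum.inl v) ↔
        d.1.fst = v := fun d => by
      rw [Hypermap.mem_darkAt, hcol]
      exact ⟨fun h => Sum.inl.inj h, fun h => congrArg Sum.inl h⟩
    rw [hcol]
    refine Finset.card_bij (fun d _ => d.1) ?_ ?_ ?_
    · intro d hd
      rw [Finset.mem_filter, hmem] at hd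
      exact Finset.mem_filter.2 ⟨Finset.mem_univ _, hd.1, (h.white d).1 hd.2⟩
    · intro d _ e _ hde
      exact Subtype.ext hde
    · intro x hx
      obtain ⟨hxv, hxm⟩ := (Finset.mem_filter.1 hx).2
      refine ⟨⟨x, by rw [hxv]; exact hv⟩, ?_, rfl⟩
      rw [Finset.mem_filter, hmem]
      exact ⟨hxv, (h.white _).2 hxm⟩
  · have hcol : (P.stellation c hG).col (Sum.inl v) = 2 := if_neg hv
    have hmem : ∀ d : WhiteDart c, d ∈ (P.stellation c hG).darkAt (Sum.inl v) ↔
        d.1.symm.fst = v := fun d => by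
      rw [Hypermap.mem_darkAt, hcol]
      exact ⟨fun h => Sum.inl.inj h, fun h => congrArg Sum.inl h⟩
    rw [hcol]
    refine Finset.card_bij (fun d _ => d.1.symm) ?_ ?_ ?_
    · intro d hd
      rw [Finset.mem_filter, hmem] at hd
      exact Finset.mem_filter.2 ⟨Finset.mem_univ _, hd.1, (h.black d).1 hd.2⟩
    · intro d _ e _ hde
      exact Subtype.ext (SimpleGraph.Dart.symm_involutive.injective hde)
    · intro x hx
      obtain ⟨hxv, hxm⟩ := (Finset.mem_filter.1 hx).2
      refine ⟨⟨x.symm, (snd_white_iff c x).2 (by rw [hxv]; exact hv)⟩, ?_,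
        SimpleGraph.Dart.symm_symm x⟩
      rw [Finset.mem_filter, hmem, SimpleGraph.Dart.symm_symm]
      refine ⟨hxv, (h.black _).2 ?_⟩
      simp only [SimpleGraph.Dart.symm_symm]
      exact hxm

open scoped Classical in
theorem Records.isOmission_iff [Nontrivial V] (hG : G.Connected) {m : G.Dart → ZMod 2}
    {o : WhiteDart c → Fin 3} (h : P.Records c m o) (s₀ s₁ : V) :
    (P.stellation c hG).IsOmission (P.special s₀ s₁) o ↔
      (∀ v, (Finset.univ.filter fun x : G.Dart => x.fst = v ∧ m x ≠ m (P.rot.symm x)).card =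
        if v = s₀ ∨ v = s₁ then 0 else 2) ∧
      ∀ f, (Finset.univ.filter fun x : G.Dart => P.leftFace x = f ∧ m x = m (P.next x)).card = 2 := by
  constructor
  · intro ho
    refine ⟨fun v => ?_, fun f => ?_⟩
    · rw [← h.card_vertex hG, ho]
      simp [special]
    · rw [← h.card_face hG, ho]
      simp [special]
  · rintro ⟨h1, h2⟩ (v | f)
    · rw [h.card_vertex hG, h1]
      simp [special]
    · rw [h.card_face hG, h2]
      simp [special]

open scoped Classical in
theorem card_of_faceRule {l : Angle G → Fin 2} {f : P.Face} (h : P.FaceRule l f) :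
    (Finset.univ.filter fun x : G.Dart => P.leftFace x = f ∧
      l (Sum.inl x) = l (Sum.inl (P.next x))).card = 2 := by
  obtain ⟨x, ⟨hx, hx1, hx2⟩, hxu⟩ := h 0
  obtain ⟨y, ⟨hy, hy1, hy2⟩, hyu⟩ := h 1
  have hxy : x ≠ y := by
    rintro rfl
    rw [hx1] at hy1
    exact absurd hy1 (by decide)
  refine Eq.trans (congrArg Finset.card ?_) (Finset.card_pair hxy)
  ext z
  simp only [Finset.mem_filter, Finset.mem_univ, true_and, Finset.mem_insert, Finset.mem_singleton]
  constructor
  · rintro ⟨hz, hz1⟩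
    have h2 : ∀ a : Fin 2, a = 0 ∨ a = 1 := by decide
    rcases h2 (l (Sum.inl z)) with h | h
    · exact Or.inl (hxu z ⟨hz, h, hz1.symm.trans h⟩)
    · exact Or.inr (hyu z ⟨hz, h, hz1.symm.trans h⟩)
  · rintro (rfl | rfl)
    · exact ⟨hx, hx1.trans hx2.symm⟩
    · exact ⟨hy, hy1.trans hy2.symm⟩

open scoped Classical in
theorem faceRule_of_card [Nontrivial V] (hG : G.Connected) {l : Angle G → Fin 2}
    {o : WhiteDart c → Fin 3} (ho : P.Records c (fun x => (l (Sum.inl x) : Fin 2)) o) {f : P.Face}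
    (h : (Finset.univ.filter fun x : G.Dart => P.leftFace x = f ∧
      l (Sum.inl x) = l (Sum.inl (P.next x))).card = 2) : P.FaceRule l f := by
  let m : G.Dart → ZMod 2 := fun x => (l (Sum.inl x) : Fin 2)
  -- Flipping the labels at black vertices turns equalities along a face into changes. The two kinds
  -- of changes are the pairs of 0s and of 1s, because equalities only occur at darts with a black
  -- tail.
  set g : G.Dart → ZMod 2 := fun x => m x + if c x.fst = Shade.white then 0 else 1 with hg
  have hnext : ∀ x : G.Dart, g (P.next x) =
      m (P.next x) + if c x.fst = Shade.white then 1 else 0 := by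
    intro x
    simp only [hg, P.next_fst, snd_white_iff]
    by_cases hx : c x.fst = Shade.white <;> simp [hx]
  have hiff : ∀ x, l (Sum.inl x) = l (Sum.inl (P.next x)) ↔ g x ≠ g (P.next x) := by
    intro x
    rw [hnext]
    simp only [hg]
    have h1 : ∀ a b : ZMod 2, a = b ↔ a + 0 ≠ b + 1 := by decide
    have h2 : ∀ a b : ZMod 2, a = b ↔ a + 1 ≠ b + 0 := by decide
    split_ifs
    · exact h1 _ _
    · exact h2 _ _
  have hu := existsUnique_change (π := P.next) (p := fun x => P.leftFace x = f)
    (fun a ha => (P.leftFace_next a).trans ha)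
    (fun a b ha hb => P.sameCycle_next c hG (ha.trans hb.symm)) (g := g)
    (Eq.trans (congrArg Finset.card (by
      ext x
      simp only [Finset.mem_filter, Finset.mem_univ, true_and, hiff])) h)
  intro i
  let j : ZMod 2 := i
  have heq : ∀ x, (P.leftFace x = f ∧ l (tailLeft x) = i ∧ l (P.headLeft x) = i) ↔
      (P.leftFace x = f ∧ g x = j + 1 ∧ g (P.next x) = j + 1 + 1) := by
    intro x
    refine and_congr_right fun _ => ?_
    rw [hnext]
    simp only [hg]
    change (m x = j ∧ m (P.next x) = j) ↔ _
    have hl : c x.fst = Shade.white → m x ≠ m (P.next x) :=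
      fun h => ho.left ⟨x, h⟩
    have h1 : ∀ a b i : ZMod 2, a ≠ b → ((a = i ∧ b = i) ↔ (a + 0 = i + 1 ∧ b + 1 = i + 1 + 1)) := by
      decide
    have h2 : ∀ a b i : ZMod 2, (a = i ∧ b = i) ↔ (a + 1 = i + 1 ∧ b + 0 = i + 1 + 1) := by
      decide
    split_ifs with h
    · exact h1 _ _ _ (hl h)
    · exact h2 _ _ _
  exact (existsUnique_congr heq).2 (hu (j + 1))

end PlaneDrawing

end StrongLabeling

/-! ### Connectedness, and labelings versus omissions -/

namespace StrongLabeling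

/-- Deleting one special vertex from `G + s₀s₁` also deletes the new edge, so a third vertex reaches
everything else within `G`. -/
theorem connected_of_weaklyTwoConnected {V : Type*} [Finite V] {G : SimpleGraph V} {s₀ s₁ : V}
    (h : WeaklyTwoConnected G s₀ s₁) : G.Connected := by
  rcases h with h | h
  · exact h.2.1
  classical
  have := Fintype.ofFinite V
  obtain ⟨u, hu⟩ : ∃ u, u ∉ ({s₀, s₁} : Finset V) := by
    by_contra! hall
    have h1 := Finset.card_le_card (fun x _ => hall x : (Finset.univ : Finset V) ⊆ {s₀, s₁})
    have h2 := h.1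
    rw [Nat.card_eq_fintype_card] at h2
    have h3 := Finset.card_le_two (a := s₀) (b := s₁)
    rw [Finset.card_univ] at h1
    omega
  simp only [Finset.mem_insert, Finset.mem_singleton, not_or] at hu
  have key : ∀ s v : V, (s = s₀ ∨ s = s₁) → v ≠ s → G.Reachable u v := by
    intro s v hs hv
    have hus : u ≠ s := by rcases hs with rfl | rfl; exacts [hu.1, hu.2]
    refine reachable_invariant (p := fun a => G.Reachable u a.1) ?_
      ((h.2.2 s).preconnected ⟨u, hus⟩ ⟨v, hv⟩) (SimpleGraph.Reachable.refl _)
    rintro ⟨a, ha⟩ ⟨b, hb⟩ hab hp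
    simp only [SimpleGraph.comap_adj, SimpleGraph.sup_adj, SimpleGraph.edge_adj,
      Function.Embedding.subtype_apply] at hab
    rcases hab with hab | ⟨hab, _⟩
    · exact hp.trans hab.reachable
    · exfalso
      rcases hs with rfl | rfl <;> rcases hab with ⟨rfl, rfl⟩ | ⟨rfl, rfl⟩
      · exact ha rfl
      · exact hb rfl
      · exact hb rfl
      · exact ha rfl
  have hall : ∀ v, G.Reachable u v := by
    intro v
    by_cases hv : v = s₀
    · by_cases hv' : v = s₁
      · have h3 := h.2.1.preconnected u v
        have : G ⊔ SimpleGraph.edge s₀ s₁ = G := by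
          rw [← hv, ← hv', SimpleGraph.edge_self_eq_bot, sup_bot_eq]
        rwa [this] at h3
      · exact key s₁ v (Or.inr rfl) hv'
    · exact key s₀ v (Or.inl rfl) hv
  have : Nonempty V := ⟨u⟩
  exact SimpleGraph.Connected.mk fun a b => (hall a).symm.trans (hall b)

namespace PlaneDrawing

variable {V : Type*} {G : SimpleGraph V} {P : PlaneDrawing G} {c : G.Coloring Shade} [Finite V]
  {s₀ s₁ : V}

open scoped Classical in
theorem IsGeneralizedStrongLabeling.card_vertex {l : Angle G → Fin 2}
    (hl : P.IsGeneralizedStrongLabeling c s₀ s₁ l) (v : V) :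
    (Finset.univ.filter fun x : G.Dart => x.fst = v ∧
      l (Sum.inl x) ≠ l (Sum.inl (P.rot.symm x))).card = if v = s₀ ∨ v = s₁ then 0 else 2 := by
  split_ifs with hv
  · rw [Finset.card_eq_zero, Finset.filter_eq_empty_iff]
    rintro x - ⟨rfl, hx⟩
    apply hx
    rcases hv with hv | hv
    · rw [hl.special₀ (Sum.inl x) hv, hl.special₀ (Sum.inl (P.rot.symm x))
        ((P.rot_symm_fst x).trans hv)]
    · rw [hl.special₁ (Sum.inl x) hv, hl.special₁ (Sum.inl (P.rot.symm x))
        ((P.rot_symm_fst x).trans hv)]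
  · exact (P.vertexRule_iff l v).1 (hl.vertexRule v (fun h => hv (Or.inl h))
      (fun h => hv (Or.inr h)))

open scoped Classical in
theorem Records.card_add_card {m : G.Dart → ZMod 2} {o : WhiteDart c → Fin 3}
    (h : P.Records c m o) :
    (Finset.univ.filter fun x : G.Dart => m x ≠ m (P.rot.symm x)).card +
      (Finset.univ.filter fun x : G.Dart => m x = m (P.next x)).card =
      2 * Fintype.card (WhiteDart c) := by
  rw [Finset.card_filter, Finset.card_filter, sum_dart c, sum_dart c,
    ← Finset.sum_add_distrib, ← Finset.sum_add_distrib, ← Finset.sum_add_distrib,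
    Finset.sum_congr rfl (g := fun _ => 2)]
  · simp [mul_comm]
  · intro d _
    simp only [← h.right d, ← h.white d, ← h.black d, h.left d, if_false]
    generalize o d = i
    fin_cases i <;> rfl

/-- Two events per edge, two per face, two per nonspecial vertex: `2|E| = 2|F| + 2|V| - 4`. Euler's
formula then leaves exactly one component. -/
theorem IsGeneralizedStrongLabeling.connected (hne : s₀ ≠ s₁) {l : Angle G → Fin 2}
    (hl : P.IsGeneralizedStrongLabeling c s₀ s₁ l) : G.Connected := by
  classical
  have := Fintype.ofFinite V
  have := Fintype.ofFinite P.Face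
  obtain ⟨o, ho⟩ := (P.edgeRule_iff c l).1 hl.edgeRule
  have h1 := ho.card_add_card
  have h2 : (Finset.univ.filter fun x : G.Dart =>
      l (Sum.inl x) ≠ l (Sum.inl (P.rot.symm x))).card + 4 = 2 * Fintype.card V := by
    rw [Finset.card_eq_sum_card_fiberwise (f := fun x : G.Dart => x.fst) (t := Finset.univ)
      (fun _ _ => Finset.mem_univ _)]
    have : ∀ v ∈ (Finset.univ : Finset V), ((Finset.univ.filter fun x : G.Dart =>
        l (Sum.inl x) ≠ l (Sum.inl (P.rot.symm x))).filter fun x => x.fst = v).card +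
        ((if v = s₀ then 2 else 0) + if v = s₁ then 2 else 0) = 2 := by
      intro v _
      rw [Finset.filter_filter]
      have h3 := hl.card_vertex v
      simp only [and_comm (b := _ = v)]
      rw [h3]
      by_cases hv : v = s₀
      · subst hv
        simp [hne]
      · by_cases hv' : v = s₁
        · subst hv'
          simp [hv]
        · simp [hv, hv']
    have h4 := Finset.sum_congr rfl this
    rw [Finset.sum_add_distrib, Finset.sum_add_distrib] at h4
    simp only [Finset.sum_ite_eq', Finset.mem_univ, if_true, Finset.sum_const, Finset.card_univ,
      smul_eq_mul] at h4
    omega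
  have h3 : (Finset.univ.filter fun x : G.Dart =>
      l (Sum.inl x) = l (Sum.inl (P.next x))).card = 2 * Fintype.card P.Face := by
    rw [Finset.card_eq_sum_card_fiberwise (f := fun x : G.Dart => P.leftFace x) (t := Finset.univ)
      (fun _ _ => Finset.mem_univ _), Finset.sum_congr rfl (g := fun _ => 2)]
    · simp [mul_comm]
    · intro f _
      rw [Finset.filter_filter]
      simp only [and_comm (b := _ = f)]
      exact card_of_faceRule (hl.faceRule f)
  have h4 : Nat.card V + Nat.card P.Face = _ := P.euler
  rw [Nat.card_eq_fintype_card, Nat.card_eq_fintype_card, ← card_whiteDart c,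
    Nat.card_eq_fintype_card] at h4
  have h5 : Nat.card G.ConnectedComponent = 1 := by
    have : (Finset.univ.filter fun x : G.Dart =>
      l (Sum.inl x) ≠ l (Sum.inl (P.rot.symm x))).card + (Finset.univ.filter fun x : G.Dart =>
      l (Sum.inl x) = l (Sum.inl (P.next x))).card = 2 * Fintype.card (WhiteDart c) := h1
    omega
  rw [Nat.card_eq_one_iff_unique] at h5
  have : Nonempty V := ⟨s₀⟩
  exact SimpleGraph.Connected.mk fun a b =>
    SimpleGraph.ConnectedComponent.exact (@Subsingleton.elim _ h5.1 _ _)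

/-- An edge between the special vertices would have no change at either end, but only one event can
be missing. -/
theorem IsGeneralizedStrongLabeling.not_adj {l : Angle G → Fin 2}
    (hl : P.IsGeneralizedStrongLabeling c s₀ s₁ l) : ¬ G.Adj s₀ s₁ := by
  intro hadj
  have hedge : ∀ d : G.Dart, (d.fst = s₀ ∨ d.fst = s₁) →
      l (Sum.inl d) = l (Sum.inl (P.rot.symm d)) := by
    rintro d (h | h)
    · rw [hl.special₀ (Sum.inl d) h, hl.special₀ (Sum.inl (P.rot.symm d))
        ((P.rot_symm_fst d).trans h)]
    · rw [hl.special₁ (Sum.inl d) h, hl.special₁ (Sum.inl (P.rot.symm d))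
        ((P.rot_symm_fst d).trans h)]
  obtain ⟨o, ho⟩ := (P.edgeRule_iff c l).1 hl.edgeRule
  have key : ∀ d : WhiteDart c, (d.1.fst = s₀ ∨ d.1.fst = s₁) → (d.1.snd = s₀ ∨ d.1.snd = s₁) →
      False := by
    intro d h h'
    have h1 : o d = 1 := by
      by_contra hcon
      exact (ho.white d).1 hcon (hedge d.1 h)
    have h2 : o d = 2 := by
      by_contra hcon
      exact (ho.black d).1 hcon (hedge d.1.symm h')
    rw [h1] at h2
    exact absurd h2 (by decide)
  by_cases hw : c s₀ = Shade.white
  · exact key ⟨⟨(s₀, s₁), hadj⟩, hw⟩ (Or.inl rfl) (Or.inr rfl)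
  · exact key ⟨⟨(s₁, s₀), hadj.symm⟩, (snd_white_iff c ⟨(s₀, s₁), hadj⟩).2 hw⟩ (Or.inr rfl)
      (Or.inl rfl)

open scoped Classical in
theorem IsGeneralizedStrongLabeling.exists_isOmission [Nontrivial V] (hG : G.Connected)
    {l : Angle G → Fin 2} (hl : P.IsGeneralizedStrongLabeling c s₀ s₁ l) :
    ∃ o, (P.stellation c hG).IsOmission (P.special s₀ s₁) o := by
  obtain ⟨o, ho⟩ := (P.edgeRule_iff c l).1 hl.edgeRule
  exact ⟨o, (ho.isOmission_iff hG s₀ s₁).2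
    ⟨hl.card_vertex, fun f => card_of_faceRule (hl.faceRule f)⟩⟩

-- Here `b` is the dark triangle of an edge, and `a`, `c`, `f` are the light ones across its sides
-- opposite to the face, the white and the black vertex. Going from one light triangle to another
-- crosses two of the sides, which changes the value unless the third vertex is the omitted one.
set_option synthInstance.maxSize 1000 in
theorem label_patterns : ∀ (o : Fin 3) (a b c f k : ZMod 2), a + b = (if o = 0 then 1 else 0) →
    b + c = (if o = 1 then 1 else 0) → f + b = (if o = 2 then 1 else 0) →
    a + k ≠ 1 + a + k ∧ (o ≠ 0 ↔ 1 + c + k = f + k) ∧ (o ≠ 1 ↔ a + k ≠ f + k) ∧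
      (o ≠ 2 ↔ 1 + c + k ≠ 1 + a + k) := by
  decide

open scoped Classical in
theorem exists_records_of_isOmission [Nontrivial V] (hG : G.Connected) {S : Finset (V ⊕ P.Face)}
    {o : WhiteDart c → Fin 3} (ho : (P.stellation c hG).IsOmission S o) (t : G.Dart) :
    ∃ m : G.Dart → ZMod 2, P.Records c m o ∧ m t = 0 := by
  obtain ⟨R, hR⟩ := (P.stellation c hG).exists_region_of_isOmission (P.stellation_card c hG) ho
  rw [eq_comp_tri c R] at hR
  set Q := R ∘ (triEquiv c).symm
  -- Each angle meets one light triangle, which is given by its first dart at a white vertex and by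
  -- its second one at a black vertex. The label is the value there, complemented at black vertices;
  -- adding `μ t` normalises it.
  set μ : G.Dart → ZMod 2 := fun x =>
    if c x.fst = Shade.white then Q x else 1 + Q (P.rot x).symm with hμ
  refine ⟨fun x => μ x + μ t, ?_, CharTwo.add_self_eq_zero _⟩
  have key : ∀ d : WhiteDart c, _ := fun d =>
    label_patterns (o d) (Q d.1) (Q d.1.symm) (Q (P.rot d.1.symm).symm) (Q (P.rot.symm d.1)) (μ t)
      ((P.bd_tri_zero c hG Q d).symm.trans (hR d 0)) ((P.bd_tri_one c hG Q d).symm.trans (hR d 1))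
      (by
        have := (P.bd_tri_two c hG Q d).symm.trans (hR d 2)
        rwa [next_symm_apply, Equiv.apply_symm_apply] at this)
  have h1 : ∀ d : WhiteDart c, μ d.1 = Q d.1 := fun d => if_pos d.2
  have hb : ∀ d : WhiteDart c, c d.1.snd ≠ Shade.white := fun d h => (snd_white_iff c d.1).1 h d.2
  have h2 : ∀ d : WhiteDart c, μ d.1.symm = 1 + Q (P.rot d.1.symm).symm := fun d => if_neg (hb d)
  have h3 : ∀ d : WhiteDart c, μ (P.rot.symm d.1) = Q (P.rot.symm d.1) := fun d =>
    if_pos (by rw [P.rot_symm_fst]; exact d.2)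
  have h4 : ∀ d : WhiteDart c, μ (P.next d.1) = 1 + Q d.1 := fun d => by
    simp only [hμ]
    rw [if_neg (by rw [P.next_fst]; exact hb d), next_apply, Equiv.apply_symm_apply,
      SimpleGraph.Dart.symm_symm]
  refine ⟨fun d => ?_, fun d => ?_, fun d => ?_, fun d => ?_⟩
  · rw [h1, h4]
    exact (key d).1
  · rw [h2, next_apply, SimpleGraph.Dart.symm_symm, h3]
    exact (key d).2.1
  · rw [h1, h3]
    exact (key d).2.2.1
  · rw [h2, ← next_apply, h4]
    exact (key d).2.2.2

/-- There is an equality on each face at a vertex without changes. -/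
theorem Records.exists_eq {m : G.Dart → ZMod 2} {o : WhiteDart c → Fin 3} (h : P.Records c m o)
    {t : G.Dart} (ht : ∀ x : G.Dart, x.fst = t.fst → m x = m (P.rot.symm x)) :
    ∃ x : G.Dart, P.leftFace x = P.leftFace t ∧ (x.fst = t.fst ∨ x.snd = t.fst) ∧
      c x.fst = Shade.black ∧ m x = m t ∧ m (P.next x) = m t := by
  by_cases hw : c t.fst = Shade.white
  · let d : WhiteDart c := ⟨P.rot t, by rw [P.rot_fst]; exact hw⟩
    have hd : P.next d.1.symm = t := P.next.apply_symm_apply t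
    have h1 : o d = 1 := by
      by_contra hcon
      exact (h.white d).1 hcon (ht d.1 (P.rot_fst t))
    have h2 := (h.right d).1 (by rw [h1]; decide)
    refine ⟨d.1.symm, P.leftFace_next_symm t, Or.inr (P.rot_fst t), snd_eq_black c d.2, ?_, ?_⟩
    · rw [h2, hd]
    · rw [hd]
  · let d : WhiteDart c := ⟨t.symm, (snd_white_iff c t).2 hw⟩
    have hd : d.1.symm = t := SimpleGraph.Dart.symm_symm t
    have h1 : o d = 2 := by
      by_contra hcon
      refine (h.black d).1 hcon ?_
      rw [hd]
      exact ht t rfl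
    have h2 := (h.right d).1 (by rw [h1]; decide)
    rw [hd] at h2
    exact ⟨t, rfl, Or.inl rfl, ne_white_iff.1 hw, rfl, h2.symm⟩

-- The labels are constant at each special vertex and normalised to 0 at `s₀`. The equality in the
-- outer face at `s₀` also yields the rule for the outer edge.
open scoped Classical in
theorem exists_label_of_isOmission [Nontrivial V] (hG : G.Connected) (hne : s₀ ≠ s₁)
    (hadj : ¬ G.Adj s₀ s₁) (h₀ : P.OnOuterFace s₀) (h₁ : P.OnOuterFace s₁)
    {o : WhiteDart c → Fin 3} (ho : (P.stellation c hG).IsOmission (P.special s₀ s₁) o) :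
    ∃ l, P.IsGeneralizedStrongLabeling c s₀ s₁ l := by
  obtain ⟨t₀, rfl, hf₀⟩ := P.exists_dart_of_onOuterFace hG h₀
  obtain ⟨t₁, rfl, hf₁⟩ := P.exists_dart_of_onOuterFace hG h₁
  obtain ⟨m, hm, hmt⟩ := exists_records_of_isOmission hG ho t₀
  obtain ⟨hv, hf⟩ := (hm.isOmission_iff hG t₀.fst t₁.fst).1 ho
  have hflip : ∀ x : G.Dart, (x.fst = t₀.fst ∨ x.fst = t₁.fst) → m x = m (P.rot.symm x) := by
    intro x hx
    have h1 := hv x.fst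
    rw [if_pos hx, Finset.card_eq_zero, Finset.filter_eq_empty_iff] at h1
    by_contra hcon
    exact h1 (Finset.mem_univ x) ⟨rfl, hcon⟩
  have hconst : ∀ t : G.Dart, (t.fst = t₀.fst ∨ t.fst = t₁.fst) → ∀ x : G.Dart, x.fst = t.fst →
      m x = m t := by
    intro t ht x hx
    refine P.eq_of_rot_invariant (fun d hd => ?_) hx rfl
    rw [hflip (P.rot d) (by rwa [P.rot_fst, hd]), Equiv.symm_apply_apply]
  let l : Angle G → Fin 2 := (Sum.elim m (fun _ => 0) : Angle G → ZMod 2)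
  have hrec : P.Records c (fun x => (l (Sum.inl x) : Fin 2)) o := hm
  have hface : ∀ f, P.FaceRule l f := fun f => faceRule_of_card hG hrec (hf f)
  have hiso : ∀ v, ¬ G.IsIsolated v := by
    intro v hv
    obtain ⟨w, hw⟩ := hG.preconnected.exists_adj_of_nontrivial v
    exact hv w hw
  obtain ⟨x₀, hx₀, hx₀s, hx₀b, hx₀m, hx₀m'⟩ := hm.exists_eq (t := t₀)
    (fun x hx => hflip x (Or.inl hx))
  obtain ⟨x₁, hx₁, hx₁s, hx₁b, hx₁m, hx₁m'⟩ := hm.exists_eq (t := t₁)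
    (fun x hx => hflip x (Or.inr hx))
  -- Each special vertex has an edge with two labels equal to its own in the outer face. If both
  -- labels were 0, the face rule would make it the same edge, joining the special vertices.
  have hmt₁ : m t₁ = 1 := by
    refine (Hypermap.zmod_two_cases _).resolve_left fun h0 => ?_
    have heq : x₀ = x₁ := (hface P.outer 0).unique
      ⟨hx₀.trans hf₀, hx₀m.trans hmt, hx₀m'.trans hmt⟩
      ⟨hx₁.trans hf₁, hx₁m.trans h0, hx₁m'.trans h0⟩
    subst heq
    rcases hx₀s with h | h <;> rcases hx₁s with h' | h'
    · exact hne (h.symm.trans h')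
    · exact hadj (by rw [← h, ← h']; exact x₀.adj)
    · exact hadj (by rw [← h, ← h']; exact x₀.adj.symm)
    · exact hne (h.symm.trans h')
  refine ⟨l, ⟨?_, ?_, ?_, ?_, hface, ?_⟩⟩
  · rintro (d | ⟨v, hv⟩) hd
    · exact (hconst t₀ (Or.inl rfl) d hd).trans hmt
    · exact absurd hv (hiso v)
  · rintro (d | ⟨v, hv⟩) hd
    · exact (hconst t₁ (Or.inr rfl) d hd).trans hmt₁
    · exact absurd hv (hiso v)
  · intro v hv0 hv1
    refine (P.vertexRule_iff l v).2 ?_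
    have := hv v
    rwa [if_neg (by tauto)] at this
  · exact (P.edgeRule_iff c l).2 ⟨o, hrec⟩
  · refine ⟨x₀.symm, snd_eq_white c hx₀b, hx₀b, hx₀s.symm, ?_, ?_, ?_⟩
    · rw [SimpleGraph.Dart.symm_symm]
      exact hx₀.trans hf₀
    · exact hx₀m'.trans hmt
    · have : l (headRight x₀.symm) = m x₀.symm.symm := rfl
      rw [this, SimpleGraph.Dart.symm_symm]
      exact hx₀m.trans hmt

end PlaneDrawing

end StrongLabeling

/-! ### Both directions of the theorem -/

namespace StrongLabeling

namespace PlaneDrawing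

variable {V : Type*} {G : SimpleGraph V} {P : PlaneDrawing G} {c : G.Coloring Shade} [Finite V]
  {s₀ s₁ : V}

open scoped Classical in
theorem stellation_nonadjacent [Nontrivial V] (hG : G.Connected) (hadj : ¬ G.Adj s₀ s₁) :
    (P.stellation c hG).Nonadjacent (P.special s₀ s₁) := by
  intro d i j hij hi hj
  have hdv : (P.stellation c hG).dv d = ![Sum.inr (P.leftFace d.1.symm), Sum.inl d.1.fst,
    Sum.inl d.1.snd] := rfl
  have hadj' : ∀ {a b : V}, G.Adj a b → (a = s₀ ∨ a = s₁) → ¬ (b = s₀ ∨ b = s₁) := by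
    rintro a b hab (rfl | rfl) (rfl | rfl)
    · exact hab.ne rfl
    · exact hadj hab
    · exact hadj hab.symm
    · exact hab.ne rfl
  rw [hdv] at hi hj
  fin_cases i <;> fin_cases j <;> simp [special] at hi hj hij
  · exact hadj' d.1.adj hi hj
  · exact hadj' d.1.adj hj hi

theorem IsGeneralizedStrongLabeling.conditions (hne : s₀ ≠ s₁) (h₀ : P.OnOuterFace s₀)
    (h₁ : P.OnOuterFace s₁) {l : Angle G → Fin 2} (hl : P.IsGeneralizedStrongLabeling c s₀ s₁ l) :
    ¬ G.Adj s₀ s₁ ∧ WeaklyTwoConnected G s₀ s₁ ∧ ¬ P.HasBlockWithRightChord c s₀ s₁ := by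
  classical
  have : Nontrivial V := ⟨s₀, s₁, hne⟩
  have hG := hl.connected hne
  have hadj := hl.not_adj
  obtain ⟨o, ho⟩ := hl.exists_isOmission hG
  have hE := P.stellation_card c hG
  have hD := P.digonRule_of_stellation c s₀ s₁ hG
    ((P.stellation c hG).digonRule_of_isOmission hE (P.stellation_star c hG) ho)
  have hT := P.triangleRule_of_stellation c s₀ s₁ hG
    ((P.stellation c hG).triangleRule_of_isOmission hE (P.stellation_star c hG) ho)
  exact ⟨hadj, hD.weaklyTwoConnected c hG hne hadj h₀ h₁,
    not_hasBlockWithRightChord hD hT hG hne hadj h₀ h₁⟩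

theorem exists_label (hne : s₀ ≠ s₁) (h₀ : P.OnOuterFace s₀) (h₁ : P.OnOuterFace s₁)
    (hadj : ¬ G.Adj s₀ s₁) (hW : WeaklyTwoConnected G s₀ s₁)
    (hB : ¬ P.HasBlockWithRightChord c s₀ s₁) :
    ∃ l, P.IsGeneralizedStrongLabeling c s₀ s₁ l := by
  classical
  have : Nontrivial V := ⟨s₀, s₁, hne⟩
  have hG := connected_of_weaklyTwoConnected hW
  have hS : (P.special s₀ s₁).card = 2 :=
    Finset.card_pair fun h => hne (Sum.inl.inj h)
  have : Nonempty (WhiteDart c) := by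
    obtain ⟨d, _⟩ := exists_dart hG s₀
    by_cases hd : c d.fst = Shade.white
    · exact ⟨⟨d, hd⟩⟩
    · exact ⟨⟨d.symm, (snd_white_iff c d).2 hd⟩⟩
  obtain ⟨o, ho⟩ := (P.stellation c hG).exists_isOmission (P.stellation_card c hG) hS
    (P.stellation_digonRule c s₀ s₁ hG (P.digonRule_of_weaklyTwoConnected hW))
    (P.stellation_triangleRule c s₀ s₁ hG
      (P.triangleRule_of_not_hasBlockWithRightChord c hG hne hadj h₀ h₁ hW hB))
    (stellation_nonadjacent hG hadj)
  exact exists_label_of_isOmission hG hne hadj h₀ h₁ ho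

end PlaneDrawing

end StrongLabeling

open StrongLabeling in
theorem mainTheorem6 {V : Type*} [Finite V] (G : SimpleGraph V) (P : PlaneDrawing G)
    (c : G.Coloring Shade) (s₀ s₁ : V) (hne : s₀ ≠ s₁)
    (h₀ : P.OnOuterFace s₀) (h₁ : P.OnOuterFace s₁) :
    (∃ l : Angle G → Fin 2, P.IsGeneralizedStrongLabeling c s₀ s₁ l) ↔
      ¬ G.Adj s₀ s₁ ∧ WeaklyTwoConnected G s₀ s₁ ∧ ¬ P.HasBlockWithRightChord c s₀ s₁ :=
  ⟨fun ⟨_, hl⟩ => hl.conditions hne h₀ h₁,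
    fun ⟨hadj, hW, hB⟩ => PlaneDrawing.exists_label hne h₀ h₁ hadj hW hB⟩
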